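/- Let $k\ge l\ge 1$ and let $\mathcal T$ be a maximal (unimodular) triangulation of the lattice trapezoid $\Delta_{k,l}\subset\mathbb R^2$ with vertices $(0,0),(0,1),(k,0),(l,1)$. Let $X=\widehat{G_{k,l}}^{*}$ be the smooth complete toric threefold whose fan in $\mathbb R^3$ is obtained from the cones over the triangles of $\mathcal T\times\{1\}$ by adding the rays generated by $(0,0,-1)$, $(0,-1,-1)$, $(1,0,0)$, $(-1,0,0)$ and the corresponding cones (it is the unique complete fan with these rays that contains the cones over $\mathcal T$). It is a compactification of the crepant resolution determined by $\mathcal T$ of $\{xy=z^kw^l\}\subset\mathbb C^4$. Let $z,w:X\to\mathbb P^1=\mathbb C\cup\{\infty\}$ be the toric functions given by the characters $(0,-1,1)$ and $(0,1,0)$. Fix any $T^3$-invariant Kähler form $\omega$ on $X$, and let $\pi_{T^1}:X\to\mathbb R$, with image the interval $I$, be a moment map of the circle action given by $(1,0,0)\in\mathbb Z^3$. The doubled Gross fibration is $$\pi:X\to B:=[-\infty,\infty]^2\times I,\qquad \pi=(b_1,b_2,b_3)=(\log|z-1|,\ \log|w-1|,\ \pi_{T^1}).$$ Let $B_0\subset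 B$ be the complement of the discriminant locus of $\pi$, that is, of the image of the set of points where $b_1$ or $b_2$ is infinite or where $\pi$ is not a submersion. For $b\in B_0$ put $F_b=\pi^{-1}(b)$. The wall $H$ of $\pi$ is the set of all $b\in B_0$ such that $F_b$ bounds a non-constant holomorphic disc of Maslov index $0$, that is, a non-constant map $u:(\overline{\mathbb D},\partial\overline{\mathbb D})\to(X,F_b)$, smooth on the closed unit disc and holomorphic in its interior, such that the loop of totally real subspaces $TF_b$ along $u|_{\partial\overline{\mathbb D}}$ has Maslov index $0$ in a trivialization of $u^*TX$ over the disc. Then $H$ is the union of the two vertical planes $b_1=0$ and $b_2=0$ in $B_0$: $$H=\{(b_1,b_2,b_3)\in B_0 \;:\; b_1=0\ \text{ or }\ b_2=0\}.$$ -/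

import Mathlib

open Set Filter Topology
open scoped ContDiff

noncomputable section

namespace DoubledGross

/-! ## Maximal triangulations of the trapezoid -/

/-- The lattice points of the trapezoid `Δ_{k,l}` with vertices `(0,0), (0,1), (k,0), (l,1)`:
the bottom points `(i,0)`, `0 ≤ i ≤ k`, and the top points `(j,1)`, `0 ≤ j ≤ l`. -/
abbrev Vertex (k l : ℕ) : Type := Fin (k + 1) ⊕ Fin (l + 1)

/-- The coordinates of a lattice point of the trapezoid. -/
def Vertex.coord {k l : ℕ} : Vertex k l → ℤ × ℤ :=
  Sum.elim (fun i => ((i : ℕ), 0)) (fun j => ((j : ℕ), 1))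

/-- A lattice point of the trapezoid as a point of the plane `ℝ²`. -/
def Vertex.point {k l : ℕ} (a : Vertex k l) : ℝ × ℝ := ((a.coord.1 : ℝ), (a.coord.2 : ℝ))

/-- The trapezoid `Δ_{k,l}`. -/
def trapezoid (k l : ℕ) : Set (ℝ × ℝ) :=
  convexHull ℝ {((0 : ℝ), (0 : ℝ)), ((0 : ℝ), (1 : ℝ)), ((k : ℝ), (0 : ℝ)), ((l : ℝ), (1 : ℝ))}

/-- Three lattice points span a standard triangle: the edge vectors at one of them form a
`ℤ`-basis of `ℤ²`. -/
def IsStandardTriangle {k l : ℕ} (s : Finset (Vertex k l)) : Prop :=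
  ∃ a b c : Vertex k l, s = {a, b, c} ∧
    |(b.coord.1 - a.coord.1) * (c.coord.2 - a.coord.2)
      - (c.coord.1 - a.coord.1) * (b.coord.2 - a.coord.2)| = 1

/-- The (closed, filled) simplex in the plane spanned by a set of lattice points. -/
def hull {k l : ℕ} (s : Finset (Vertex k l)) : Set (ℝ × ℝ) :=
  convexHull ℝ (Vertex.point '' (s : Set (Vertex k l)))

/-- A maximal triangulation of `Δ_{k,l}`: standard triangles that cover the trapezoid and
any two of which meet in the face spanned by their common vertices. -/
structure MaximalTriangulation (k l : ℕ) where
  triangles : Set (Finset (Vertex k l))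
  standard : ∀ s ∈ triangles, IsStandardTriangle s
  cover : ⋃ s ∈ triangles, hull s = trapezoid k l
  inter : ∀ s ∈ triangles, ∀ t ∈ triangles, hull s ∩ hull t = hull (s ∩ t)

/-! ## The fan -/

/-- The rays of the fan: one for each lattice point of the trapezoid and four additional ones. -/
abbrev Ray (k l : ℕ) : Type := Vertex k l ⊕ Fin 4

section Rays

variable {k l : ℕ}

/-- The ray through `(i,0,1)`. -/
abbrev bot (i : Fin (k + 1)) : Ray k l := Sum.inl (Sum.inl i)
/-- The ray through `(j,1,1)`. -/
abbrev top (j : Fin (l + 1)) : Ray k l := Sum.inl (Sum.inr j)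
/-- The ray through `(0,0,-1)`, belonging to the divisor `z = ∞`. -/
abbrev zInf : Ray k l := Sum.inr 0
/-- The ray through `(0,-1,-1)`, belonging to the divisor `w = ∞`. -/
abbrev wInf : Ray k l := Sum.inr 1
/-- The ray through `(1,0,0)`, belonging to the divisor `ξ = 0`. -/
abbrev xiZero : Ray k l := Sum.inr 2
/-- The ray through `(-1,0,0)`, belonging to the divisor `ξ = ∞`. -/
abbrev xiInf : Ray k l := Sum.inr 3

/-- The primitive generator in `ℤ³` of a ray. -/
def gen : Ray k l → Fin 3 → ℤ :=
  Sum.elim (fun a => ![a.coord.1, a.coord.2, 1])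
    ![![0, 0, -1], ![0, -1, -1], ![1, 0, 0], ![-1, 0, 0]]

end Rays

/-- The maximal cones of the complete fan obtained from the cone over a maximal triangulation of
`Δ_{k,l}` by adding the four rays `(0,0,-1), (0,-1,-1), (1,0,0), (-1,0,0)`. Under the projection
`(a,b,c) ↦ (c - b, b)` this fan maps to the fan of `ℙ¹ × ℙ¹`; the cones are listed quadrant by
quadrant. A cone is given by the set of its rays. -/
inductive IsMaxCone {k l : ℕ} (T : MaximalTriangulation k l) : Finset (Ray k l) → Prop
  | triangle (s : Finset (Vertex k l)) (hs : s ∈ T.triangles) :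
      IsMaxCone T (s.map Function.Embedding.inl)
  | left : IsMaxCone T {xiInf, bot 0, top 0}
  | right : IsMaxCone T {xiZero, bot (Fin.last k), top (Fin.last l)}
  | botEdge (i : Fin k) : IsMaxCone T {bot i.castSucc, bot i.succ, wInf}
  | botLeft : IsMaxCone T {xiInf, bot 0, wInf}
  | botRight : IsMaxCone T {xiZero, bot (Fin.last k), wInf}
  | topEdge (j : Fin l) : IsMaxCone T {top j.castSucc, top j.succ, zInf}
  | topLeft : IsMaxCone T {xiInf, top 0, zInf}
  | topRight : IsMaxCone T {xiZero, top (Fin.last l), zInf}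
  | infLeft : IsMaxCone T {xiInf, zInf, wInf}
  | infRight : IsMaxCone T {xiZero, zInf, wInf}

/-- The maximal cones as a type. -/
abbrev Cone {k l : ℕ} (T : MaximalTriangulation k l) : Type :=
  {σ : Finset (Ray k l) // IsMaxCone T σ}

/-! ## The toric variety -/

/-- Homogeneous coordinates of points of the toric variety: the coordinates outside some maximal
cone are all non-zero. -/
abbrev Homog {k l : ℕ} (T : MaximalTriangulation k l) : Type :=
  {Z : Ray k l → ℂ // ∃ σ : Cone T, ∀ ρ, ρ ∉ σ.1 → Z ρ ≠ 0}

/-- Two systems of homogeneous coordinates give the same point if they differ by an element `g` of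
`{g ∈ (ℂ^×)^{Σ(1)} | ∏ g_ρ^⟨m, v_ρ⟩ = 1 for all m ∈ ℤ³}`. -/
def homogSetoid {k l : ℕ} (T : MaximalTriangulation k l) : Setoid (Homog T) where
  r Z Z' := ∃ g : Ray k l → ℂˣ,
    (∀ m : Fin 3 → ℤ, ∏ ρ, g ρ ^ (m ⬝ᵥ gen ρ) = 1) ∧ ∀ ρ, Z'.1 ρ = g ρ * Z.1 ρ
  iseqv :=
    { refl := fun Z => ⟨1, by simp, by simp⟩
      symm := by
        rintro Z Z' ⟨g, hg, h⟩
        refine ⟨g⁻¹, fun m => ?_, fun ρ => ?_⟩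
        · simp [hg m]
        · simp [h ρ]
      trans := by
        rintro Z Z' Z'' ⟨g, hg, h⟩ ⟨g', hg', h'⟩
        refine ⟨g' * g, fun m => ?_, fun ρ => ?_⟩
        · simp [mul_zpow, Finset.prod_mul_distrib, hg m, hg' m]
        · simp [h ρ, h' ρ, mul_assoc] }

/-- The toric compactification of the resolved generalized conifold, as the quotient of
the space of homogeneous coordinates. -/
def Space {k l : ℕ} (T : MaximalTriangulation k l) : Type := Quotient (homogSetoid T)

/-- The coordinate space `ℂ³` of the affine chart of a maximal cone, with one coordinate for each
ray of the cone. -/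
abbrev Coord {k l : ℕ} {T : MaximalTriangulation k l} (σ : Cone T) : Type :=
  {ρ : Ray k l // ρ ∈ σ.1} → ℂ

section Space

variable {k l : ℕ} {T : MaximalTriangulation k l}

/-- The homogeneous coordinates of a point of an affine chart: all others are set to one. -/
def extend (σ : Cone T) (p : Coord σ) (ρ : Ray k l) : ℂ :=
  if h : ρ ∈ σ.1 then p ⟨ρ, h⟩ else 1

/-- The holomorphic affine chart `ℂ³ → X` of a maximal cone; these charts form the atlas of the
complex manifold `X`. -/
def chart (σ : Cone T) (p : Coord σ) : Space T :=
  Quotient.mk (homogSetoid T) ⟨extend σ p, σ, fun ρ hρ => by simp [extend, hρ]⟩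

/-- The monomial function `χ^{(0,-1,1)}` in homogeneous coordinates, where it is finite. -/
def zVal (Z : Ray k l → ℂ) : ℂ := (∏ i : Fin (k + 1), Z (bot i)) / Z zInf

/-- The monomial function `χ^{(0,1,0)}` in homogeneous coordinates, where it is finite. -/
def wVal (Z : Ray k l → ℂ) : ℂ := (∏ j : Fin (l + 1), Z (top j)) / Z wInf

theorem zVal_eq {Z Z' : Ray k l → ℂ} (g : Ray k l → ℂˣ)
    (hg : ∀ m : Fin 3 → ℤ, ∏ ρ, g ρ ^ (m ⬝ᵥ gen ρ) = 1) (h : ∀ ρ, Z' ρ = g ρ * Z ρ) :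
    zVal Z' = zVal Z := by
  have h1 := hg ![0, -1, 1]
  simp [Fintype.prod_sum_type, gen, Vertex.coord, dotProduct, Fin.sum_univ_three,
    Fin.prod_univ_four] at h1
  have h2 : (∏ i : Fin (k + 1), (g (bot i) : ℂ)) = g zInf := by
    rw [mul_inv_eq_one] at h1
    rw [← h1]
    simp
  simp only [zVal, h, Finset.prod_mul_distrib, h2]
  rw [mul_div_mul_left _ _ (Units.ne_zero _)]

theorem wVal_eq {Z Z' : Ray k l → ℂ} (g : Ray k l → ℂˣ)
    (hg : ∀ m : Fin 3 → ℤ, ∏ ρ, g ρ ^ (m ⬝ᵥ gen ρ) = 1) (h : ∀ ρ, Z' ρ = g ρ * Z ρ) :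
    wVal Z' = wVal Z := by
  have h1 := hg ![0, 1, 0]
  simp [Fintype.prod_sum_type, gen, Vertex.coord, dotProduct, Fin.sum_univ_three,
    Fin.prod_univ_four] at h1
  have h2 : (∏ j : Fin (l + 1), (g (top j) : ℂ)) = g wInf := by
    rw [mul_inv_eq_one] at h1
    rw [← h1]
    simp
  simp only [wVal, h, Finset.prod_mul_distrib, h2]
  rw [mul_div_mul_left _ _ (Units.ne_zero _)]

open Classical in
/-- The toric function `z : X → ℙ¹ = ℂ ∪ {∞}`. -/
def z : Space T → OnePoint ℂ :=
  Quotient.lift (fun Z : Homog T => if Z.1 zInf = 0 then OnePoint.infty else ((zVal Z.1 : ℂ) :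
      OnePoint ℂ)) (by
    rintro Z Z' ⟨g, hg, h⟩
    have h0 : Z'.1 zInf = 0 ↔ Z.1 zInf = 0 := by simp [h]
    simp only [h0, zVal_eq g hg h])

open Classical in
/-- The toric function `w : X → ℙ¹ = ℂ ∪ {∞}`. -/
def w : Space T → OnePoint ℂ :=
  Quotient.lift (fun Z : Homog T => if Z.1 wInf = 0 then OnePoint.infty else ((wVal Z.1 : ℂ) :
      OnePoint ℂ)) (by
    rintro Z Z' ⟨g, hg, h⟩
    have h0 : Z'.1 wInf = 0 ↔ Z.1 wInf = 0 := by simp [h]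
    simp only [h0, wVal_eq g hg h])

end Space

/-- The function `ζ ↦ log |ζ - 1|` on `ℂ ∪ {∞}` with values in `[-∞,∞]`. -/
def logDist : OnePoint ℂ → EReal := fun ζ =>
  ζ.elim (⊤ : EReal) (fun c : ℂ => ENNReal.log ‖c - 1‖ₑ)

/-! ## Toric Kähler forms and moment maps -/

/-- A smooth Kähler form on `X` that is invariant under the compact torus `T³`, given by its
expressions in the affine charts. -/
structure ToricKahlerForm {k l : ℕ} (T : MaximalTriangulation k l) where
  /-- the expression in the chart of a maximal cone -/
  form : (σ : Cone T) → Coord σ → Coord σ [⋀^Fin 2]→L[ℝ] ℝ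
  smooth : ∀ σ, ContDiff ℝ ∞ (form σ)
  /-- the expressions in two charts agree under the transition map `ψ` between the charts -/
  compat : ∀ (σ τ : Cone T) (p : Coord σ) (ψ : Coord σ → Coord τ), DifferentiableAt ℝ ψ p →
    (∀ᶠ p' in 𝓝 p, chart τ (ψ p') = chart σ p') →
    form σ p = (form τ (ψ p)).compContinuousLinearMap (fderiv ℝ ψ p)
  closed : ∀ σ p, extDeriv (form σ) p = 0
  /-- type `(1,1)` -/
  invariant_J : ∀ σ p v v', form σ p ![Complex.I • v, Complex.I • v'] = form σ p ![v, v']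
  positive : ∀ σ p v, v ≠ 0 → 0 < form σ p ![v, Complex.I • v]
  /-- In the chart of a maximal cone the compact torus acts as the group of all
  rotations of the three coordinates. -/
  invariant_torus : ∀ σ (s : {ρ : Ray k l // ρ ∈ σ.1} → Circle) (p v v' : Coord σ),
    form σ (fun ρ => s ρ * p ρ) ![fun ρ => s ρ * v ρ, fun ρ => s ρ * v' ρ] = form σ p ![v, v']

section Fibration

variable {k l : ℕ} {T : MaximalTriangulation k l}

/-- `μ` is a moment map for the circle subgroup of the torus given by `n ∈ ℤ³`. In the chart of a
maximal cone the circle acts with weights `a`, the coordinates of `n` in the basis of `ℤ³` formed by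
the generators of the cone, so its generating vector field is `p ↦ (i a_ρ p_ρ)_ρ`.
The sign is the one for which `κ = dμ ∧ dθ + ⋯`. -/
structure IsMomentMap (κ : ToricKahlerForm T) (n : Fin 3 → ℤ) (μ : Space T → ℝ) : Prop where
  smooth : ∀ σ, ContDiff ℝ ∞ (fun p => μ (chart σ p))
  deriv_eq : ∀ (σ : Cone T) (a : {ρ : Ray k l // ρ ∈ σ.1} → ℤ), ∑ ρ, a ρ • gen ρ.1 = n →
    ∀ p v : Coord σ, fderiv ℝ (fun p => μ (chart σ p)) p v =
      κ.form σ p ![v, fun ρ => Complex.I * a ρ * p ρ]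

/-! ## The doubled Gross fibration -/

/-- The fibration `π = (log |z - 1|, log |w - 1|, μ)`. -/
def fibration (μ : Space T → ℝ) (x : Space T) : EReal × EReal × ℝ :=
  (logDist (z x), logDist (w x), μ x)

/-- The base `B = [-∞,∞]² × I`, where the interval `I` is the image of the moment map. -/
def base (μ : Space T → ℝ) : Set (EReal × EReal × ℝ) := {b | b.2.2 ∈ range μ}

/-- The fibration in an affine chart, at points with `z, w ∉ {1, ∞}`. -/
def fibrationInChart (μ : Space T → ℝ) (σ : Cone T) (p : Coord σ) : ℝ × ℝ × ℝ :=
  (Real.log ‖zVal (extend σ p) - 1‖, Real.log ‖wVal (extend σ p) - 1‖, μ (chart σ p))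

/-- A regular point of the fibration: `π` has finite coordinates there and is a submersion. -/
def IsRegularPoint (μ : Space T → ℝ) (x : Space T) : Prop :=
  z x ≠ OnePoint.infty ∧ z x ≠ ((1 : ℂ) : OnePoint ℂ) ∧
  w x ≠ OnePoint.infty ∧ w x ≠ ((1 : ℂ) : OnePoint ℂ) ∧
  ∀ (σ : Cone T) (p : Coord σ), chart σ p = x →
    Function.Surjective (fderiv ℝ (fibrationInChart μ σ) p)

/-- The discriminant locus: the image of the points that are not regular. -/
def discriminant (μ : Space T → ℝ) : Set (EReal × EReal × ℝ) :=
  fibration μ '' {x | ¬ IsRegularPoint μ x}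

/-- `B₀`, the complement of the discriminant locus in the base. -/
def regularBase (μ : Space T → ℝ) : Set (EReal × EReal × ℝ) := base μ \ discriminant μ

/-- The tangent space of the fiber of `π` through a regular point, in an affine chart. -/
def fiberTangent (μ : Space T → ℝ) (σ : Cone T) (p : Coord σ) : Set (Coord σ) :=
  {v | fderiv ℝ (fibrationInChart μ σ) p v = 0}

/-! ## Holomorphic discs and the Maslov index -/

/-- The closed unit disc. -/
abbrev disc : Set ℂ := Metric.closedBall 0 1

/-- `u` restricts to a map from the closed unit disc to `X` which is smooth up to
the boundary and holomorphic in the interior. -/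
def IsHolomorphicDisc (u : ℂ → Space T) : Prop :=
  ∀ t ∈ disc, ∃ (σ : Cone T) (g : ℂ → Coord σ) (W : Set ℂ), IsOpen W ∧ t ∈ W ∧
    ContDiffOn ℝ ∞ g (W ∩ disc) ∧ DifferentiableOn ℂ g (W ∩ Metric.ball 0 1) ∧
    ∀ s ∈ W ∩ disc, u s = chart σ (g s)

/-- `e` is a continuous complex trivialization `disc × ℂ³ ≅ u^* TX` over the closed disc,
given by its expressions in the affine charts. -/
structure IsTrivialization (u : ℂ → Space T)
    (e : (σ : Cone T) → ℂ → (Fin 3 → ℂ) →L[ℂ] Coord σ) : Prop where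
  bijective : ∀ σ, ∀ t ∈ disc, u t ∈ range (chart σ) → Function.Bijective (e σ t)
  compat : ∀ (σ τ : Cone T), ∀ t ∈ disc, ∀ (p : Coord σ) (ψ : Coord σ → Coord τ),
    u t = chart σ p → DifferentiableAt ℂ ψ p →
    (∀ᶠ p' in 𝓝 p, chart τ (ψ p') = chart σ p') → e τ t = (fderiv ℂ ψ p).comp (e σ t)
  continuous : ∀ σ, ContinuousOn (e σ) {t | t ∈ disc ∧ u t ∈ range (chart σ)}

/-- The disc `u`, with boundary on a regular fiber of `π`, has Maslov index `n`: in a trivialization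
of `u^* TX`, the loop of (totally real) tangent spaces of the fiber along the boundary
has the phase `det² / |det|²` of degree `n`, where the columns of the matrix `A` are a real
basis of the tangent space. -/
def HasMaslovIndex (μ : Space T → ℝ) (u : ℂ → Space T) (n : ℤ) : Prop :=
  ∃ (e : (σ : Cone T) → ℂ → (Fin 3 → ℂ) →L[ℂ] Coord σ) (φ : ℝ → ℝ),
    IsTrivialization u e ∧ Continuous φ ∧ φ (2 * Real.pi) = φ 0 + 2 * Real.pi * n ∧
    ∀ (θ : ℝ) (σ : Cone T) (p : Coord σ), u (Complex.exp (θ * Complex.I)) = chart σ p →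
      ∀ A : Matrix (Fin 3) (Fin 3) ℂ,
        LinearIndependent ℝ (fun j => e σ (Complex.exp (θ * Complex.I)) (A.col j)) →
        (∀ j, e σ (Complex.exp (θ * Complex.I)) (A.col j) ∈ fiberTangent μ σ p) →
        A.det ^ 2 = (‖A.det‖ : ℂ) ^ 2 * Complex.exp (φ θ * Complex.I)

/-- The wall: the points `b` of `B₀` whose fiber bounds a non-constant holomorphic disc of Maslov
index zero. -/
def wall (μ : Space T → ℝ) : Set (EReal × EReal × ℝ) :=
  {b | b ∈ regularBase μ ∧ ∃ u : ℂ → Space T, IsHolomorphicDisc u ∧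
    (∀ t : ℂ, ‖t‖ = 1 → fibration μ (u t) = b) ∧
    (∃ s ∈ disc, ∃ t ∈ disc, u s ≠ u t) ∧ HasMaslovIndex μ u 0}

end Fibration

end DoubledGross

end

noncomputable section
namespace DoubledGross

variable {k l : ℕ} {T : MaximalTriangulation k l}

/-! ## Cones and charts -/


/-! Let ξ be the character (1,0,0). Up to sign, the form Ω = dlog ξ ∧ dz ∧ dw / ((z-1)(w-1)) is a
holomorphic volume form on X with simple poles exactly along ξ = 0, ξ = ∞, z = ∞, w = ∞, z = 1 and w
= 1. In homogeneous coordinates its polar divisor is cut out by `polar`. Through a generic point the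
tangent space of the fiber is spanned by the circle direction and by i(z-1)∂_z and i(w-1)∂_w, the
last two corrected by multiples of the radial vector ξ∂_ξ. Hence Ω has constant phase on the fiber
(`frameVolume_phase`). So the Maslov index of a disc with generic boundary is twice the number of
its intersections with the polar divisor. These all count positively, being zeros of a holomorphic
function (`frameVolume_local`, `order_eq_zero_of_phase`).

Wall ⊆ planes (`wall_subset`). If b₁ and b₂ are non-zero, then z, w ≠ 0 on the fiber, and regularity
puts the fiber into the open torus. A disc of index zero avoids the polar divisor, so z-1 and w-1
are holomorphic without zeros on the disc and have constant modulus on its boundary. By the maximum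
principle for these functions and their inverses, z and w are constant, hence non-zero, and the disc
lies in one orbit of ℂ^×. There the moment map is a strictly monotone function of |ξ|
(`moment_eq_iff`), so the same principle applied to 1/ξ makes the disc constant.

Planes ⊆ wall. Inside z = 0, each level of w is a chain of projective lines running from ξ = ∞ to ξ
= 0. The moment map is maximal at the first end and minimal at the other, so by the intermediate
value theorem it takes every value of I on the chain (`EdgeChain.exists_triPoint`). Hence every
fiber over b₁ = 0 contains a point of such a chain, and by regularity this is not a fixed point of
the circle. Its circle orbit bounds a disc in its line, centered at a node. In the chart at the node
the circle rotates the tangent and the normal coordinate with opposite weights, so the phase is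
constant and the index is zero (`EdgeCone.mem_wall`). The plane b₂ = 0 is symmetric. -/

theorem exists_equiv_of_det {s : Finset (Ray k l)} {a b c : Ray k l} (hs : s = {a, b, c})
    (hdet : IsUnit (Matrix.of ![gen a, gen b, gen c]).det) :
    ∃ f : Fin 3 ≃ {ρ // ρ ∈ s}, IsUnit (Matrix.of fun i => gen (f i).1).det := by
  have hne : ∀ x y : Fin 3, x ≠ y → (![a, b, c] : Fin 3 → Ray k l) x ≠ ![a, b, c] y := by
    intro x y hxy h
    have h0 : (Matrix.of ![gen a, gen b, gen c]).det = 0 := by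
      refine Matrix.det_zero_of_row_eq hxy ?_
      have h1 : ∀ x : Fin 3, (![gen a, gen b, gen c] : Fin 3 → Fin 3 → ℤ) x =
          gen ((![a, b, c] : Fin 3 → Ray k l) x) := by
        intro x; fin_cases x <;> rfl
      change (![gen a, gen b, gen c] : Fin 3 → Fin 3 → ℤ) x = ![gen a, gen b, gen c] y
      rw [h1, h1, h]
    rw [h0] at hdet
    exact not_isUnit_zero hdet
  subst hs
  let f : Fin 3 → {ρ // ρ ∈ ({a, b, c} : Finset (Ray k l))} := fun i =>
    ⟨![a, b, c] i, by fin_cases i <;> simp⟩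
  have hf : Function.Bijective f := by
    constructor
    · intro x y h
      by_contra hxy
      exact hne x y hxy (congrArg Subtype.val h)
    · rintro ⟨ρ, hρ⟩
      simp only [Finset.mem_insert, Finset.mem_singleton] at hρ
      rcases hρ with rfl | rfl | rfl
      · exact ⟨0, rfl⟩
      · exact ⟨1, rfl⟩
      · exact ⟨2, rfl⟩
  refine ⟨Equiv.ofBijective f hf, ?_⟩
  convert hdet using 3
  ext i j
  fin_cases i <;> rfl

/-- The fan is smooth. For a cone over a triangle the determinant is, up to sign, the one in
`IsStandardTriangle`, because the generators are the vertices placed at height one. The other cones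
are computed directly. -/
theorem Cone.exists_equiv (σ : Cone T) :
    ∃ f : Fin 3 ≃ {ρ // ρ ∈ σ.1}, IsUnit (Matrix.of fun i => gen (f i).1).det := by
  obtain ⟨σ, hσ⟩ := σ
  cases hσ with
  | triangle s hs =>
    obtain ⟨a, b, c, rfl, h⟩ := T.standard s hs
    refine exists_equiv_of_det (a := Sum.inl a) (b := Sum.inl b) (c := Sum.inl c)
      (by simp [Finset.map_insert]) ?_
    rw [Int.isUnit_iff_abs_eq, ← h]
    congr 1
    simp [Matrix.det_fin_three, gen]
    ring
  | left => exact exists_equiv_of_det rfl (by simp [Matrix.det_fin_three, gen, Vertex.coord])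
  | right => exact exists_equiv_of_det rfl (by simp [Matrix.det_fin_three, gen, Vertex.coord])
  | botEdge i => exact exists_equiv_of_det rfl (by simp [Matrix.det_fin_three, gen, Vertex.coord])
  | botLeft => exact exists_equiv_of_det rfl (by simp [Matrix.det_fin_three, gen, Vertex.coord])
  | botRight => exact exists_equiv_of_det rfl (by simp [Matrix.det_fin_three, gen, Vertex.coord])
  | topEdge j => exact exists_equiv_of_det rfl (by simp [Matrix.det_fin_three, gen, Vertex.coord])
  | topLeft => exact exists_equiv_of_det rfl (by simp [Matrix.det_fin_three, gen, Vertex.coord])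
  | topRight => exact exists_equiv_of_det rfl (by simp [Matrix.det_fin_three, gen, Vertex.coord])
  | infLeft => exact exists_equiv_of_det rfl (by simp [Matrix.det_fin_three, gen, Vertex.coord])
  | infRight => exact exists_equiv_of_det rfl (by simp [Matrix.det_fin_three, gen, Vertex.coord])

theorem Cone.exists_dual (σ : Cone T) : ∃ m : {ρ // ρ ∈ σ.1} → Fin 3 → ℤ,
    (∀ ρ ρ', m ρ ⬝ᵥ gen ρ'.1 = if ρ = ρ' then 1 else 0) ∧
      ∀ v, ∑ ρ, (m ρ ⬝ᵥ v) • gen ρ.1 = v := by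
  obtain ⟨f, hf⟩ := σ.exists_equiv
  set A : Matrix (Fin 3) (Fin 3) ℤ := Matrix.of fun i => gen (f i).1 with hA
  refine ⟨fun ρ j => A⁻¹ j (f.symm ρ), fun ρ ρ' => ?_, fun v => ?_⟩
  · have h := congrFun (congrFun (Matrix.mul_nonsing_inv A hf) (f.symm ρ')) (f.symm ρ)
    rw [Matrix.mul_apply, Matrix.one_apply] at h
    simp only [(f.symm.injective.eq_iff), hA, Matrix.of_apply, Equiv.apply_symm_apply] at h
    simp only [dotProduct, eq_comm (a := ρ), ← h]
    exact Finset.sum_congr rfl fun j _ => mul_comm _ _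
  · rw [← Equiv.sum_comp f]
    have h := Matrix.nonsing_inv_mul A hf
    have h2 := congrArg (fun M => Matrix.vecMul v M) h
    simp only [Matrix.vecMul_one, ← Matrix.vecMul_vecMul] at h2
    conv_rhs => rw [← h2]
    ext j
    simp [Matrix.vecMul, dotProduct, hA, Finset.sum_apply, mul_comm]

/-- The basis of the character lattice dual to the generators of a maximal cone. -/
def dual (σ : Cone T) : {ρ // ρ ∈ σ.1} → Fin 3 → ℤ := σ.exists_dual.choose

theorem dual_gen (σ : Cone T) (ρ ρ' : {ρ // ρ ∈ σ.1}) :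
    dual σ ρ ⬝ᵥ gen ρ'.1 = if ρ = ρ' then 1 else 0 := σ.exists_dual.choose_spec.1 ρ ρ'

theorem sum_dual (σ : Cone T) (v : Fin 3 → ℤ) : ∑ ρ, (dual σ ρ ⬝ᵥ v) • gen ρ.1 = v :=
  σ.exists_dual.choose_spec.2 v

/-- The coordinates in the chart of a maximal cone in terms of homogeneous coordinates. -/
def toCoord (σ : Cone T) (Z : Ray k l → ℂ) : Coord σ := fun ρ =>
  Z ρ * ∏ ρ' ∈ σ.1ᶜ, Z ρ' ^ (dual σ ρ ⬝ᵥ gen ρ')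

theorem prod_mul_compl {M : Type*} [CommMonoid M] (σ : Cone T) (f : Ray k l → M) :
    ∏ ρ, f ρ = (∏ ρ : {ρ // ρ ∈ σ.1}, f ρ) * ∏ ρ ∈ σ.1ᶜ, f ρ := by
  rw [← Finset.prod_mul_prod_compl σ.1 f, Finset.prod_coe_sort σ.1 f]

/-- By duality the exponents on the rays of the cone are 0 except for a single 1. Splitting that
factor off, as `toCoord` does, leaves negative exponents only on coordinates that do not vanish on
the chart. -/
theorem mul_prod_compl_zpow {M : Type*} [DivisionCommMonoid M] (σ : Cone T)
    (ρ : {ρ // ρ ∈ σ.1}) (f : Ray k l → M) :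
    f ρ * ∏ ρ' ∈ σ.1ᶜ, f ρ' ^ (dual σ ρ ⬝ᵥ gen ρ') = ∏ ρ', f ρ' ^ (dual σ ρ ⬝ᵥ gen ρ') := by
  rw [prod_mul_compl σ]
  congr 1
  simp only [dual_gen]
  rw [Finset.prod_eq_single ρ]
  · simp
  · intro ρ' _ h
    simp [h.symm]
  · simp

theorem toCoord_eq {Z Z' : Ray k l → ℂ} (σ : Cone T) (g : Ray k l → ℂˣ)
    (hg : ∀ m : Fin 3 → ℤ, ∏ ρ, g ρ ^ (m ⬝ᵥ gen ρ) = 1) (h : ∀ ρ, Z' ρ = g ρ * Z ρ) :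
    toCoord σ Z' = toCoord σ Z := by
  ext ρ
  have h1 : (g ρ : ℂ) * ∏ ρ' ∈ σ.1ᶜ, (g ρ' : ℂ) ^ (dual σ ρ ⬝ᵥ gen ρ') = 1 := by
    rw [mul_prod_compl_zpow σ ρ (fun ρ => (g ρ : ℂ))]
    have := congrArg Units.val (hg (dual σ ρ))
    simpa using this
  simp only [toCoord, h, mul_zpow, Finset.prod_mul_distrib]
  linear_combination (Z ρ * ∏ ρ' ∈ σ.1ᶜ, Z ρ' ^ (dual σ ρ ⬝ᵥ gen ρ')) * h1

/-- The coordinates in the chart of a maximal cone, extended by junk values outside the chart. -/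
def coordOf (σ : Cone T) : Space T → Coord σ :=
  Quotient.lift (fun Z : Homog T => toCoord σ Z.1) (by
    rintro Z Z' ⟨g, hg, h⟩
    exact (toCoord_eq σ g hg h).symm)

theorem extend_mem (σ : Cone T) (p : Coord σ) (ρ : {ρ // ρ ∈ σ.1}) : extend σ p ρ = p ρ := by
  simp [extend]

theorem extend_notMem (σ : Cone T) (p : Coord σ) {ρ : Ray k l} (h : ρ ∉ σ.1) :
    extend σ p ρ = 1 := by
  simp [extend, h]

theorem toCoord_extend (σ : Cone T) (p : Coord σ) : toCoord σ (extend σ p) = p := by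
  ext ρ
  rw [toCoord, extend_mem, Finset.prod_eq_one, mul_one]
  intro ρ' h
  rw [extend_notMem σ p (by simpa using h), one_zpow]

theorem prod_zpow_eq_zpow_sum {ι G : Type*} [CommGroup G] (s : Finset ι) (a : G) (n : ι → ℤ) :
    ∏ i ∈ s, a ^ n i = a ^ ∑ i ∈ s, n i := by
  classical
  induction s using Finset.induction_on with
  | empty => simp
  | insert i s hi ih => rw [Finset.prod_insert hi, Finset.sum_insert hi, zpow_add, ih]

/-- The generators of the cone form a basis of the lattice, so any rescaling of the coordinates
outside the cone to 1 extends uniquely to an element of the group that is divided out. The dual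
basis gives its components inside the cone. -/
theorem chart_toCoord (σ : Cone T) (Z : Homog T) (h : ∀ ρ, ρ ∉ σ.1 → Z.1 ρ ≠ 0) :
    chart σ (toCoord σ Z.1) = Quotient.mk (homogSetoid T) Z := by
  symm
  apply Quotient.sound
  let y : Ray k l → ℂˣ := fun ρ => if h' : Z.1 ρ = 0 then 1 else Units.mk0 _ h'
  have hy : ∀ ρ, ρ ∉ σ.1 → (y ρ : ℂ) = Z.1 ρ := fun ρ hρ => by simp [y, h ρ hρ]
  let g : Ray k l → ℂˣ := fun ρ =>
    if hρ : ρ ∈ σ.1 then ∏ ρ' ∈ σ.1ᶜ, y ρ' ^ (dual σ ⟨ρ, hρ⟩ ⬝ᵥ gen ρ') else (y ρ)⁻¹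
  refine ⟨g, fun m => ?_, fun ρ => ?_⟩
  · have h1 : ∏ ρ : {ρ // ρ ∈ σ.1}, g ρ ^ (m ⬝ᵥ gen ρ.1) = ∏ ρ ∈ σ.1ᶜ, y ρ ^ (m ⬝ᵥ gen ρ) := by
      calc _ = ∏ ρ : {ρ // ρ ∈ σ.1}, ∏ ρ' ∈ σ.1ᶜ,
              y ρ' ^ ((dual σ ρ ⬝ᵥ gen ρ') * (m ⬝ᵥ gen ρ.1)) := by
            refine Finset.prod_congr rfl fun ρ _ => ?_
            simp only [g, ρ.2, dif_pos, ← Finset.prod_zpow, zpow_mul]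
        _ = _ := by
            rw [Finset.prod_comm]
            refine Finset.prod_congr rfl fun ρ' _ => ?_
            rw [prod_zpow_eq_zpow_sum]
            congr 1
            conv_rhs => rw [← sum_dual σ (gen ρ')]
            simp only [dotProduct_sum, dotProduct_smul, smul_eq_mul]
    rw [prod_mul_compl σ, h1, ← Finset.prod_mul_distrib]
    refine Finset.prod_eq_one fun ρ hρ => ?_
    have hρ' : ρ ∉ σ.1 := by simpa using hρ
    simp [g, hρ']
  · by_cases hρ : ρ ∈ σ.1
    · have h2 := extend_mem σ (toCoord σ Z.1) ⟨ρ, hρ⟩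
      simp only at h2
      simp only [h2, toCoord, g, hρ, dif_pos]
      rw [mul_comm]
      congr 1
      push_cast
      refine Finset.prod_congr rfl fun ρ' hρ' => ?_
      rw [hy ρ' (by simpa using hρ')]
    · simp only [extend_notMem σ _ hρ, g, hρ, dif_neg, not_false_eq_true]
      push_cast
      rw [hy ρ hρ, inv_mul_cancel₀ (h ρ hρ)]

theorem mk_mem_range_chart (σ : Cone T) (Z : Homog T) :
    Quotient.mk (homogSetoid T) Z ∈ range (chart σ) ↔ ∀ ρ, ρ ∉ σ.1 → Z.1 ρ ≠ 0 := by
  constructor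
  · rintro ⟨p, hp⟩ ρ hρ
    obtain ⟨g, -, hg⟩ := Quotient.exact hp
    have : Z.1 ρ = g ρ * extend σ p ρ := hg ρ
    rw [this, extend_notMem σ p hρ]
    simp
  · exact fun h => ⟨_, chart_toCoord σ Z h⟩

theorem chart_mem_range_chart (σ τ : Cone T) (p : Coord σ) :
    chart σ p ∈ range (chart τ) ↔ ∀ ρ, ρ ∉ τ.1 → extend σ p ρ ≠ 0 := mk_mem_range_chart τ _

theorem coordOf_chart_self (σ : Cone T) (p : Coord σ) : coordOf σ (chart σ p) = p :=
  toCoord_extend σ p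

theorem chart_coordOf {σ : Cone T} {x : Space T} (h : x ∈ range (chart σ)) :
    chart σ (coordOf σ x) = x := by
  obtain ⟨p, rfl⟩ := h
  rw [coordOf_chart_self]

theorem chart_injective (σ : Cone T) : Function.Injective (chart σ) := fun p q h => by
  rw [← coordOf_chart_self σ p, h, coordOf_chart_self]

theorem exists_chart (x : Space T) : ∃ (σ : Cone T) (p : Coord σ), chart σ p = x := by
  induction x using Quotient.inductionOn with
  | h Z =>
    obtain ⟨σ, hσ⟩ := Z.2
    exact ⟨σ, _, chart_toCoord σ Z hσ⟩

theorem chart_eq_of_extend_eq {σ τ : Cone T} {p : Coord σ} {q : Coord τ}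
    (h : extend σ p = extend τ q) : chart σ p = chart τ q :=
  congrArg (Quotient.mk (homogSetoid T)) (Subtype.ext h)

/-! ## Transition maps -/

/-- The transition map between the charts of two maximal cones. -/
def transition (σ τ : Cone T) (p : Coord σ) : Coord τ := coordOf τ (chart σ p)

theorem chart_transition {σ τ : Cone T} {p : Coord σ} (h : chart σ p ∈ range (chart τ)) :
    chart τ (transition σ τ p) = chart σ p := chart_coordOf h

theorem contDiff_extend (σ : Cone T) (ρ : Ray k l) :
    ContDiff ℂ ∞ fun p : Coord σ => extend σ p ρ := by
  unfold extend
  split_ifs <;> fun_prop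

theorem continuous_extend (σ : Cone T) (ρ : Ray k l) :
    Continuous fun p : Coord σ => extend σ p ρ := (contDiff_extend σ ρ).continuous

theorem isOpen_preimage_range (σ τ : Cone T) : IsOpen {p | chart σ p ∈ range (chart τ)} := by
  simp only [chart_mem_range_chart, ofPred_forall]
  exact isOpen_iInter_of_finite fun ρ => isOpen_iInter_of_finite fun _ =>
    isOpen_ne_fun (continuous_extend σ ρ) continuous_const

theorem contDiffAt_zpow {E : Type*} [NormedAddCommGroup E] [NormedSpace ℂ E] {f : E → ℂ} {x : E}
    (hf : ContDiffAt ℂ ∞ f x) (h0 : f x ≠ 0) (n : ℤ) : ContDiffAt ℂ ∞ (fun y => f y ^ n) x := by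
  obtain ⟨m, rfl | rfl⟩ := n.eq_nat_or_neg
  · simpa using hf.pow m
  · simp only [zpow_neg, zpow_natCast]
    exact (hf.pow m).inv (pow_ne_zero _ h0)

theorem contDiffAt_transition {σ τ : Cone T} {p : Coord σ} (h : chart σ p ∈ range (chart τ)) :
    ContDiffAt ℂ ∞ (transition σ τ) p := by
  rw [chart_mem_range_chart] at h
  rw [contDiffAt_pi]
  intro ρ
  refine (contDiff_extend σ _).contDiffAt.mul (contDiffAt_prod fun ρ' hρ' => ?_)
  exact contDiffAt_zpow (contDiff_extend σ _).contDiffAt (h _ (by simpa using hρ')) _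

theorem eventually_chart_transition {σ τ : Cone T} {p : Coord σ}
    (h : chart σ p ∈ range (chart τ)) :
    ∀ᶠ p' in 𝓝 p, chart τ (transition σ τ p') = chart σ p' :=
  ((isOpen_preimage_range σ τ).eventually_mem h).mono fun _ => chart_transition

theorem extend_ne_zero {σ : Cone T} {p : Coord σ} (hp : ∀ ρ, p ρ ≠ 0) (ρ : Ray k l) :
    extend σ p ρ ≠ 0 := by
  unfold extend
  split_ifs
  · exact hp _
  · exact one_ne_zero

theorem mem_range_of_torus {σ : Cone T} (τ : Cone T) {p : Coord σ} (hp : ∀ ρ, p ρ ≠ 0) :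
    chart σ p ∈ range (chart τ) :=
  (chart_mem_range_chart σ τ p).2 fun ρ _ => extend_ne_zero hp ρ

theorem transition_ne_zero {σ : Cone T} (τ : Cone T) {p : Coord σ} (hp : ∀ ρ, p ρ ≠ 0) (ρ) :
    transition σ τ p ρ ≠ 0 :=
  mul_ne_zero (extend_ne_zero hp _)
    (Finset.prod_ne_zero_iff.2 fun _ _ => zpow_ne_zero _ (extend_ne_zero hp _))

theorem transition_eq_prod (σ τ : Cone T) (p : Coord σ) (ρ) :
    transition σ τ p ρ = ∏ ρ', p ρ' ^ (dual τ ρ ⬝ᵥ gen ρ'.1) := by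
  change extend σ p ρ * _ = _
  rw [mul_prod_compl_zpow τ ρ (extend σ p), prod_mul_compl σ]
  simp only [extend_mem]
  rw [Finset.prod_eq_one (s := σ.1ᶜ), mul_one]
  intro ρ' h
  rw [extend_notMem σ p (by simpa using h), one_zpow]

/-- On the torus the transition map is monomial, so its derivative is read off from logarithmic
derivatives of products of powers. -/
theorem fderiv_transition {σ : Cone T} (τ : Cone T) {p : Coord σ} (hp : ∀ ρ, p ρ ≠ 0)
    (v : Coord σ) (ρ) :
    fderiv ℂ (transition σ τ) p v ρ =
      transition σ τ p ρ * ∑ ρ', (dual τ ρ ⬝ᵥ gen ρ'.1 : ℤ) * (v ρ' / p ρ') := by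
  have hd : DifferentiableAt ℂ (transition σ τ) p :=
    (contDiffAt_transition (mem_range_of_torus τ hp)).differentiableAt (by simp)
  have h1 : HasDerivAt (fun t : ℂ => transition σ τ (p + t • v) ρ)
      (fderiv ℂ (transition σ τ) p v ρ) 0 := by
    have hl : HasDerivAt (fun t : ℂ => p + t • v) v 0 := by
      simpa using ((hasDerivAt_id (0 : ℂ)).smul_const v).const_add p
    have h2 : HasFDerivAt (transition σ τ) (fderiv ℂ (transition σ τ) p) (p + (0 : ℂ) • v) := by
      simpa using hd.hasFDerivAt
    exact hasDerivAt_pi.1 (h2.comp_hasDerivAt _ hl) ρ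
  simp only [transition_eq_prod] at h1
  have h3 := h1.deriv
  have hdf : ∀ ρ', HasDerivAt (fun t : ℂ => (p + t • v) ρ') (v ρ') 0 := by
    intro ρ'
    simpa using ((hasDerivAt_id (0 : ℂ)).mul_const (v ρ')).const_add (p ρ')
  have h4 := logDeriv_prod (𝕜 := ℂ) (𝕜' := ℂ) (s := Finset.univ)
    (f := fun ρ' (t : ℂ) => (p + t • v) ρ' ^ (dual τ ρ ⬝ᵥ gen ρ'.1)) (x := 0) ?_ ?_
  · rw [logDeriv_apply, h3] at h4
    simp only [zero_smul, add_zero] at h4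
    rw [← transition_eq_prod, div_eq_iff (transition_ne_zero τ hp ρ), mul_comm] at h4
    rw [h4]
    congr 1
    refine Finset.sum_congr rfl fun ρ' _ => ?_
    rw [logDeriv_fun_zpow (hdf ρ').differentiableAt, logDeriv_apply, (hdf ρ').deriv]
    simp
  · intro ρ' _
    simpa using zpow_ne_zero _ (hp ρ')
  · intro ρ' _
    exact (hdf ρ').differentiableAt.zpow (Or.inl (by simpa using hp ρ'))

/-- The map to `ℤ³ ⊗ ℂ` given by the generators of a maximal cone. -/
def genMap (σ : Cone T) : Coord σ →L[ℂ] (Fin 3 → ℂ) :=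
  LinearMap.toContinuousLinearMap
    { toFun := fun v j => ∑ ρ, v ρ * (gen ρ.1 j : ℂ)
      map_add' := fun v v' => by ext j; simp [add_mul, Finset.sum_add_distrib]
      map_smul' := fun c v => by ext j; simp [Finset.mul_sum, mul_assoc] }

theorem genMap_apply (σ : Cone T) (v : Coord σ) (j : Fin 3) :
    genMap σ v j = ∑ ρ, v ρ * (gen ρ.1 j : ℂ) := rfl

theorem genMap_injective (σ : Cone T) : Function.Injective (genMap σ) := by
  rw [injective_iff_map_eq_zero]
  intro v hv
  ext ρ
  have h1 : ∑ j, (dual σ ρ j : ℂ) * genMap σ v j = v ρ := by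
    simp only [genMap_apply, Finset.mul_sum]
    rw [Finset.sum_comm]
    calc _ = ∑ ρ', v ρ' * ((dual σ ρ ⬝ᵥ gen ρ'.1 : ℤ) : ℂ) := by
          refine Finset.sum_congr rfl fun ρ' _ => ?_
          simp only [dotProduct]
          push_cast
          rw [Finset.mul_sum]
          exact Finset.sum_congr rfl fun j _ => by ring
      _ = v ρ := by simp [dual_gen]
  rw [← h1, hv]
  simp

/-- The logarithmic differentials are independent of the chart. -/
theorem genMap_transition {σ : Cone T} (τ : Cone T) {p : Coord σ} (hp : ∀ ρ, p ρ ≠ 0)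
    (v : Coord σ) :
    genMap τ (fun ρ => fderiv ℂ (transition σ τ) p v ρ / transition σ τ p ρ) =
      genMap σ (fun ρ => v ρ / p ρ) := by
  ext j
  simp only [genMap_apply, fderiv_transition τ hp]
  have h1 : ∀ ρ' : Ray k l, ∑ ρ, ((dual τ ρ ⬝ᵥ gen ρ' : ℤ) : ℂ) * (gen ρ.1 j : ℂ) = gen ρ' j := by
    intro ρ'
    conv_rhs => rw [← sum_dual τ (gen ρ')]
    simp
  calc _ = ∑ ρ, ∑ ρ', (v ρ' / p ρ') * (((dual τ ρ ⬝ᵥ gen ρ'.1 : ℤ) : ℂ) * (gen ρ.1 j : ℂ)) := by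
        refine Finset.sum_congr rfl fun ρ _ => ?_
        rw [mul_div_cancel_left₀ _ (transition_ne_zero τ hp ρ), Finset.sum_mul]
        exact Finset.sum_congr rfl fun ρ' _ => by ring
    _ = _ := by
        rw [Finset.sum_comm]
        refine Finset.sum_congr rfl fun ρ' _ => ?_
        rw [← Finset.mul_sum, h1]

/-! ## Kähler forms on coordinate lines -/

theorem alternating_add_left {E : Type*} [NormedAddCommGroup E] [NormedSpace ℝ E]
    (f : E [⋀^Fin 2]→L[ℝ] ℝ) (v v' w : E) : f ![v + v', w] = f ![v, w] + f ![v', w] :=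
  f.toAlternatingMap.map_vecCons_add ![w] v v'

theorem alternating_smul_left {E : Type*} [NormedAddCommGroup E] [NormedSpace ℝ E]
    (f : E [⋀^Fin 2]→L[ℝ] ℝ) (c : ℝ) (v w : E) : f ![c • v, w] = c * f ![v, w] :=
  f.toAlternatingMap.map_vecCons_smul ![w] c v

theorem alternating_self {E : Type*} [NormedAddCommGroup E] [NormedSpace ℝ E]
    (f : E [⋀^Fin 2]→L[ℝ] ℝ) (v : E) : f ![v, v] = 0 :=
  f.map_eq_zero_of_eq ![v, v] (i := 0) (j := 1) rfl (by decide)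

theorem alternating_swap {E : Type*} [NormedAddCommGroup E] [NormedSpace ℝ E]
    (f : E [⋀^Fin 2]→L[ℝ] ℝ) (v w : E) : f ![v, w] = -f ![w, v] := by
  have h := alternating_self f (v + w)
  rw [alternating_add_left] at h
  have h1 : ∀ u : E, f ![u, v + w] = f ![u, v] + f ![u, w] := by
    intro u
    have h1 : ∀ x, Function.update ![u, v] 1 x = ![u, x] := by
      intro x
      ext i
      fin_cases i <;> rfl
    have h2 := f.map_update_add ![u, v] 1 v w
    rwa [h1, h1, h1] at h2
  rw [h1, h1, alternating_self, alternating_self] at h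
  linarith

/-- The norm of the coordinate vector field in a Kähler metric, squared. -/
def lineNorm (κ : ToricKahlerForm T) (σ : Cone T) (ρ : {ρ // ρ ∈ σ.1}) (p : Coord σ) : ℝ :=
  κ.form σ p ![Pi.single ρ 1, Complex.I • Pi.single ρ 1]

theorem lineNorm_pos (κ : ToricKahlerForm T) (σ : Cone T) (ρ : {ρ // ρ ∈ σ.1}) (p : Coord σ) :
    0 < lineNorm κ σ ρ p := κ.positive σ p _ (by simp)

/-- On a complex line a real 2-form is a multiple of the area form, and `lineNorm` is the factor. -/
theorem form_single (κ : ToricKahlerForm T) (σ : Cone T) (ρ : {ρ // ρ ∈ σ.1}) (p : Coord σ)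
    (x y : ℂ) : κ.form σ p ![Pi.single ρ x, Pi.single ρ y] =
      (x.re * y.im - x.im * y.re) * lineNorm κ σ ρ p := by
  have h : ∀ x : ℂ, (Pi.single ρ x : Coord σ) =
      x.re • (Pi.single ρ 1 : Coord σ) + x.im • (Complex.I • (Pi.single ρ 1 : Coord σ)) := by
    intro x
    ext ρ'
    by_cases h : ρ' = ρ
    · subst h
      simp [Complex.re_add_im]
    · simp [h]
  rw [h x, h y, alternating_add_left, alternating_smul_left, alternating_smul_left]
  rw [alternating_swap, alternating_add_left, alternating_smul_left, alternating_smul_left,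
    alternating_self]
  rw [alternating_swap _ (Complex.I • _) (_ + _), alternating_add_left, alternating_smul_left,
    alternating_smul_left, alternating_self, alternating_swap _ (Complex.I • _) _]
  simp only [lineNorm]
  ring

/-! ## Moment maps -/

/-- The hypothesis `hp` says that at these points the circle moves only the coordinate `ρ₀`. The
generating field is then tangent to the coordinate line, and only the restriction of the Kähler form
to that line enters. -/
theorem moment_hasDerivAt {κ : ToricKahlerForm T} {n : Fin 3 → ℤ} {μ : Space T → ℝ}
    (hμ : IsMomentMap κ n μ) {σ : Cone T} {a : {ρ // ρ ∈ σ.1} → ℤ} (ha : ∑ ρ, a ρ • gen ρ.1 = n)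
    {ρ₀ : {ρ // ρ ∈ σ.1}} {p : Coord σ} (hp : ∀ ρ, ρ ≠ ρ₀ → a ρ * p ρ = 0) {γ : ℝ → ℂ} {γ' : ℂ}
    {s : ℝ} (hγ : HasDerivAt γ γ' s) :
    HasDerivAt (fun s => μ (chart σ (Function.update p ρ₀ (γ s))))
      (a ρ₀ * (γ' * starRingEnd ℂ (γ s)).re * lineNorm κ σ ρ₀ (Function.update p ρ₀ (γ s))) s := by
  have h1 : HasDerivAt (fun s => Function.update p ρ₀ (γ s)) (Pi.single ρ₀ γ') s := by
    rw [hasDerivAt_pi]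
    intro ρ
    by_cases h : ρ = ρ₀
    · subst h
      simpa using hγ
    · simpa [h] using hasDerivAt_const s (p ρ)
  have h2 := ((hμ.smooth σ).differentiable (by simp) (Function.update p ρ₀ (γ s))).hasFDerivAt
  have h3 := h2.comp_hasDerivAt s h1
  refine h3.congr_deriv ?_
  rw [hμ.deriv_eq σ a ha]
  have h4 : (fun ρ => Complex.I * a ρ * Function.update p ρ₀ (γ s) ρ) =
      Pi.single ρ₀ (Complex.I * a ρ₀ * γ s) := by
    ext ρ
    by_cases h : ρ = ρ₀
    · subst h
      simp
    · simp [h, mul_assoc, hp ρ h]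
  rw [h4, form_single]
  congr 1
  simp
  ring

theorem fderiv_moment_eq_zero {κ : ToricKahlerForm T} {n : Fin 3 → ℤ} {μ : Space T → ℝ}
    (hμ : IsMomentMap κ n μ) {σ : Cone T} {a : {ρ // ρ ∈ σ.1} → ℤ} (ha : ∑ ρ, a ρ • gen ρ.1 = n)
    {p : Coord σ} (hp : ∀ ρ, a ρ * p ρ = 0) : fderiv ℝ (fun p => μ (chart σ p)) p = 0 := by
  ext v
  rw [hμ.deriv_eq σ a ha]
  have : (fun ρ => Complex.I * a ρ * p ρ) = (0 : ℝ) • (0 : Coord σ) := by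
    ext ρ
    simp [mul_assoc, hp ρ]
  rw [this, alternating_swap, alternating_smul_left]
  simp

/-- In a chart the fixed points of the circle form a linear subspace, and the differential of the
moment map vanishes along it. The two points are joined by a segment. -/
theorem moment_const {κ : ToricKahlerForm T} {n : Fin 3 → ℤ} {μ : Space T → ℝ}
    (hμ : IsMomentMap κ n μ) {σ : Cone T} {a : {ρ // ρ ∈ σ.1} → ℤ} (ha : ∑ ρ, a ρ • gen ρ.1 = n)
    {p q : Coord σ} (hp : ∀ ρ, a ρ * p ρ = 0) (hq : ∀ ρ, a ρ * q ρ = 0) :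
    μ (chart σ p) = μ (chart σ q) := by
  have h1 : ∀ s : ℝ, HasDerivAt (fun s : ℝ => μ (chart σ (p + s • (q - p)))) 0 s := by
    intro s
    have h2 : HasDerivAt (fun s : ℝ => p + s • (q - p)) (q - p) s := by
      simpa using ((hasDerivAt_id s).smul_const (q - p)).const_add p
    have h3 := ((hμ.smooth σ).differentiable (by simp) (p + s • (q - p))).hasFDerivAt
    have h4 := h3.comp_hasDerivAt s h2
    rw [fderiv_moment_eq_zero hμ ha (p := p + s • (q - p))] at h4
    · exact h4
    · intro ρ
      have h5 := hp ρ
      have h6 := hq ρ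
      simp only [Pi.add_apply, Pi.smul_apply, Pi.sub_apply, Complex.real_smul]
      linear_combination (1 - (s : ℂ)) * h5 + (s : ℂ) * h6
  have h := is_const_of_deriv_eq_zero (fun s => (h1 s).differentiableAt) (fun s => (h1 s).deriv) 0 1
  simpa using h

/-- Along the radial segment s ↦ s·p_ρ₀ the derivative of the moment map is the weight times a
non-negative quantity. -/
theorem moment_le_of_weight_neg {κ : ToricKahlerForm T} {n : Fin 3 → ℤ} {μ : Space T → ℝ}
    (hμ : IsMomentMap κ n μ) {σ : Cone T} {a : {ρ // ρ ∈ σ.1} → ℤ} (ha : ∑ ρ, a ρ • gen ρ.1 = n)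
    {ρ₀ : {ρ // ρ ∈ σ.1}} {p : Coord σ} (hp : ∀ ρ, ρ ≠ ρ₀ → a ρ * p ρ = 0) (h0 : a ρ₀ ≤ 0) :
    μ (chart σ p) ≤ μ (chart σ (Function.update p ρ₀ 0)) := by
  have hd : ∀ s : ℝ, HasDerivAt _ _ s := fun s => moment_hasDerivAt hμ ha hp
    (γ := fun s : ℝ => (s : ℂ) * p ρ₀) (γ' := p ρ₀)
    (by simpa using (Complex.ofRealCLM.hasDerivAt (x := s)).mul_const (p ρ₀))
  have h := antitoneOn_of_deriv_nonpos (convex_Icc (0 : ℝ) 1)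
    (fun s _ => (hd s).continuousAt.continuousWithinAt)
    (fun s _ => (hd s).differentiableAt.differentiableWithinAt) (fun s hs => by
      rw [(hd s).deriv]
      refine mul_nonpos_of_nonpos_of_nonneg (mul_nonpos_of_nonpos_of_nonneg
        (by exact_mod_cast h0) ?_) (lineNorm_pos _ _ _ _).le
      rw [map_mul, Complex.conj_ofReal, mul_left_comm, Complex.mul_conj, Complex.re_ofReal_mul,
        Complex.ofReal_re]
      rw [interior_Icc] at hs
      exact mul_nonneg hs.1.le (Complex.normSq_nonneg _))
  have h1 := h (left_mem_Icc.2 zero_le_one) (right_mem_Icc.2 zero_le_one) zero_le_one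
  simpa using h1

theorem le_moment_of_weight_pos {κ : ToricKahlerForm T} {n : Fin 3 → ℤ} {μ : Space T → ℝ}
    (hμ : IsMomentMap κ n μ) {σ : Cone T} {a : {ρ // ρ ∈ σ.1} → ℤ} (ha : ∑ ρ, a ρ • gen ρ.1 = n)
    {ρ₀ : {ρ // ρ ∈ σ.1}} {p : Coord σ} (hp : ∀ ρ, ρ ≠ ρ₀ → a ρ * p ρ = 0) (h0 : 0 ≤ a ρ₀) :
    μ (chart σ (Function.update p ρ₀ 0)) ≤ μ (chart σ p) := by
  have hd : ∀ s : ℝ, HasDerivAt _ _ s := fun s => moment_hasDerivAt hμ ha hp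
    (γ := fun s : ℝ => (s : ℂ) * p ρ₀) (γ' := p ρ₀)
    (by simpa using (Complex.ofRealCLM.hasDerivAt (x := s)).mul_const (p ρ₀))
  have h := monotoneOn_of_deriv_nonneg (convex_Icc (0 : ℝ) 1)
    (fun s _ => (hd s).continuousAt.continuousWithinAt)
    (fun s _ => (hd s).differentiableAt.differentiableWithinAt) (fun s hs => by
      rw [(hd s).deriv]
      refine mul_nonneg (mul_nonneg (by exact_mod_cast h0) ?_) (lineNorm_pos _ _ _ _).le
      rw [map_mul, Complex.conj_ofReal, mul_left_comm, Complex.mul_conj, Complex.re_ofReal_mul,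
        Complex.ofReal_re]
      rw [interior_Icc] at hs
      exact mul_nonneg hs.1.le (Complex.normSq_nonneg _))
  have h1 := h (left_mem_Icc.2 zero_le_one) (right_mem_Icc.2 zero_le_one) zero_le_one
  simpa using h1

/-- On an orbit of the complexified circle, the moment map is a strictly monotone function
of the absolute value of the coordinate. -/
theorem moment_eq_iff {κ : ToricKahlerForm T} {n : Fin 3 → ℤ} {μ : Space T → ℝ}
    (hμ : IsMomentMap κ n μ) {σ : Cone T} {a : {ρ // ρ ∈ σ.1} → ℤ} (ha : ∑ ρ, a ρ • gen ρ.1 = n)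
    {ρ₀ : {ρ // ρ ∈ σ.1}} {p : Coord σ} (hp : ∀ ρ, ρ ≠ ρ₀ → a ρ * p ρ = 0) (h0 : a ρ₀ ≠ 0)
    {x y : ℂ} (hx : x ≠ 0) (hy : y ≠ 0) :
    μ (chart σ (Function.update p ρ₀ x)) = μ (chart σ (Function.update p ρ₀ y)) ↔
      ‖x‖ = ‖y‖ := by
  -- The path s ↦ exp(sc)·x joins x to y. Along it the derivative of the moment map is Re c =
  -- log(|y|/|x|) times a factor that never vanishes. Rolle's theorem gives one direction and a
  -- vanishing derivative the other.
  set c := Complex.log (y / x) with hc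
  have hcx : Complex.exp c * x = y := by
    rw [hc, Complex.exp_log (div_ne_zero hy hx)]
    field_simp
  have hre : c.re = Real.log (‖y‖ / ‖x‖) := by simp [hc, Complex.log_re]
  let γ : ℝ → ℂ := fun s => Complex.exp (s * c) * x
  have hγ : ∀ s, HasDerivAt γ (c * γ s) s := by
    intro s
    have h1 : HasDerivAt (fun s : ℝ => (s : ℂ) * c) c s := by
      simpa using (Complex.ofRealCLM.hasDerivAt (x := s)).mul_const c
    have h2 := h1.cexp.mul_const x
    exact h2.congr_deriv (by simp only [γ]; ring)
  have hd : ∀ s : ℝ, HasDerivAt _ _ s := fun s => moment_hasDerivAt hμ ha hp (hγ s)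
  have hval : ∀ s, (c * γ s * starRingEnd ℂ (γ s)).re = c.re * Complex.normSq (γ s) := by
    intro s
    rw [mul_assoc, Complex.mul_conj, Complex.re_mul_ofReal]
  have hγ0 : γ 0 = x := by simp [γ]
  have hγ1 : γ 1 = y := by simp [γ, hcx]
  constructor
  · intro h
    obtain ⟨s, -, hs⟩ := exists_deriv_eq_zero (a := 0) (b := 1)
      (f := fun s => μ (chart σ (Function.update p ρ₀ (γ s)))) zero_lt_one
      (fun s _ => (hd s).continuousAt.continuousWithinAt) (by simp only [hγ0, hγ1, h])
    rw [(hd s).deriv, hval] at hs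
    have h1 : Complex.normSq (γ s) ≠ 0 := by
      exact Complex.normSq_eq_zero.not.2 (mul_ne_zero (Complex.exp_ne_zero _) hx)
    have h2 : (a ρ₀ : ℝ) ≠ 0 := by exact_mod_cast h0
    have h3 : c.re = 0 := by simpa [h1, h2, (lineNorm_pos _ _ _ _).ne'] using hs
    rw [← hcx, norm_mul, Complex.norm_exp, h3]
    simp
  · intro h
    have h1 : c.re = 0 := by rw [hre, h, div_self (by simpa using hy), Real.log_one]
    have h := is_const_of_deriv_eq_zero (fun s => (hd s).differentiableAt)
      (fun s => by rw [(hd s).deriv, hval, h1]; ring) 0 1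
    simp only [hγ0, hγ1] at h
    exact h

/-! ## The derivative of the fibration -/

theorem hasFDerivAt_log_norm {E : Type*} [NormedAddCommGroup E] [NormedSpace ℝ E] {f : E → ℂ}
    {f' : E →L[ℝ] ℂ} {x : E} (hf : HasFDerivAt f f' x) (h0 : f x ≠ 0) :
    HasFDerivAt (fun y => Real.log ‖f y‖) (Complex.reCLM.comp ((f x)⁻¹ • f')) x := by
  have h1 : HasFDerivAt (fun y => ‖f y‖ ^ 2) _ x := hf.norm_sq
  have h2 := (h1.log (by simpa using h0)).const_smul (1 / 2 : ℝ)
  have h3 : (fun y => Real.log ‖f y‖) = fun y => (1 / 2 : ℝ) • Real.log (‖f y‖ ^ 2) := by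
    ext y
    rw [Real.log_pow, smul_eq_mul]
    push_cast
    ring
  rw [h3]
  refine h2.congr_fderiv ?_
  ext v
  simp [Complex.inner, Complex.inv_re, Complex.inv_im, Complex.normSq_eq_norm_sq]
  ring

/-- The function `z` in a chart. -/
def zChart (σ : Cone T) (p : Coord σ) : ℂ := zVal (extend σ p)
/-- The function `w` in a chart. -/
def wChart (σ : Cone T) (p : Coord σ) : ℂ := wVal (extend σ p)

theorem contDiffAt_zChart {σ : Cone T} {p : Coord σ} (h : extend σ p zInf ≠ 0) :
    ContDiffAt ℂ ∞ (zChart σ) p :=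
  ContDiffAt.div (contDiffAt_prod fun _ _ => (contDiff_extend σ _).contDiffAt)
    (contDiff_extend σ _).contDiffAt h

theorem contDiffAt_wChart {σ : Cone T} {p : Coord σ} (h : extend σ p wInf ≠ 0) :
    ContDiffAt ℂ ∞ (wChart σ) p :=
  ContDiffAt.div (contDiffAt_prod fun _ _ => (contDiff_extend σ _).contDiffAt)
    (contDiff_extend σ _).contDiffAt h

/-- A point of a chart where `z` and `w` are finite and different from one. -/
structure IsFinitePoint (σ : Cone T) (p : Coord σ) : Prop where
  zInf_ne : extend σ p zInf ≠ 0
  wInf_ne : extend σ p wInf ≠ 0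
  z_ne : zChart σ p ≠ 1
  w_ne : wChart σ p ≠ 1

theorem z_chart (σ : Cone T) (p : Coord σ) (h : extend σ p zInf ≠ 0) :
    z (chart σ p) = ((zChart σ p : ℂ) : OnePoint ℂ) := if_neg h

theorem w_chart (σ : Cone T) (p : Coord σ) (h : extend σ p wInf ≠ 0) :
    w (chart σ p) = ((wChart σ p : ℂ) : OnePoint ℂ) := if_neg h

theorem z_chart_of_eq (σ : Cone T) (p : Coord σ) (h : extend σ p zInf = 0) :
    z (chart σ p) = OnePoint.infty := if_pos h

theorem w_chart_of_eq (σ : Cone T) (p : Coord σ) (h : extend σ p wInf = 0) :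
    w (chart σ p) = OnePoint.infty := if_pos h

theorem isFinitePoint_of_isRegularPoint {μ : Space T → ℝ} {σ : Cone T} {p : Coord σ}
    (h : IsRegularPoint μ (chart σ p)) : IsFinitePoint σ p := by
  obtain ⟨h1, h2, h3, h4, -⟩ := h
  have h5 : extend σ p zInf ≠ 0 := fun h => h1 (z_chart_of_eq σ p h)
  have h6 : extend σ p wInf ≠ 0 := fun h => h3 (w_chart_of_eq σ p h)
  refine ⟨h5, h6, fun h => h2 ?_, fun h => h4 ?_⟩
  · rw [z_chart σ p h5, h]
  · rw [w_chart σ p h6, h]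

theorem hasFDerivAt_fibrationInChart {κ : ToricKahlerForm T} {n : Fin 3 → ℤ} {μ : Space T → ℝ}
    (hμ : IsMomentMap κ n μ) {σ : Cone T} {p : Coord σ} (h : IsFinitePoint σ p) :
    HasFDerivAt (fibrationInChart μ σ)
      ((Complex.reCLM.comp ((zChart σ p - 1)⁻¹ • (fderiv ℂ (zChart σ) p).restrictScalars ℝ)).prod
        ((Complex.reCLM.comp
          ((wChart σ p - 1)⁻¹ • (fderiv ℂ (wChart σ) p).restrictScalars ℝ)).prod
          (fderiv ℝ (fun p => μ (chart σ p)) p))) p := by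
  have hz := ((contDiffAt_zChart h.zInf_ne).differentiableAt (by simp)).hasFDerivAt.restrictScalars
    ℝ |>.sub_const 1
  have hw := ((contDiffAt_wChart h.wInf_ne).differentiableAt (by simp)).hasFDerivAt.restrictScalars
    ℝ |>.sub_const 1
  exact (hasFDerivAt_log_norm hz (sub_ne_zero.2 h.z_ne)).prodMk
    ((hasFDerivAt_log_norm hw (sub_ne_zero.2 h.w_ne)).prodMk
      ((hμ.smooth σ).differentiable (by simp) p).hasFDerivAt)

theorem mem_fiberTangent_iff {κ : ToricKahlerForm T} {n : Fin 3 → ℤ} {μ : Space T → ℝ}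
    (hμ : IsMomentMap κ n μ) {σ : Cone T} {p : Coord σ} (h : IsFinitePoint σ p) (v : Coord σ) :
    v ∈ fiberTangent μ σ p ↔ ((zChart σ p - 1)⁻¹ * fderiv ℂ (zChart σ) p v).re = 0 ∧
      ((wChart σ p - 1)⁻¹ * fderiv ℂ (wChart σ) p v).re = 0 ∧
      fderiv ℝ (fun p => μ (chart σ p)) p v = 0 := by
  rw [fiberTangent, mem_ofPred_eq, (hasFDerivAt_fibrationInChart hμ h).fderiv]
  simp [Prod.ext_iff, -Complex.mul_re]

/-- The differential of the moment map vanishes at a fixed point, so the third coordinate direction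
is missed. -/
theorem not_isRegularPoint_of_fixed {κ : ToricKahlerForm T} {n : Fin 3 → ℤ} {μ : Space T → ℝ}
    (hμ : IsMomentMap κ n μ) {σ : Cone T} {a : {ρ // ρ ∈ σ.1} → ℤ} (ha : ∑ ρ, a ρ • gen ρ.1 = n)
    {p : Coord σ} (hp : ∀ ρ, a ρ * p ρ = 0) : ¬ IsRegularPoint μ (chart σ p) := by
  intro h
  have h1 := hasFDerivAt_fibrationInChart hμ (isFinitePoint_of_isRegularPoint h)
  have h2 := h.2.2.2.2 σ p rfl
  rw [h1.fderiv, fderiv_moment_eq_zero hμ ha hp] at h2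
  obtain ⟨v, hv⟩ := h2 (0, 0, 1)
  have := congrArg (fun b : ℝ × ℝ × ℝ => b.2.2) hv
  simp at this

/-! ## The range of the moment map -/

/-- The cone of the chart with coordinates `1/ξ, z, w`. -/
abbrev leftCone (T : MaximalTriangulation k l) : Cone T := ⟨_, IsMaxCone.left⟩
/-- The cone of the chart containing the generic points of the divisor `ξ = 0`. -/
abbrev rightCone (T : MaximalTriangulation k l) : Cone T := ⟨_, IsMaxCone.right⟩

/-- The circle weights in the chart of a cone two of whose generators are not moved. -/
theorem sum_weight_single {σ : Cone T} {ρ₀ : {ρ // ρ ∈ σ.1}} {c : ℤ} {n : Fin 3 → ℤ}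
    (h : c • gen ρ₀.1 = n) : ∑ ρ, (Pi.single ρ₀ c : {ρ // ρ ∈ σ.1} → ℤ) ρ • gen ρ.1 = n := by
  rw [Finset.sum_eq_single ρ₀]
  · simpa using h
  · intro ρ _ hρ
    simp [hρ]
  · simp

theorem single_weight_mul {σ : Cone T} {ρ₀ ρ : {ρ // ρ ∈ σ.1}} {c : ℤ} (x : ℂ) (h : ρ ≠ ρ₀) :
    ((Pi.single ρ₀ c : {ρ // ρ ∈ σ.1} → ℤ) ρ : ℂ) * x = 0 := by simp [h]

theorem single_weight_mul_update {σ : Cone T} {ρ₀ : {ρ // ρ ∈ σ.1}} {c : ℤ} {p : Coord σ}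
    (hp : p ρ₀ = 0) (ρ : {ρ // ρ ∈ σ.1}) :
    ((Pi.single ρ₀ c : {ρ // ρ ∈ σ.1} → ℤ) ρ : ℂ) * p ρ = 0 := by
  by_cases h : ρ = ρ₀
  · simp [h, hp]
  · simp [h]

theorem dense_torus (σ : Cone T) : Dense {p : Coord σ | ∀ ρ, p ρ ≠ 0} := by
  have h : Dense (Set.pi univ fun _ : {ρ // ρ ∈ σ.1} => ({0}ᶜ : Set ℂ)) :=
    dense_pi _ fun _ _ => dense_compl_singleton 0
  convert h using 1
  ext p
  simp

theorem continuous_moment {κ : ToricKahlerForm T} {n : Fin 3 → ℤ} {μ : Space T → ℝ}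
    (hμ : IsMomentMap κ n μ) (σ : Cone T) : Continuous fun p => μ (chart σ p) :=
  (hμ.smooth σ).continuous

/-- The divisor on which the circle acts with normal weight -1 is the maximum of the moment map. A
point of the torus flows radially into this divisor while the moment map does not decrease, and the
moment map is constant on the part of the divisor in the chart. The torus is dense in every chart,
so the bound holds everywhere. -/
theorem moment_le {κ : ToricKahlerForm T} {n : Fin 3 → ℤ} {μ : Space T → ℝ}
    (hμ : IsMomentMap κ n μ) {σ : Cone T} {ρ₀ : {ρ // ρ ∈ σ.1}} (h : (-1 : ℤ) • gen ρ₀.1 = n)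
    {q : Coord σ} (hq : q ρ₀ = 0) (x : Space T) : μ x ≤ μ (chart σ q) := by
  obtain ⟨τ, p, rfl⟩ := exists_chart x
  have hcl : IsClosed {p | μ (chart τ p) ≤ μ (chart σ q)} :=
    isClosed_le (continuous_moment hμ τ) continuous_const
  refine hcl.closure_subset_iff.2 (fun p hp => ?_) (dense_torus τ p)
  have h1 : μ (chart τ p) = μ (chart σ (transition τ σ p)) := by
    rw [chart_transition (mem_range_of_torus σ hp)]
  rw [mem_ofPred_eq, h1]
  refine (moment_le_of_weight_neg hμ (sum_weight_single h) (ρ₀ := ρ₀)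
    (fun ρ hρ => single_weight_mul _ hρ) (by simp)).trans_eq ?_
  exact moment_const hμ (sum_weight_single h) (single_weight_mul_update (by simp))
    (single_weight_mul_update hq)

theorem le_moment {κ : ToricKahlerForm T} {n : Fin 3 → ℤ} {μ : Space T → ℝ}
    (hμ : IsMomentMap κ n μ) {σ : Cone T} {ρ₀ : {ρ // ρ ∈ σ.1}} (h : (1 : ℤ) • gen ρ₀.1 = n)
    {q : Coord σ} (hq : q ρ₀ = 0) (x : Space T) : μ (chart σ q) ≤ μ x := by
  obtain ⟨τ, p, rfl⟩ := exists_chart x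
  have hcl : IsClosed {p | μ (chart σ q) ≤ μ (chart τ p)} :=
    isClosed_le continuous_const (continuous_moment hμ τ)
  refine hcl.closure_subset_iff.2 (fun p hp => ?_) (dense_torus τ p)
  have h1 : μ (chart τ p) = μ (chart σ (transition τ σ p)) := by
    rw [chart_transition (mem_range_of_torus σ hp)]
  rw [mem_ofPred_eq, h1]
  refine Eq.trans_le ?_ (le_moment_of_weight_pos hμ (sum_weight_single h) (ρ₀ := ρ₀)
    (fun ρ hρ => single_weight_mul _ hρ) (by simp))
  exact moment_const hμ (sum_weight_single h) (single_weight_mul_update hq)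
    (single_weight_mul_update (by simp))

/-! ## Winding numbers -/

/-- Continuous logarithms are available on open simply connected sets. The function is therefore
first extended to the whole plane by composition with the radial retraction onto the closed disc. -/
theorem exists_exp_eq_on_disc {g : ℂ → ℂ} (hg : ContinuousOn g disc) (h0 : ∀ t ∈ disc, g t ≠ 0) :
    ∃ f : ℂ → ℂ, Continuous f ∧ ∀ t ∈ disc, Complex.exp (f t) = g t := by
  let r : ℂ → ℂ := fun t => ((max 1 ‖t‖ : ℝ) : ℂ)⁻¹ * t
  have hpos : ∀ t : ℂ, 0 < max 1 ‖t‖ := fun t => lt_max_of_lt_left one_pos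
  have hr : Continuous r := by
    refine Continuous.mul (Continuous.inv₀ (by fun_prop) fun t => ?_) continuous_id
    exact_mod_cast (hpos t).ne'
  have hrd : ∀ t, r t ∈ disc := by
    intro t
    simp only [r, disc, mem_closedBall_zero_iff, norm_mul, norm_inv, Complex.norm_real,
      Real.norm_eq_abs, abs_of_pos (hpos t)]
    rw [inv_mul_le_one₀ (hpos t)]
    exact le_max_right _ _
  have hsc : IsSimplyConnected (univ : Set ℂ) := by
    have := (Homeomorph.Set.univ ℂ).toHomotopyEquiv.simplyConnectedSpace
    exact this
  obtain ⟨f, hf, hfe⟩ := Complex.exists_continuousOn_eqOn_exp_comp hsc isOpen_univ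
    (g := fun t => g (r t)) (hg.comp_continuous hr hrd).continuousOn
    (by rintro ⟨t, -, ht⟩; exact h0 _ (hrd t) ht)
  refine ⟨f, continuousOn_univ.1 hf, fun t ht => ?_⟩
  have h := hfe (mem_univ t)
  have h1 : r t = t := by
    have : ‖t‖ ≤ 1 := by simpa using ht
    simp [r, max_eq_left this]
  simpa [h1] using h

/-- A continuous real function all of whose values are logarithms of the same phase is constant. -/
theorem const_of_exp_const {h : ℝ → ℝ} (hc : Continuous h) {c : ℂ}
    (he : ∀ θ, Complex.exp (h θ * Complex.I) = c) (a b : ℝ) : h a = h b := by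
  have hfac : ∀ θ, ∃ m : ℤ, h θ = h a + m * (2 * Real.pi) := by
    intro θ
    obtain ⟨m, hm⟩ := Complex.exp_eq_exp_iff_exists_int.1 ((he θ).trans (he a).symm)
    refine ⟨m, ?_⟩
    have := congrArg Complex.im hm
    simpa using this
  choose m hm using hfac
  have hm' : ∀ θ, (m θ : ℝ) = (h θ - h a) / (2 * Real.pi) := by
    intro θ
    rw [hm θ]
    field_simp
    ring
  have hmc : Continuous m := by
    rw [Int.isClosedEmbedding_coe_real.isEmbedding.continuous_iff]
    have : (fun θ => (m θ : ℝ)) = fun θ => (h θ - h a) / (2 * Real.pi) := funext hm'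
    change Continuous fun θ => (m θ : ℝ)
    rw [this]
    fun_prop
  have h1 : m a = m b := PreconnectedSpace.constant inferInstance hmc
  have h2 := hm a
  rw [h1] at h2
  have h3 := hm b
  linarith

/-- The argument principle by hand: on the unit circle t - a = t·(1 - a/t), and for |a| < 1 the
second factor lies in the slit plane and has a periodic logarithm. The phase of F² therefore grows
by 4π times the sum of the orders, while the phase φ has no growth by hypothesis. -/
theorem sum_orders_eq_zero {S : Finset ℂ} (n : ℂ → ℕ) (hS : ∀ a ∈ S, ‖a‖ < 1) {f : ℂ → ℂ}
    (hf : Continuous f) {φ : ℝ → ℝ} (hφ : Continuous φ) (h0 : φ (2 * Real.pi) = φ 0) {F : ℂ → ℂ}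
    (hF : ∀ t, ‖t‖ = 1 → F t = (∏ a ∈ S, (t - a) ^ n a) * Complex.exp (f t))
    (hphase : ∀ θ : ℝ, F (Complex.exp (θ * Complex.I)) ^ 2 =
      -((‖F (Complex.exp (θ * Complex.I))‖ : ℂ) ^ 2 * Complex.exp (φ θ * Complex.I))) :
    ∑ a ∈ S, n a = 0 := by
  let e : ℝ → ℂ := fun θ => Complex.exp (θ * Complex.I)
  have hen : ∀ θ, ‖e θ‖ = 1 := fun θ => Complex.norm_exp_ofReal_mul_I θ
  have hec : Continuous e := by fun_prop
  have hslit : ∀ a ∈ S, ∀ θ, 1 - a * (e θ)⁻¹ ∈ Complex.slitPlane := by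
    intro a ha θ
    rw [sub_eq_add_neg]
    exact Complex.mem_slitPlane_of_norm_lt_one (by simpa [hen θ] using hS a ha)
  let L : ℝ → ℂ := fun θ => ∑ a ∈ S, n a * Complex.log (1 - a * (e θ)⁻¹) + f (e θ)
  have hLc : Continuous L := by
    refine Continuous.add (continuous_finsetSum _ fun a ha => ?_) (hf.comp hec)
    refine continuous_const.mul (Continuous.clog ?_ (hslit a ha))
    exact continuous_const.sub (continuous_const.mul (hec.inv₀ fun θ => Complex.exp_ne_zero _))
  have hprod : ∀ θ, F (e θ) = Complex.exp ((∑ a ∈ S, n a : ℕ) * (θ * Complex.I) + L θ) := by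
    intro θ
    have he0 : e θ ≠ 0 := Complex.exp_ne_zero _
    have h1 : ∀ a ∈ S, (e θ - a) ^ n a = Complex.exp (n a * (θ * Complex.I)) *
        Complex.exp (n a * Complex.log (1 - a * (e θ)⁻¹)) := by
      intro a ha
      rw [Complex.exp_nat_mul, Complex.exp_nat_mul, ← mul_pow,
        Complex.exp_log (Complex.slitPlane_ne_zero (hslit a ha θ))]
      congr 1
      change _ = e θ * _
      field_simp
    rw [hF _ (hen θ), Finset.prod_congr rfl h1, Finset.prod_mul_distrib, ← Complex.exp_sum,
      ← Complex.exp_sum, ← Complex.exp_add, ← Complex.exp_add]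
    congr 1
    simp only [L]
    push_cast
    rw [Finset.sum_mul]
    ring
  -- The difference of the two phases is a continuous real function with values in π + 2πℤ, hence
  -- constant. Comparing θ = 0 with θ = 2π leaves only the linear term.
  have key : ∀ θ, Complex.exp (((2 * (∑ a ∈ S, n a : ℕ) * θ + 2 * (L θ).im - φ θ : ℝ) : ℂ) *
      Complex.I) = -1 := by
    intro θ
    have h1 := hphase θ
    change F (e θ) ^ 2 = -((‖F (e θ)‖ : ℂ) ^ 2 * _) at h1
    rw [hprod θ, Complex.norm_exp] at h1
    push_cast at h1
    rw [← Complex.exp_nat_mul, ← Complex.exp_nat_mul, ← Complex.exp_add] at h1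
    set M : ℕ := ∑ a ∈ S, n a
    have h2 : ((((M : ℂ) * (θ * Complex.I) + L θ).re : ℝ) : ℂ) = ((L θ).re : ℂ) := by simp
    simp only [M] at h2
    push_cast at h2
    rw [h2] at h1
    have h3 : (((2 * (M : ℕ) * θ + 2 * (L θ).im - φ θ : ℝ) : ℂ) * Complex.I) =
        ((2 : ℕ) : ℂ) * ((M : ℂ) * (θ * Complex.I) + L θ)
          - (((2 : ℕ) : ℂ) * ((L θ).re : ℂ) + φ θ * Complex.I) := by
      have h4 := Complex.re_add_im (L θ)
      push_cast
      linear_combination 2 * h4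
    rw [h3, Complex.exp_sub]
    simp only [M]
    push_cast at h1 ⊢
    rw [h1, neg_div, div_self (Complex.exp_ne_zero _)]
  have hc : Continuous fun θ : ℝ => 2 * ((∑ a ∈ S, n a : ℕ) : ℝ) * θ + 2 * (L θ).im - φ θ := by
    have := Complex.continuous_im.comp hLc
    simp only [Function.comp_def] at this
    fun_prop
  have h1 := const_of_exp_const hc key 0 (2 * Real.pi)
  have hL : L (2 * Real.pi) = L 0 := by simp [L, e]
  rw [hL, h0] at h1
  have h2 : ((∑ a ∈ S, n a : ℕ) : ℝ) * Real.pi = 0 := by linarith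
  have h3 := (mul_eq_zero.1 h2).resolve_right Real.pi_ne_zero
  exact_mod_cast h3

/-- A function on the closed disc that is locally a power of a coordinate times a continuous
function without zeros has no zeros, if its phase along the boundary has degree zero. -/
theorem order_eq_zero_of_phase {F : ℂ → ℂ} {n : ℂ → ℕ} {E : Set ℂ} {φ : ℝ → ℝ}
    (hφ : Continuous φ) (h0 : φ (2 * Real.pi) = φ 0)
    (hphase : ∀ θ : ℝ, F (Complex.exp (θ * Complex.I)) ^ 2 =
      -((‖F (Complex.exp (θ * Complex.I))‖ : ℂ) ^ 2 * Complex.exp (φ θ * Complex.I)))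
    (hE : ∀ t, ‖t‖ = 1 → t ∉ E)
    (hloc : ∀ t₀ ∈ disc, ∃ (G : ℂ → ℂ) (W : Set ℂ), IsOpen W ∧ t₀ ∈ W ∧
      ContinuousOn G (W ∩ disc) ∧ (∀ t ∈ W ∩ disc, G t ≠ 0) ∧
      (∀ t ∈ W ∩ disc, t ≠ t₀ → t ∉ E ∧ F t = (t - t₀) ^ n t₀ * G t) ∧
      (t₀ ∉ E → n t₀ = 0 ∧ F t₀ = G t₀)) :
    ∀ t ∈ disc, n t = 0 := by
  choose! G W hWo hW hGc hG0 hG hGE using hloc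
  -- Near every point of the compact disc, E contains at most that point itself.
  have hfin : (E ∩ disc).Finite := by
    by_contra hinf
    obtain ⟨a, ha, hacc⟩ := Set.Infinite.exists_accPt_of_subset_isCompact
      (K := disc) hinf (isCompact_closedBall _ _) inter_subset_right
    rw [accPt_iff_nhds] at hacc
    obtain ⟨y, ⟨hy1, hy2, hy3⟩, hya⟩ := hacc (W a) ((hWo a ha).mem_nhds (hW a ha))
    exact (hG a ha y ⟨hy1, hy3⟩ hya).1 hy2
  let S : Finset ℂ := hfin.toFinset
  have hmem : ∀ a, a ∈ S ↔ a ∈ E ∧ a ∈ disc := fun a => by simp [S]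
  classical
  -- F with all its zeros divided out. At a point of E the value of F itself carries no information
  -- and is replaced by the local factor G; the power belonging to that point is then omitted from
  -- the denominator.
  let g : ℂ → ℂ := fun t => (if t ∈ E then G t t else F t) / ∏ a ∈ S.erase t, (t - a) ^ n a
  have hgloc : ∀ t₀ ∈ disc, ∀ t ∈ W t₀ ∩ disc, g t = G t₀ t / ∏ a ∈ S.erase t₀, (t - a) ^ n a := by
    intro t₀ ht₀ t ht
    by_cases h : t = t₀
    · subst h
      by_cases hE' : t ∈ E
      · simp [g, hE']
      · simp [g, hE', (hGE t ht₀ hE').2]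
    · obtain ⟨h1, h2⟩ := hG t₀ ht₀ t ht h
      have h3 : t - t₀ ≠ 0 := sub_ne_zero.2 h
      have h4 : t ∉ S := fun h => h1 ((hmem t).1 h).1
      simp only [g, if_neg h1, h2, Finset.erase_eq_of_notMem h4]
      by_cases hS : t₀ ∈ S
      · rw [← Finset.mul_prod_erase S _ hS, mul_div_mul_left _ _ (pow_ne_zero _ h3)]
      · have h5 : t₀ ∉ E := fun h => hS ((hmem t₀).2 ⟨h, ht₀⟩)
        rw [Finset.erase_eq_of_notMem hS, (hGE t₀ ht₀ h5).1, pow_zero, one_mul]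
  have hden : ∀ t₀, ∏ a ∈ S.erase t₀, (t₀ - a) ^ n a ≠ 0 := by
    intro t₀
    refine Finset.prod_ne_zero_iff.2 fun a ha => pow_ne_zero _ (sub_ne_zero.2 ?_)
    exact (Finset.ne_of_mem_erase ha).symm
  have hgc : ContinuousOn g disc := by
    intro t₀ ht₀
    have h1 : ContinuousWithinAt (fun t => G t₀ t / ∏ a ∈ S.erase t₀, (t - a) ^ n a)
        (W t₀ ∩ disc) t₀ :=
      (hGc t₀ ht₀ t₀ ⟨hW t₀ ht₀, ht₀⟩).div
        (Continuous.continuousWithinAt (continuous_finsetProd _ fun a _ => by fun_prop)) (hden t₀)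
    have h2 := h1.congr (hgloc t₀ ht₀) (hgloc t₀ ht₀ t₀ ⟨hW t₀ ht₀, ht₀⟩)
    exact (continuousWithinAt_inter' (mem_nhdsWithin_of_mem_nhds
      ((hWo t₀ ht₀).mem_nhds (hW t₀ ht₀)))).1 (by rwa [inter_comm] at h2)
  have hg0 : ∀ t ∈ disc, g t ≠ 0 := by
    intro t ht
    rw [hgloc t ht t ⟨hW t ht, ht⟩]
    exact div_ne_zero (hG0 t ht t ⟨hW t ht, ht⟩) (hden t)
  obtain ⟨f, hfc, hf⟩ := exists_exp_eq_on_disc hgc hg0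
  have hsum := sum_orders_eq_zero (S := S) n (fun a ha => ?_) hfc hφ h0 (F := F) ?_ hphase
  · intro t ht
    by_cases h : t ∈ E
    · exact (Finset.sum_eq_zero_iff.1 hsum) t ((hmem t).2 ⟨h, ht⟩)
    · exact (hGE t ht h).1
  · obtain ⟨h1, h2⟩ := (hmem a).1 ha
    refine lt_of_le_of_ne (by simpa using h2) fun h => hE a h h1
  · intro t ht
    have h1 : t ∈ disc := by simp [ht]
    have h2 : t ∉ S := fun h => hE t ht ((hmem t).1 h).1
    have h3 := hden t
    rw [Finset.erase_eq_of_notMem h2] at h3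
    rw [hf t h1]
    simp only [g, if_neg (hE t ht), Finset.erase_eq_of_notMem h2]
    field_simp

/-! ## Invariants of homogeneous coordinates -/

theorem exists_units_of_chart_eq {σ τ : Cone T} {p : Coord σ} {q : Coord τ}
    (h : chart σ p = chart τ q) : ∃ g : Ray k l → ℂˣ,
      (∀ m : Fin 3 → ℤ, ∏ ρ, g ρ ^ (m ⬝ᵥ gen ρ) = 1) ∧
        ∀ ρ, extend τ q ρ = g ρ * extend σ p ρ := Quotient.exact h

theorem extend_eq_zero_iff {σ τ : Cone T} {p : Coord σ} {q : Coord τ}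
    (h : chart σ p = chart τ q) (ρ : Ray k l) : extend τ q ρ = 0 ↔ extend σ p ρ = 0 := by
  obtain ⟨g, -, hg⟩ := exists_units_of_chart_eq h
  simp [hg]

theorem zChart_eq {σ τ : Cone T} {p : Coord σ} {q : Coord τ} (h : chart σ p = chart τ q) :
    zChart τ q = zChart σ p := by
  obtain ⟨g, hg, hg'⟩ := exists_units_of_chart_eq h
  exact zVal_eq g hg hg'

theorem wChart_eq {σ τ : Cone T} {p : Coord σ} {q : Coord τ} (h : chart σ p = chart τ q) :
    wChart τ q = wChart σ p := by
  obtain ⟨g, hg, hg'⟩ := exists_units_of_chart_eq h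
  exact wVal_eq g hg hg'

theorem extend_ne_zero_iff {σ : Cone T} {p : Coord σ} :
    (∀ ρ, p ρ ≠ 0) ↔ ∀ ρ, extend σ p ρ ≠ 0 :=
  ⟨fun h => extend_ne_zero h, fun h ρ => by simpa [extend_mem] using h ρ⟩

/-- The points of the torus with `z ≠ 1` and `w ≠ 1`. -/
def IsGeneric (x : Space T) : Prop := ∃ (σ : Cone T) (p : Coord σ), chart σ p = x ∧
  (∀ ρ, p ρ ≠ 0) ∧ zChart σ p ≠ 1 ∧ wChart σ p ≠ 1

theorem isGeneric_chart {σ : Cone T} {p : Coord σ} : IsGeneric (chart σ p) ↔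
    (∀ ρ, p ρ ≠ 0) ∧ zChart σ p ≠ 1 ∧ wChart σ p ≠ 1 := by
  refine ⟨?_, fun h => ⟨σ, p, rfl, h⟩⟩
  rintro ⟨τ, q, h, h1, h2, h3⟩
  rw [zChart_eq h, wChart_eq h]
  refine ⟨?_, h2, h3⟩
  rw [extend_ne_zero_iff] at h1 ⊢
  exact fun ρ => (extend_eq_zero_iff h ρ).not.2 (h1 ρ)

/-- The section of the anticanonical bundle whose divisor is the polar divisor of the holomorphic
volume form, in homogeneous coordinates. -/
def polar (Z : Ray k l → ℂ) : ℂ :=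
  Z xiZero * Z xiInf * Z zInf * Z wInf * ((∏ i : Fin (k + 1), Z (bot i)) - Z zInf) *
    ((∏ j : Fin (l + 1), Z (top j)) - Z wInf)

/-- The points outside the polar divisor of the holomorphic volume form. -/
def IsFinite (x : Space T) : Prop := ∃ (σ : Cone T) (p : Coord σ), chart σ p = x ∧
  IsFinitePoint σ p ∧ extend σ p xiZero ≠ 0 ∧ extend σ p xiInf ≠ 0

theorem isFinite_chart {σ : Cone T} {p : Coord σ} : IsFinite (chart σ p) ↔
    IsFinitePoint σ p ∧ extend σ p xiZero ≠ 0 ∧ extend σ p xiInf ≠ 0 := by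
  refine ⟨?_, fun h => ⟨σ, p, rfl, h⟩⟩
  rintro ⟨τ, q, h, ⟨h1, h2, h3, h4⟩, h5, h6⟩
  refine ⟨⟨?_, ?_, ?_, ?_⟩, ?_, ?_⟩
  · rwa [ne_eq, extend_eq_zero_iff h]
  · rwa [ne_eq, extend_eq_zero_iff h]
  · rwa [zChart_eq h]
  · rwa [wChart_eq h]
  · rwa [ne_eq, extend_eq_zero_iff h]
  · rwa [ne_eq, extend_eq_zero_iff h]

theorem polar_ne_zero_iff {σ : Cone T} {p : Coord σ} :
    polar (extend σ p) ≠ 0 ↔ IsFinite (chart σ p) := by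
  have hz : extend σ p zInf ≠ 0 → (zChart σ p ≠ 1 ↔
      (∏ i : Fin (k + 1), extend σ p (bot i)) - extend σ p zInf ≠ 0) := fun h => by
    rw [sub_ne_zero, zChart, zVal, ne_eq, div_eq_one_iff_eq h]
  have hw : extend σ p wInf ≠ 0 → (wChart σ p ≠ 1 ↔
      (∏ j : Fin (l + 1), extend σ p (top j)) - extend σ p wInf ≠ 0) := fun h => by
    rw [sub_ne_zero, wChart, wVal, ne_eq, div_eq_one_iff_eq h]
  rw [isFinite_chart, polar]
  simp only [mul_ne_zero_iff]
  constructor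
  · rintro ⟨⟨⟨⟨⟨h1, h2⟩, h3⟩, h4⟩, h5⟩, h6⟩
    exact ⟨⟨h3, h4, (hz h3).2 h5, (hw h4).2 h6⟩, h1, h2⟩
  · rintro ⟨⟨h3, h4, h5, h6⟩, h1, h2⟩
    exact ⟨⟨⟨⟨⟨h1, h2⟩, h3⟩, h4⟩, (hz h3).1 h5⟩, (hw h4).1 h6⟩

/-- Genericity becomes the non-vanishing of one holomorphic function in the chart, so that isolation
of zeros applies along a disc. -/
theorem isGeneric_iff_polar {σ : Cone T} {p : Coord σ} : IsGeneric (chart σ p) ↔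
    polar (extend σ p) * ∏ ρ, p ρ ≠ 0 := by
  rw [mul_ne_zero_iff, polar_ne_zero_iff, isGeneric_chart, isFinite_chart, Finset.prod_ne_zero_iff]
  constructor
  · rintro ⟨h1, h2, h3⟩
    have h4 := extend_ne_zero_iff.1 h1
    exact ⟨⟨⟨h4 _, h4 _, h2, h3⟩, h4 _, h4 _⟩, fun ρ _ => h1 ρ⟩
  · rintro ⟨⟨⟨-, -, h2, h3⟩, -, -⟩, h1⟩
    exact ⟨fun ρ => h1 ρ (Finset.mem_univ _), h2, h3⟩

theorem contDiff_polar (σ : Cone T) : ContDiff ℂ ∞ fun p : Coord σ => polar (extend σ p) := by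
  have h := contDiff_extend σ
  have h1 : ContDiff ℂ ∞ fun p : Coord σ => ∏ i : Fin (k + 1), extend σ p (bot i) :=
    contDiff_prod fun _ _ => h _
  have h2 : ContDiff ℂ ∞ fun p : Coord σ => ∏ j : Fin (l + 1), extend σ p (top j) :=
    contDiff_prod fun _ _ => h _
  exact (((((h _).mul (h _)).mul (h _)).mul (h _)).mul (h1.sub (h _))).mul (h2.sub (h _))

/-- The product of all homogeneous coordinates is the section vanishing on the toric boundary.
Replacing the zero divisors of z and w by z = 1 and w = 1 multiplies it by (z-1)(w-1)/(zw). -/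
theorem polar_eq {σ : Cone T} {p : Coord σ} (hp : ∀ ρ, p ρ ≠ 0) :
    polar (extend σ p) = (zChart σ p - 1) * (wChart σ p - 1) / (zChart σ p * wChart σ p) *
      ∏ ρ, p ρ := by
  have h := extend_ne_zero hp
  have h1 : ∏ ρ, p ρ = ∏ ρ, extend σ p ρ := by
    rw [prod_mul_compl σ, Finset.prod_eq_one (s := σ.1ᶜ), mul_one]
    · exact Finset.prod_congr rfl fun ρ _ => (extend_mem σ p ρ).symm
    · exact fun ρ hρ => extend_notMem σ p (by simpa using hρ)
  rw [h1, polar, zChart, wChart, zVal, wVal]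
  simp only [Fintype.prod_sum_type, Fin.prod_univ_four]
  have h2 : ∏ i : Fin (k + 1), extend σ p (bot i) ≠ 0 := Finset.prod_ne_zero_iff.2 fun _ _ => h _
  have h3 : ∏ j : Fin (l + 1), extend σ p (top j) ≠ 0 := Finset.prod_ne_zero_iff.2 fun _ _ => h _
  have h4 := h zInf
  have h5 := h wInf
  field_simp

/-- Regular points outside the divisors `z = 0` and `w = 0` are generic. -/
theorem isGeneric_of_isRegularPoint {κ : ToricKahlerForm T} {μ : Space T → ℝ}
    (hμ : IsMomentMap κ ![1, 0, 0] μ) {σ : Cone T} {p : Coord σ}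
    (h : IsRegularPoint μ (chart σ p)) (hz : zChart σ p ≠ 0) (hw : wChart σ p ≠ 0) :
    IsGeneric (chart σ p) := by
  obtain ⟨h1, h2, h3, h4⟩ := isFinitePoint_of_isRegularPoint h
  have hbot : ∀ i, extend σ p (bot i) ≠ 0 := fun i => by
    have := (div_ne_zero_iff.1 hz).1
    exact Finset.prod_ne_zero_iff.1 this i (Finset.mem_univ _)
  have htop : ∀ j, extend σ p (top j) ≠ 0 := fun j => by
    have := (div_ne_zero_iff.1 hw).1
    exact Finset.prod_ne_zero_iff.1 this j (Finset.mem_univ _)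
  -- Points of ξ = 0 or ξ = ∞ that lie in a chart where the circle rotates only the coordinate of
  -- that divisor are fixed by the circle, hence not regular.
  have hfix : ∀ (τ : Cone T) (ρ₀ : {ρ // ρ ∈ τ.1}) (c : ℤ), c • gen ρ₀.1 = ![1, 0, 0] →
      extend σ p ρ₀ = 0 → chart σ p ∉ range (chart τ) := by
    rintro τ ρ₀ c hc h0 ⟨q, hq⟩
    rw [← hq] at h
    refine not_isRegularPoint_of_fixed hμ (sum_weight_single hc) (single_weight_mul_update ?_) h
    rw [← extend_mem τ q ρ₀, ← extend_eq_zero_iff hq]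
    exact h0
  -- The divisors ξ = 0 and ξ = ∞ are disjoint: no cone contains both rays.
  have hxi : extend σ p xiZero ≠ 0 ∨ extend σ p xiInf ≠ 0 := by
    by_contra! hcon
    have hmem : ∀ ρ, extend σ p ρ = 0 → ρ ∈ σ.1 := fun ρ h => by
      by_contra hn
      simp [extend_notMem σ p hn] at h
    have h5 := hmem _ hcon.1
    have h6 := hmem _ hcon.2
    obtain ⟨σ, hσ⟩ := σ
    cases hσ <;> simp at h5 h6
  have h5 : extend σ p xiInf ≠ 0 := by
    intro h0
    refine hfix (leftCone T) ⟨xiInf, by simp⟩ (-1) (by simp [gen]) h0 ?_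
    rw [chart_mem_range_chart]
    rintro (⟨i | j⟩ | m) hm
    · exact hbot i
    · exact htop j
    · fin_cases m
      · exact h1
      · exact h2
      · exact hxi.resolve_right (not_not.2 h0)
      · simp at hm
  have h6 : extend σ p xiZero ≠ 0 := by
    intro h0
    refine hfix (rightCone T) ⟨xiZero, by simp⟩ 1 (by simp [gen]) h0 ?_
    rw [chart_mem_range_chart]
    rintro (⟨i | j⟩ | m) hm
    · exact hbot i
    · exact htop j
    · fin_cases m
      · exact h1
      · exact h2
      · simp at hm
      · exact h5
  rw [isGeneric_chart, extend_ne_zero_iff]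
  refine ⟨?_, h3, h4⟩
  rintro (⟨i | j⟩ | m)
  · exact hbot i
  · exact htop j
  · fin_cases m
    exacts [h1, h2, h6, h5]

/-! ## Logarithmic frames -/

/-- The logarithmic differentials in a chart. -/
def logMap (σ : Cone T) (p : Coord σ) : Coord σ →ₗ[ℂ] (Fin 3 → ℂ) :=
  (genMap σ).toLinearMap ∘ₗ Matrix.toLin' (Matrix.diagonal fun ρ => (p ρ)⁻¹)

theorem logMap_apply (σ : Cone T) (p v : Coord σ) :
    logMap σ p v = genMap σ (fun ρ => v ρ / p ρ) := by
  change genMap σ _ = _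
  congr 1
  ext ρ
  simp [Matrix.mulVec_diagonal, div_eq_inv_mul]

theorem card_cone (σ : Cone T) : Fintype.card {ρ // ρ ∈ σ.1} = 3 := by
  obtain ⟨f, -⟩ := σ.exists_equiv
  simpa using (Fintype.card_congr f).symm

/-- The isomorphism given by the generators of a maximal cone. -/
def genEquiv (σ : Cone T) : Coord σ ≃ₗ[ℂ] (Fin 3 → ℂ) :=
  LinearEquiv.ofInjectiveOfFinrankEq (genMap σ).toLinearMap (genMap_injective σ)
    (by rw [Module.finrank_fintype_fun_eq_card, Module.finrank_fintype_fun_eq_card, card_cone,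
      Fintype.card_fin])

/-- The logarithmic differentials are the generator map after a diagonal scaling. Conjugation by
`genEquiv` moves the scaling to an endomorphism of ℂ³, where determinants multiply. -/
theorem det_logMap (σ : Cone T) (p : Coord σ) (e : (Fin 3 → ℂ) →ₗ[ℂ] Coord σ) :
    LinearMap.det (logMap σ p ∘ₗ e) =
      (∏ ρ, p ρ)⁻¹ * LinearMap.det ((genMap σ).toLinearMap ∘ₗ e) := by
  have hG : ∀ v, genEquiv σ v = genMap σ v := fun v => rfl
  have h1 : logMap σ p ∘ₗ e = ((genEquiv σ).toLinearMap ∘ₗ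
      Matrix.toLin' (Matrix.diagonal fun ρ => (p ρ)⁻¹) ∘ₗ (genEquiv σ).symm.toLinearMap) ∘ₗ
        ((genMap σ).toLinearMap ∘ₗ e) := by
    apply LinearMap.ext
    intro v
    have h2 : (genEquiv σ).symm (genMap σ (e v)) = e v := by
      rw [← hG, LinearEquiv.symm_apply_apply]
    simp only [LinearMap.comp_apply, LinearEquiv.coe_coe, ContinuousLinearMap.coe_coe, h2, hG]
    rfl
  rw [h1, LinearMap.det_comp, LinearMap.det_conj, LinearMap.det_toLin', Matrix.det_diagonal,
    Finset.prod_inv_distrib]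

theorem logMap_transition {σ : Cone T} (τ : Cone T) {p : Coord σ} (hp : ∀ ρ, p ρ ≠ 0)
    (v : Coord σ) :
    logMap τ (transition σ τ p) (fderiv ℂ (transition σ τ) p v) = logMap σ p v := by
  rw [logMap_apply, logMap_apply, genMap_transition τ hp]

theorem det_genMap_ne_zero {σ : Cone T} {e : (Fin 3 → ℂ) →L[ℂ] Coord σ}
    (he : Function.Bijective e) :
    LinearMap.det ((genMap σ).toLinearMap ∘ₗ e.toLinearMap) ≠ 0 := by
  have hinj : Function.Injective ((genMap σ).toLinearMap ∘ₗ e.toLinearMap) :=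
    (genMap_injective σ).comp he.1
  intro h
  exact (LinearMap.bot_lt_ker_of_det_eq_zero h).ne' (LinearMap.ker_eq_bot.2 hinj)

theorem continuousOn_det_genMap {σ : Cone T} {e : ℂ → (Fin 3 → ℂ) →L[ℂ] Coord σ} {S : Set ℂ}
    (he : ContinuousOn e S) :
    ContinuousOn (fun t => LinearMap.det ((genMap σ).toLinearMap ∘ₗ (e t).toLinearMap)) S := by
  simp only [← LinearMap.det_toMatrix']
  refine Continuous.comp_continuousOn (Continuous.matrix_det continuous_id) ?_
  refine continuousOn_pi.2 fun i => continuousOn_pi.2 fun j => ?_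
  simp only [LinearMap.toMatrix'_apply]
  have h1 : Continuous fun A : (Fin 3 → ℂ) →L[ℂ] Coord σ =>
      genMap σ (A (Pi.single j 1)) i := by fun_prop
  exact h1.comp_continuousOn he

/-! ## Generic points on a holomorphic disc -/

theorem ball_subset_disc : Metric.ball (0 : ℂ) 1 ⊆ disc := Metric.ball_subset_closedBall

theorem contDiff_polar_mul_prod (σ : Cone T) :
    ContDiff ℂ ∞ fun p : Coord σ => polar (extend σ p) * ∏ ρ, p ρ :=
  (contDiff_polar σ).mul (contDiff_prod fun _ _ => by fun_prop)

theorem differentiableOn_comp {E : Type*} [NormedAddCommGroup E] [NormedSpace ℂ E] {h : E → ℂ}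
    (hh : ContDiff ℂ ∞ h) {g : ℂ → E} {S : Set ℂ} (hg : DifferentiableOn ℂ g S) :
    DifferentiableOn ℂ (fun t => h (g t)) S :=
  (hh.differentiable (by simp)).comp_differentiableOn hg

theorem analyticAt_comp {E : Type*} [NormedAddCommGroup E] [NormedSpace ℂ E] {h : E → ℂ}
    (hh : ContDiff ℂ ∞ h) {g : ℂ → E} {W : Set ℂ} (hW : IsOpen W)
    (hg : DifferentiableOn ℂ g (W ∩ Metric.ball 0 1)) {t : ℂ} (ht : t ∈ W)
    (ht' : t ∈ Metric.ball (0 : ℂ) 1) : AnalyticAt ℂ (fun t => h (g t)) t :=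
  (differentiableOn_comp hh hg).analyticAt ((hW.inter Metric.isOpen_ball).mem_nhds ⟨ht, ht'⟩)

theorem eventually_isGeneric {u : ℂ → Space T} (hu : IsHolomorphicDisc u) {t : ℂ} (ht : t ∈ disc)
    (h : IsGeneric (u t)) : ∀ᶠ s in 𝓝[disc] t, IsGeneric (u s) := by
  obtain ⟨σ, g, W, hW, htW, hg, -, hug⟩ := hu t ht
  rw [hug t ⟨htW, ht⟩, isGeneric_iff_polar] at h
  have h1 : ContinuousWithinAt g (W ∩ disc) t := hg.continuousOn t ⟨htW, ht⟩
  have h2 := ((contDiff_polar_mul_prod σ).continuous.continuousAt.comp_continuousWithinAt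
    h1).eventually_ne h
  have h3 : 𝓝[W ∩ disc] t = 𝓝[disc] t := by
    rw [inter_comm]
    exact nhdsWithin_inter_of_mem' (mem_nhdsWithin_of_mem_nhds (hW.mem_nhds htW))
  have h4 : ∀ᶠ s in 𝓝[W ∩ disc] t, s ∈ W ∩ disc := self_mem_nhdsWithin
  rw [← h3]
  filter_upwards [h2, h4] with s hs hs'
  rw [hug s hs', isGeneric_iff_polar]
  exact hs

theorem eventually_isGeneric_or {u : ℂ → Space T} (hu : IsHolomorphicDisc u) {t : ℂ}
    (ht : t ∈ Metric.ball (0 : ℂ) 1) :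
    (∀ᶠ s in 𝓝 t, ¬ IsGeneric (u s)) ∨ ∀ᶠ s in 𝓝[≠] t, IsGeneric (u s) := by
  obtain ⟨σ, g, W, hW, htW, -, hg, hug⟩ := hu t (ball_subset_disc ht)
  have hmem : ∀ᶠ s in 𝓝 t, s ∈ W ∩ Metric.ball 0 1 :=
    (hW.inter Metric.isOpen_ball).mem_nhds ⟨htW, ht⟩
  have hug' : ∀ s ∈ W ∩ Metric.ball 0 1, u s = chart σ (g s) :=
    fun s hs => hug s ⟨hs.1, ball_subset_disc hs.2⟩
  rcases (analyticAt_comp (contDiff_polar_mul_prod σ) hW hg htW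
    ht).eventually_eq_zero_or_eventually_ne_zero with h | h
  · left
    filter_upwards [h, hmem] with s hs hs'
    rw [hug' s hs', isGeneric_iff_polar]
    exact not_not.2 hs
  · right
    filter_upwards [h, hmem.filter_mono nhdsWithin_le_nhds] with s hs hs'
    rw [hug' s hs', isGeneric_iff_polar]
    exact hs

/-- Identity theorem: the two alternatives of `eventually_isGeneric_or` define disjoint open sets
covering the connected open disc. The first cannot be everything, because the boundary point 1 is
generic and genericity persists at nearby interior points. -/
theorem eventually_isGeneric_punctured {u : ℂ → Space T} (hu : IsHolomorphicDisc u)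
    (hb : ∀ t, ‖t‖ = 1 → IsGeneric (u t)) {t : ℂ} (ht : t ∈ Metric.ball (0 : ℂ) 1) :
    ∀ᶠ s in 𝓝[≠] t, IsGeneric (u s) := by
  by_contra hcon
  have h1 := (eventually_isGeneric_or hu ht).resolve_right hcon
  let S : Set ℂ := {t | ∀ᶠ s in 𝓝 t, ¬ IsGeneric (u s)}
  let S' : Set ℂ := {t | ∀ᶠ s in 𝓝[≠] t, IsGeneric (u s)}
  have hS : IsOpen S := isOpen_setOfPred_eventually_nhds
  have hS' : ∀ t ∈ S', S' ∈ 𝓝 t := by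
    intro t ht
    have h3 : ∀ᶠ s in 𝓝[≠] t, s ∈ S' := by
      have h4 := eventually_eventually_nhdsWithin.2 ht
      filter_upwards [h4, self_mem_nhdsWithin] with s hs hst
      rw [nhdsWithin_eq_nhds.2 (isOpen_compl_singleton.mem_nhds hst)] at hs
      exact hs.filter_mono nhdsWithin_le_nhds
    have h5 := eventually_nhdsWithin_iff.1 h3
    filter_upwards [h5] with s hs
    by_cases hst : s = t
    · rw [hst]; exact ht
    · exact hs hst
  have hS'o : IsOpen S' := isOpen_iff_mem_nhds.2 hS'
  have hdisj : Disjoint S S' := by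
    rw [Set.disjoint_left]
    intro t h2 h3
    obtain ⟨s, hs, hs'⟩ := ((h2.filter_mono nhdsWithin_le_nhds).and h3).exists
    exact hs hs'
  have hsub : Metric.ball (0 : ℂ) 1 ⊆ S :=
    (convex_ball (0 : ℂ) 1).isPreconnected.subset_left_of_subset_union hS hS'o hdisj
      (fun t ht => eventually_isGeneric_or hu ht) ⟨t, ht, h1⟩
  have h2 : (1 : ℂ) ∈ closure (Metric.ball (0 : ℂ) 1) := by
    rw [closure_ball _ one_ne_zero]
    simp
  have h3 := eventually_isGeneric hu (t := 1) (by simp) (hb 1 (by simp))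
  have h4 := h3.filter_mono (nhdsWithin_mono _ ball_subset_disc)
  have : (𝓝[Metric.ball (0 : ℂ) 1] 1).NeBot := mem_closure_iff_nhdsWithin_neBot.1 h2
  obtain ⟨s, hs, hs'⟩ := (h4.and self_mem_nhdsWithin).exists
  exact (hsub hs').self_of_nhds hs

/-! ## The volume form in a trivialization -/

/-- The reciprocal of the holomorphic volume form on the frame given by a trivialization. -/
def frameVolume (u : ℂ → Space T) (e : (σ : Cone T) → ℂ → (Fin 3 → ℂ) →L[ℂ] Coord σ)
    (t : ℂ) : ℂ :=
  (zChart (leftCone T) (coordOf _ (u t)) - 1) * (wChart (leftCone T) (coordOf _ (u t)) - 1) /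
    (zChart (leftCone T) (coordOf _ (u t)) * wChart (leftCone T) (coordOf _ (u t))) /
    LinearMap.det (logMap (leftCone T) (coordOf _ (u t)) ∘ₗ (e (leftCone T) t).toLinearMap)

/-- The quotient is defined through one fixed chart but has the same form in all charts. There the
numerator is the polar section and the denominator does not vanish for any frame, so every zero
comes from the polar divisor. -/
theorem frameVolume_eq {u : ℂ → Space T} {e : (σ : Cone T) → ℂ → (Fin 3 → ℂ) →L[ℂ] Coord σ}
    (he : IsTrivialization u e) {t : ℂ} (ht : t ∈ disc) {σ : Cone T} {p : Coord σ}
    (hp : u t = chart σ p) (hgen : IsGeneric (u t)) :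
    frameVolume u e t = polar (extend σ p) /
      LinearMap.det ((genMap σ).toLinearMap ∘ₗ (e σ t).toLinearMap) := by
  rw [hp, isGeneric_chart] at hgen
  have hmem := mem_range_of_torus (leftCone T) hgen.1
  have h1 : chart σ p = chart (leftCone T) (coordOf _ (u t)) := by
    rw [hp]; exact (chart_coordOf hmem).symm
  have h2 : e (leftCone T) t = (fderiv ℂ (transition σ (leftCone T)) p).comp (e σ t) :=
    he.compat σ _ t ht p _ hp ((contDiffAt_transition hmem).differentiableAt (by simp))
      (eventually_chart_transition hmem)
  have h3 : coordOf (leftCone T) (u t) = transition σ _ p := by rw [hp]; rfl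
  have h4 : logMap (leftCone T) (coordOf _ (u t)) ∘ₗ (e (leftCone T) t).toLinearMap =
      logMap σ p ∘ₗ (e σ t).toLinearMap := by
    apply LinearMap.ext
    intro v
    rw [h2, h3]
    exact logMap_transition (leftCone T) hgen.1 _
  have h5 : ∏ ρ, p ρ ≠ 0 := Finset.prod_ne_zero_iff.2 fun ρ _ => hgen.1 ρ
  rw [frameVolume, h4, zChart_eq h1, wChart_eq h1, det_logMap, polar_eq hgen.1]
  field_simp

/-- The integer n is the order of vanishing of the polar section along the disc. It may be zero at a
point that is not generic, for instance where the disc crosses z = 0, which is why the exceptional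
set consists of the non-generic points and finiteness is asserted only when n = 0. -/
theorem frameVolume_local {u : ℂ → Space T} {e : (σ : Cone T) → ℂ → (Fin 3 → ℂ) →L[ℂ] Coord σ}
    (hu : IsHolomorphicDisc u) (hb : ∀ t, ‖t‖ = 1 → IsGeneric (u t)) (he : IsTrivialization u e)
    {t₀ : ℂ} (ht₀ : t₀ ∈ disc) : ∃ n : ℕ, (n = 0 → IsFinite (u t₀)) ∧
      ∃ (G : ℂ → ℂ) (W : Set ℂ), IsOpen W ∧ t₀ ∈ W ∧
      ContinuousOn G (W ∩ disc) ∧ (∀ t ∈ W ∩ disc, G t ≠ 0) ∧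
      (∀ t ∈ W ∩ disc, t ≠ t₀ → t ∉ {t | ¬ IsGeneric (u t)} ∧
        frameVolume u e t = (t - t₀) ^ n * G t) ∧
      (t₀ ∉ {t | ¬ IsGeneric (u t)} → n = 0 ∧ frameVolume u e t₀ = G t₀) := by
  obtain ⟨σ, g, W, hW, htW, hg, hgd, hug⟩ := hu t₀ ht₀
  let N : ℂ → ℂ := fun t => LinearMap.det ((genMap σ).toLinearMap ∘ₗ (e σ t).toLinearMap)
  have hN : ContinuousOn N (W ∩ disc) :=
    (continuousOn_det_genMap (he.continuous σ)).mono fun t ht => ⟨ht.2, g t, (hug t ht).symm⟩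
  have hN0 : ∀ t ∈ W ∩ disc, N t ≠ 0 := fun t ht =>
    det_genMap_ne_zero (he.bijective σ t ht.2 ⟨g t, (hug t ht).symm⟩)
  have hF : ∀ t ∈ W ∩ disc, IsGeneric (u t) → frameVolume u e t = polar (extend σ (g t)) / N t :=
    fun t ht h => frameVolume_eq he ht.2 (hug t ht) h
  have hpol : ∀ t ∈ W ∩ disc, IsGeneric (u t) → polar (extend σ (g t)) ≠ 0 := by
    intro t ht h
    rw [hug t ht, isGeneric_iff_polar] at h
    exact left_ne_zero_of_mul h
  by_cases hgen : IsGeneric (u t₀)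
  · obtain ⟨V, hV, htV, hVg⟩ := mem_nhdsWithin.1 (eventually_isGeneric hu ht₀ hgen)
    have hsub : (W ∩ V) ∩ disc ⊆ W ∩ disc := inter_subset_inter_left _ inter_subset_left
    have hgen' : ∀ t ∈ (W ∩ V) ∩ disc, IsGeneric (u t) := fun t ht => hVg ⟨ht.1.2, ht.2⟩
    refine ⟨0, fun _ => ?_, fun t => polar (extend σ (g t)) / N t, W ∩ V, hW.inter hV,
      ⟨htW, htV⟩, ?_, ?_, ?_, ?_⟩
    · rw [hug t₀ ⟨htW, ht₀⟩, ← polar_ne_zero_iff]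
      exact hpol t₀ ⟨htW, ht₀⟩ hgen
    · refine ContinuousOn.div ?_ (hN.mono hsub) fun t ht => hN0 t (hsub ht)
      exact (contDiff_polar σ).continuous.comp_continuousOn (hg.continuousOn.mono hsub)
    · exact fun t ht => div_ne_zero (hpol t (hsub ht) (hgen' t ht)) (hN0 t (hsub ht))
    · intro t ht _
      refine ⟨not_not.2 (hgen' t ht), ?_⟩
      rw [pow_zero, one_mul, hF t (hsub ht) (hgen' t ht)]
    · exact fun _ => ⟨rfl, hF t₀ ⟨htW, ht₀⟩ hgen⟩
  -- Boundary points are generic, so this case occurs only in the interior, where the polar section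
  -- is analytic along the disc.
  · have hball : t₀ ∈ Metric.ball (0 : ℂ) 1 := by
      rw [mem_ball_zero_iff]
      refine lt_of_le_of_ne (by simpa using ht₀) fun h => hgen (hb t₀ h)
    have han := analyticAt_comp (contDiff_polar σ) hW hgd htW hball
    have hev := eventually_isGeneric_punctured hu hb hball
    have hWev : ∀ᶠ t in 𝓝 t₀, t ∈ W ∩ Metric.ball 0 1 :=
      (hW.inter Metric.isOpen_ball).mem_nhds ⟨htW, hball⟩
    have hne : ¬ ∀ᶠ t in 𝓝 t₀, polar (extend σ (g t)) = 0 := by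
      intro h
      obtain ⟨t, ⟨ht, ht'⟩, ht''⟩ :=
        (((h.and hWev).filter_mono nhdsWithin_le_nhds).and hev).exists
      exact hpol t ⟨ht'.1, ball_subset_disc ht'.2⟩ ht'' ht
    obtain ⟨n, h, hh, hh0, hhe⟩ := han.exists_eventuallyEq_pow_smul_nonzero_iff.2 hne
    have hgood : ∀ᶠ t in 𝓝 t₀, t ∈ W ∩ Metric.ball 0 1 ∧ AnalyticAt ℂ h t ∧ h t ≠ 0 ∧
        polar (extend σ (g t)) = (t - t₀) ^ n • h t ∧ (t ≠ t₀ → IsGeneric (u t)) := by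
      filter_upwards [hWev, hh.eventually_analyticAt, hh.continuousAt.eventually_ne hh0, hhe,
        eventually_nhdsWithin_iff.1 hev] with t h1 h2 h3 h4 h5
      exact ⟨h1, h2, h3, h4, h5⟩
    obtain ⟨V, hVsub, hV, htV⟩ := eventually_nhds_iff.1 hgood
    have hsub : V ∩ disc ⊆ W ∩ disc := fun t ht => ⟨(hVsub t ht.1).1.1, ht.2⟩
    refine ⟨n, fun hn => ?_, fun t => h t / N t, V, hV, htV, ?_, ?_, ?_, ?_⟩
    · rw [hug t₀ ⟨htW, ht₀⟩, ← polar_ne_zero_iff, (hVsub t₀ htV).2.2.2.1, hn]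
      simpa using hh0
    · refine ContinuousOn.div (fun t ht => ?_) (hN.mono hsub) fun t ht => hN0 t (hsub ht)
      exact (hVsub t ht.1).2.1.continuousAt.continuousWithinAt
    · exact fun t ht => div_ne_zero (hVsub t ht.1).2.2.1 (hN0 t (hsub ht))
    · intro t ht hne
      have h1 := (hVsub t ht.1).2.2.2.2 hne
      refine ⟨not_not.2 h1, ?_⟩
      rw [hF t (hsub ht) h1, (hVsub t ht.1).2.2.2.1, smul_eq_mul, mul_div_assoc]
    · exact fun h => (h hgen).elim

/-! ## The phase of the volume form on the fibers -/

theorem fderiv_moment_single {κ : ToricKahlerForm T} {n : Fin 3 → ℤ} {μ : Space T → ℝ}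
    (hμ : IsMomentMap κ n μ) {σ : Cone T} {a : {ρ // ρ ∈ σ.1} → ℤ} (ha : ∑ ρ, a ρ • gen ρ.1 = n)
    {ρ₀ : {ρ // ρ ∈ σ.1}} {p : Coord σ} (hp : ∀ ρ, ρ ≠ ρ₀ → a ρ * p ρ = 0) (c : ℂ) :
    fderiv ℝ (fun p => μ (chart σ p)) p (Pi.single ρ₀ c) =
      a ρ₀ * (c * starRingEnd ℂ (p ρ₀)).re * lineNorm κ σ ρ₀ p := by
  rw [hμ.deriv_eq σ a ha]
  have h4 : (fun ρ => Complex.I * a ρ * p ρ) =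
      Pi.single ρ₀ (Complex.I * a ρ₀ * p ρ₀) := by
    ext ρ
    by_cases h : ρ = ρ₀
    · subst h
      simp
    · simp [h, mul_assoc, hp ρ h]
  rw [h4, form_single]
  congr 1
  simp
  ring

theorem re_mul_mul_conj (c x : ℂ) : (c * x * starRingEnd ℂ x).re = c.re * Complex.normSq x := by
  rw [mul_assoc, Complex.mul_conj, Complex.re_mul_ofReal]

/-- A vector can be made tangent to the levels of the moment map by adding a radial vector. -/
theorem exists_radial {κ : ToricKahlerForm T} {n : Fin 3 → ℤ} {μ : Space T → ℝ}
    (hμ : IsMomentMap κ n μ) {σ : Cone T} {a : {ρ // ρ ∈ σ.1} → ℤ} (ha : ∑ ρ, a ρ • gen ρ.1 = n)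
    {ρ₀ : {ρ // ρ ∈ σ.1}} {p : Coord σ} (hp : ∀ ρ, ρ ≠ ρ₀ → a ρ * p ρ = 0) (h0 : a ρ₀ ≠ 0)
    (hp0 : p ρ₀ ≠ 0) (v : Coord σ) :
    ∃ r : ℝ, fderiv ℝ (fun p => μ (chart σ p)) p (v + Pi.single ρ₀ (r * p ρ₀)) = 0 := by
  set m : ℝ := a ρ₀ * Complex.normSq (p ρ₀) * lineNorm κ σ ρ₀ p with hm
  have hm0 : m ≠ 0 := mul_ne_zero (mul_ne_zero (by exact_mod_cast h0)
    (Complex.normSq_eq_zero.not.2 hp0)) (lineNorm_pos _ _ _ _).ne'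
  refine ⟨-(fderiv ℝ (fun p => μ (chart σ p)) p v) / m, ?_⟩
  rw [map_add, fderiv_moment_single hμ ha hp, re_mul_mul_conj, Complex.ofReal_re]
  have : ∀ r : ℝ, (a ρ₀ : ℝ) * (r * Complex.normSq (p ρ₀)) * lineNorm κ σ ρ₀ p = r * m := by
    intro r; rw [hm]; ring
  rw [this]
  field_simp
  ring

theorem zChart_left (p : Coord (leftCone T)) : zChart (leftCone T) p = p ⟨bot 0, by simp⟩ := by
  simp [zChart, zVal, extend]

theorem wChart_left (p : Coord (leftCone T)) : wChart (leftCone T) p = p ⟨top 0, by simp⟩ := by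
  simp [wChart, wVal, extend]

theorem logMap_single (σ : Cone T) (p : Coord σ) (ρ₀ : {ρ // ρ ∈ σ.1}) (c : ℂ) (j : Fin 3) :
    logMap σ p (Pi.single ρ₀ c) j = c / p ρ₀ * gen ρ₀.1 j := by
  rw [logMap_apply, genMap_apply, Finset.sum_eq_single ρ₀]
  · simp
  · intro ρ _ h
    simp [h]
  · simp

/-- In the chart with coordinates 1/ξ, z, w the fiber has the tangent basis `v` below. Its
logarithmic determinant is -i(z-1)(w-1)/(zw), because the radial corrections are multiples of the
first column. So the matrix of this basis in the frame has determinant -i times `frameVolume`, and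
squaring produces the sign. -/
theorem frameVolume_phase {κ : ToricKahlerForm T} {μ : Space T → ℝ}
    (hμ : IsMomentMap κ ![1, 0, 0] μ) {u : ℂ → Space T}
    {e : (σ : Cone T) → ℂ → (Fin 3 → ℂ) →L[ℂ] Coord σ} (he : IsTrivialization u e) {t : ℂ}
    (ht : t ∈ disc) (hgen : IsGeneric (u t)) {c : ℂ}
    (hA : ∀ (p : Coord (leftCone T)), u t = chart _ p → ∀ A : Matrix (Fin 3) (Fin 3) ℂ,
      LinearIndependent ℝ (fun j => e (leftCone T) t (A.col j)) →
      (∀ j, e (leftCone T) t (A.col j) ∈ fiberTangent μ (leftCone T) p) →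
      A.det ^ 2 = (‖A.det‖ : ℂ) ^ 2 * c) :
    frameVolume u e t ^ 2 = -((‖frameVolume u e t‖ : ℂ) ^ 2 * c) := by
  set σ := leftCone T with hσ
  obtain ⟨p, hp⟩ : ∃ p : Coord σ, u t = chart σ p := by
    obtain ⟨τ, q, hq⟩ := exists_chart (u t)
    have := hgen
    rw [← hq, isGeneric_chart] at this
    obtain ⟨p, h⟩ := mem_range_of_torus σ this.1
    exact ⟨p, by rw [← hq, h]⟩
  have hcoord : coordOf σ (u t) = p := by rw [hp, coordOf_chart_self]
  have hgen' := hgen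
  rw [hp] at hgen'
  have hfin : IsFinitePoint σ p := by
    rw [isGeneric_iff_polar, mul_ne_zero_iff, polar_ne_zero_iff, isFinite_chart] at hgen'
    exact hgen'.1.1
  rw [isGeneric_chart] at hgen'
  obtain ⟨hp0, hz1, hw1⟩ := hgen'
  let X : {ρ // ρ ∈ σ.1} := ⟨xiInf, by simp [hσ]⟩
  let Y : {ρ // ρ ∈ σ.1} := ⟨bot 0, by simp [hσ]⟩
  let Z : {ρ // ρ ∈ σ.1} := ⟨top 0, by simp [hσ]⟩
  have hzp : zChart σ p = p Y := zChart_left p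
  have hwp : wChart σ p = p Z := wChart_left p
  have hXY : X ≠ Y := by simp [X, Y]
  have hXZ : X ≠ Z := by simp [X, Z]
  have hYZ : Y ≠ Z := by simp [Y, Z]
  have hdz : ∀ v, fderiv ℂ (zChart σ) p v = v Y := by
    intro v
    have : zChart σ = fun p => (ContinuousLinearMap.proj Y : Coord σ →L[ℂ] ℂ) p :=
      funext zChart_left
    rw [this, ContinuousLinearMap.fderiv]
    rfl
  have hdw : ∀ v, fderiv ℂ (wChart σ) p v = v Z := by
    intro v
    have : wChart σ = fun p => (ContinuousLinearMap.proj Z : Coord σ →L[ℂ] ℂ) p :=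
      funext wChart_left
    rw [this, ContinuousLinearMap.fderiv]
    rfl
  rw [hzp] at hz1
  rw [hwp] at hw1
  have hz1' := sub_ne_zero.2 hz1
  have hw1' := sub_ne_zero.2 hw1
  have ha := sum_weight_single (σ := σ) (ρ₀ := X) (c := -1) (n := ![1, 0, 0]) (by simp [gen, X])
  have hfix : ∀ ρ, ρ ≠ X → ((Pi.single X (-1) : {ρ // ρ ∈ σ.1} → ℤ) ρ : ℂ) * p ρ = 0 :=
    fun ρ hρ => single_weight_mul _ hρ
  obtain ⟨r, hr⟩ := exists_radial hμ ha hfix (by simp) (hp0 X)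
    (Pi.single Y (Complex.I * (p Y - 1)))
  obtain ⟨r', hr'⟩ := exists_radial hμ ha hfix (by simp) (hp0 X)
    (Pi.single Z (Complex.I * (p Z - 1)))
  let v : Fin 3 → Coord σ := ![Pi.single X (Complex.I * p X),
    Pi.single Y (Complex.I * (p Y - 1)) + Pi.single X (r * p X),
    Pi.single Z (Complex.I * (p Z - 1)) + Pi.single X (r' * p X)]
  have hbij := he.bijective σ t ht ⟨p, hp.symm⟩
  choose B hB using fun j => hbij.2 (v j)
  -- The columns of A are the basis vectors `v` written in the frame e, so that the hypothesis on
  -- phases applies to A.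
  let A : Matrix (Fin 3) (Fin 3) ℂ := Matrix.of fun i j => B j i
  have hcol : ∀ j, e σ t (A.col j) = v j := fun j => hB j
  have hI : ∀ x : ℂ, x ≠ 0 → (x⁻¹ * (Complex.I * x)).re = 0 := by
    intro x hx
    rw [mul_left_comm, inv_mul_cancel₀ hx]
    simp
  have hlin : LinearIndependent ℝ v := by
    rw [Fintype.linearIndependent_iff]
    intro c hc
    rw [Fin.sum_univ_three] at hc
    have h1 := congrFun hc Y
    have h2 := congrFun hc Z
    have h3 := congrFun hc X
    simp [v, hXY, hXY.symm, hXZ, hXZ.symm, hYZ, hYZ.symm, hz1', hw1'] at h1 h2 h3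
    rw [h1, h2] at h3
    simp [hp0 X] at h3
    intro i
    fin_cases i
    exacts [h3, h1, h2]
  have htan : ∀ j, v j ∈ fiberTangent μ σ p := by
    intro j
    rw [mem_fiberTangent_iff hμ hfin, hdz, hdw, hzp, hwp]
    fin_cases j
    · refine ⟨by simp [v, hXY], by simp [v, hXZ], ?_⟩
      change fderiv ℝ (fun p => μ (chart σ p)) p (Pi.single X (Complex.I * p X)) = 0
      rw [fderiv_moment_single hμ ha hfix, re_mul_mul_conj]
      simp
    · refine ⟨?_, by simp [v, hYZ, hXZ], hr⟩
      simpa only [v, hXY, Fin.mk_one, Matrix.cons_val_one, Matrix.cons_val_zero, Pi.add_apply,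
        Pi.single_eq_same, Pi.single_eq_of_ne hXY.symm, add_zero] using hI _ hz1'
    · refine ⟨by simp [v, hYZ, hXY], ?_, hr'⟩
      simpa only [v, Fin.reduceFinMk, Matrix.cons_val, Pi.add_apply,
        Pi.single_eq_same, Pi.single_eq_of_ne hXZ.symm, add_zero] using hI _ hw1'
  have hdet := hA p hp A (by simpa only [hcol] using hlin) (by simpa only [hcol] using htan)
  set J := LinearMap.det (logMap σ p ∘ₗ (e σ t).toLinearMap) with hJ
  have hJ0 : J ≠ 0 := by
    rw [hJ, det_logMap]
    exact mul_ne_zero (inv_ne_zero (Finset.prod_ne_zero_iff.2 fun ρ _ => hp0 ρ))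
      (det_genMap_ne_zero hbij)
  have hJA : J * A.det = -Complex.I * ((p Y - 1) * (p Z - 1) / (p Y * p Z)) := by
    have h1 : J * A.det = LinearMap.det
        ((logMap σ p ∘ₗ (e σ t).toLinearMap) ∘ₗ Matrix.toLin' A) := by
      rw [LinearMap.det_comp, LinearMap.det_toLin']
    have h2 : LinearMap.toMatrix' ((logMap σ p ∘ₗ (e σ t).toLinearMap) ∘ₗ Matrix.toLin' A) =
        Matrix.of fun i j => logMap σ p (v j) i := by
      ext i j
      rw [LinearMap.toMatrix'_apply]
      simp only [LinearMap.comp_apply, Matrix.toLin'_apply, Matrix.of_apply]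
      rw [← hcol j]
      simp
    rw [h1, ← LinearMap.det_toMatrix', h2, Matrix.det_fin_three]
    simp only [Matrix.of_apply, v, Matrix.cons_val, map_add, Pi.add_apply, logMap_single]
    have hX := hp0 X
    have hY := hp0 Y
    have hZ := hp0 Z
    have hgX : gen X.1 = ![-1, 0, 0] := by simp [gen, X]
    have hgY : gen Y.1 = ![0, 0, 1] := by simp [gen, Y, Vertex.coord]
    have hgZ : gen Z.1 = ![0, 1, 1] := by simp [gen, Z, Vertex.coord]
    simp only [hgX, hgY, hgZ, Matrix.cons_val]
    generalize p X = x at *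
    generalize p Y = y at *
    generalize p Z = z at *
    push_cast
    field_simp
    linear_combination ((y - 1) * (z - 1)) * Complex.I_sq
  have hFA : A.det = -Complex.I * frameVolume u e t := by
    have h1 : frameVolume u e t = (p Y - 1) * (p Z - 1) / (p Y * p Z) / J := by
      rw [frameVolume, hcoord, hzp, hwp]
    rw [h1, ← mul_div_assoc, ← hJA, mul_div_cancel_left₀ _ hJ0]
  rw [hFA] at hdet
  simp only [mul_pow, neg_sq, Complex.I_sq, norm_mul, norm_neg, Complex.norm_I, one_mul] at hdet
  linear_combination -hdet

/-! ## Discs of Maslov index zero -/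

/-- A function on the disc with holomorphic expressions in the charts inherits holomorphy inside and
continuity up to the boundary from the local lifts of the disc. -/
theorem diffContOnCl_of_charts {u : ℂ → Space T} (hu : IsHolomorphicDisc u) {f : ℂ → ℂ}
    (h : (σ : Cone T) → Coord σ → ℂ) (hh : ∀ t ∈ disc, ∀ (σ : Cone T) (p : Coord σ),
      u t = chart σ p → ContDiffAt ℂ ∞ (h σ) p ∧ f t = h σ p) :
    DiffContOnCl ℂ f (Metric.ball 0 1) := by
  constructor
  · intro t ht
    obtain ⟨σ, g, W, hW, htW, -, hg, hug⟩ := hu t (ball_subset_disc ht)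
    have hmem : W ∩ Metric.ball 0 1 ∈ 𝓝 t := (hW.inter Metric.isOpen_ball).mem_nhds ⟨htW, ht⟩
    have hug' : ∀ s ∈ W ∩ Metric.ball 0 1, u s = chart σ (g s) :=
      fun s hs => hug s ⟨hs.1, ball_subset_disc hs.2⟩
    have h1 : DifferentiableAt ℂ (fun s => h σ (g s)) t :=
      ((hh t (ball_subset_disc ht) σ _ (hug' t ⟨htW, ht⟩)).1.differentiableAt (by simp)).comp t
        (hg.differentiableAt hmem)
    refine (h1.congr_of_eventuallyEq ?_).differentiableWithinAt
    filter_upwards [hmem] with s hs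
    exact (hh s (ball_subset_disc hs.2) σ _ (hug' s hs)).2
  · rw [closure_ball _ one_ne_zero]
    intro t ht
    obtain ⟨σ, g, W, hW, htW, hg, -, hug⟩ := hu t ht
    have h1 : ContinuousWithinAt (fun s => h σ (g s)) (W ∩ disc) t :=
      (hh t ht σ _ (hug t ⟨htW, ht⟩)).1.continuousAt.comp_continuousWithinAt
        (hg.continuousOn t ⟨htW, ht⟩)
    have h2 := h1.congr (fun s hs => (hh s hs.2 σ _ (hug s hs)).2)
      (hh t ht σ _ (hug t ⟨htW, ht⟩)).2
    exact (continuousWithinAt_inter' (mem_nhdsWithin_of_mem_nhds (hW.mem_nhds htW))).1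
      (by rwa [inter_comm] at h2)

/-- A holomorphic function without zeros on the disc is constant if its absolute value is constant
on the boundary. -/
theorem eq_of_norm_eq_on_sphere {f : ℂ → ℂ} (hf : DiffContOnCl ℂ f (Metric.ball 0 1))
    (h0 : ∀ t ∈ disc, f t ≠ 0) {c : ℝ} (hc : ∀ t : ℂ, ‖t‖ = 1 → ‖f t‖ = c) {t : ℂ}
    (ht : t ∈ disc) : f t = f 0 := by
  have hcl : closure (Metric.ball (0 : ℂ) 1) = disc := closure_ball _ one_ne_zero
  have hfr : frontier (Metric.ball (0 : ℂ) 1) = Metric.sphere 0 1 := frontier_ball _ one_ne_zero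
  have hcpos : 0 < c := by
    rw [← hc 1 (by simp)]
    exact norm_pos_iff.2 (h0 1 (by simp))
  have hle : ∀ s ∈ disc, ‖f s‖ ≤ c := by
    intro s hs
    refine Complex.norm_le_of_forall_mem_frontier_norm_le Metric.isBounded_ball hf
      (fun r hr => ?_) (hcl ▸ hs)
    rw [hfr] at hr
    exact (hc r (by simpa using hr)).le
  have hge : c ≤ ‖f 0‖ := by
    have h1 := Complex.norm_le_of_forall_mem_frontier_norm_le (f := fun s => (f s)⁻¹) (C := c⁻¹)
      (z := 0) Metric.isBounded_ball (hf.inv fun s hs => h0 s (hcl ▸ hs)) (fun r hr => ?_)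
      (hcl ▸ by simp)
    · rw [norm_inv] at h1
      exact (inv_le_inv₀ (norm_pos_iff.2 (h0 0 (by simp))) hcpos).1 h1
    · rw [hfr] at hr
      rw [norm_inv, hc r (by simpa using hr)]
  exact Complex.eqOn_closure_of_isPreconnected_of_isMaxOn_norm
    (convex_ball (0 : ℂ) 1).isPreconnected Metric.isOpen_ball hf (c := 0) (by simp)
    (fun s hs => (hle s (ball_subset_disc hs)).trans hge) (hcl ▸ ht)

theorem logDist_coe (ζ : ℂ) : logDist (ζ : OnePoint ℂ) = ENNReal.log ‖ζ - 1‖ₑ := rfl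

theorem logDist_coe_eq_iff {ζ ζ' : ℂ} :
    logDist (ζ : OnePoint ℂ) = logDist (ζ' : OnePoint ℂ) ↔ ‖ζ - 1‖ = ‖ζ' - 1‖ := by
  rw [logDist_coe, logDist_coe, ENNReal.log_injective.eq_iff, enorm_eq_iff_norm_eq]

theorem logDist_zero : logDist ((0 : ℂ) : OnePoint ℂ) = 0 := by
  rw [logDist_coe]
  simp

theorem eq_on_disc_of_isFinite {u : ℂ → Space T} (hu : IsHolomorphicDisc u)
    (hfin : ∀ t ∈ disc, IsFinite (u t)) {ζ : Space T → OnePoint ℂ}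
    {ζc : (σ : Cone T) → Coord σ → ℂ} {b : EReal} (hb : ∀ t : ℂ, ‖t‖ = 1 → logDist (ζ (u t)) = b)
    (hζ : ∀ (σ : Cone T) p, IsFinitePoint σ p →
      ζ (chart σ p) = (ζc σ p : OnePoint ℂ) ∧ ContDiffAt ℂ ∞ (ζc σ) p ∧ ζc σ p ≠ 1) :
    ∃ c : ℂ, ∀ t ∈ disc, ζ (u t) = (c : OnePoint ℂ) := by
  -- The value 0 assigned to ∞ is never used, since finite points have ζ ≠ ∞.
  let f : ℂ → ℂ := fun t => (ζ (u t)).elim 0 id - 1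
  have hf : ∀ t ∈ disc, ∀ (σ : Cone T) (p : Coord σ), u t = chart σ p →
      ContDiffAt ℂ ∞ (fun p => ζc σ p - 1) p ∧ f t = ζc σ p - 1 := by
    intro t ht σ p hp
    have h1 := hfin t ht
    rw [hp, isFinite_chart] at h1
    obtain ⟨h2, h3, -⟩ := hζ σ p h1.1
    refine ⟨h3.sub contDiffAt_const, ?_⟩
    simp only [f]
    rw [hp, h2]
    rfl
  have hcoe : ∀ t ∈ disc, ζ (u t) = ((f t + 1 : ℂ) : OnePoint ℂ) ∧ f t ≠ 0 := by
    intro t ht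
    obtain ⟨σ, p, hp⟩ := exists_chart (u t)
    have h1 := hfin t ht
    rw [← hp, isFinite_chart] at h1
    obtain ⟨h2, -, h4⟩ := hζ σ p h1.1
    rw [(hf t ht σ p hp.symm).2, ← hp, h2, sub_add_cancel]
    exact ⟨rfl, sub_ne_zero.2 h4⟩
  have hdc := diffContOnCl_of_charts hu _ hf
  have hnorm : ∀ t : ℂ, ‖t‖ = 1 → ‖f t‖ = ‖f 1‖ := by
    intro t ht
    have h1 := hb t ht
    rw [← hb 1 (by simp), (hcoe t (by simp [ht])).1, (hcoe 1 (by simp)).1,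
      logDist_coe_eq_iff] at h1
    simpa using h1
  refine ⟨f 0 + 1, fun t ht => ?_⟩
  rw [(hcoe t ht).1, eq_of_norm_eq_on_sphere hdc (fun t ht => (hcoe t ht).2) hnorm ht]

/-- Index zero forces the sum of the non-negative orders along the polar divisor to vanish, hence
each order, and order zero means that the disc avoids the divisor. -/
theorem isFinite_of_hasMaslovIndex_zero {κ : ToricKahlerForm T} {μ : Space T → ℝ}
    (hμ : IsMomentMap κ ![1, 0, 0] μ) {u : ℂ → Space T} (hu : IsHolomorphicDisc u)
    (hgen : ∀ t, ‖t‖ = 1 → IsGeneric (u t)) (hmas : HasMaslovIndex μ u 0) {t : ℂ} (ht : t ∈ disc) :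
    IsFinite (u t) := by
  obtain ⟨e, φ, he, hφ, hφ0, hA⟩ := hmas
  have hloc := fun t₀ (ht₀ : t₀ ∈ disc) => frameVolume_local hu hgen he ht₀
  choose! n hn hloc using hloc
  refine hn t ht (order_eq_zero_of_phase (F := frameVolume u e) hφ (by simpa using hφ0)
    (fun θ => ?_) (fun t ht => not_not.2 (hgen t ht)) hloc t ht)
  have h1 : ‖Complex.exp (θ * Complex.I)‖ = 1 := Complex.norm_exp_ofReal_mul_I θ
  exact frameVolume_phase hμ he (by simp [h1]) (hgen _ h1) fun p hp => hA θ _ p hp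

/-- A disc in the torus on which `z` and `w` are constant and whose boundary lies in a level
of the moment map is constant. -/
theorem disc_const {κ : ToricKahlerForm T} {μ : Space T → ℝ}
    (hμ : IsMomentMap κ ![1, 0, 0] μ) {u : ℂ → Space T} (hu : IsHolomorphicDisc u)
    (hgen : ∀ t ∈ disc, IsGeneric (u t)) {c d : ℂ} (hz : ∀ t ∈ disc, z (u t) = (c : OnePoint ℂ))
    (hw : ∀ t ∈ disc, w (u t) = (d : OnePoint ℂ)) {m : ℝ} (hm : ∀ t : ℂ, ‖t‖ = 1 → μ (u t) = m)
    {t : ℂ} (ht : t ∈ disc) : u t = u 0 := by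
  set σ := leftCone T with hσ
  let X : {ρ // ρ ∈ σ.1} := ⟨xiInf, by simp [hσ]⟩
  let q : ℂ → Coord σ := fun t => coordOf σ (u t)
  have hrange : ∀ t ∈ disc, u t ∈ range (chart σ) := by
    intro t ht
    obtain ⟨τ, p, hp⟩ := exists_chart (u t)
    have h := hgen t ht
    rw [← hp, isGeneric_chart] at h
    rw [← hp]
    exact mem_range_of_torus σ h.1
  have hq : ∀ t ∈ disc, chart σ (q t) = u t := fun t ht => chart_coordOf (hrange t ht)
  have hq0 : ∀ t ∈ disc, ∀ ρ, q t ρ ≠ 0 := by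
    intro t ht
    have h := hgen t ht
    rw [← hq t ht, isGeneric_chart] at h
    exact h.1
  have hqz : ∀ t ∈ disc, q t ⟨bot 0, by simp [hσ]⟩ = c := by
    intro t ht
    refine (zChart_left (q t)).symm.trans ?_
    have h := hz t ht
    rw [← hq t ht, z_chart σ _ (extend_ne_zero (hq0 t ht) _)] at h
    exact OnePoint.coe_injective h
  have hqw : ∀ t ∈ disc, q t ⟨top 0, by simp [hσ]⟩ = d := by
    intro t ht
    refine (wChart_left (q t)).symm.trans ?_
    have h := hw t ht
    rw [← hq t ht, w_chart σ _ (extend_ne_zero (hq0 t ht) _)] at h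
    exact OnePoint.coe_injective h
  -- With z and w constant, only the coordinate 1/ξ varies: the disc stays in one orbit of the
  -- complexified circle.
  have hupd : ∀ t ∈ disc, q t = Function.update (q 0) X (q t X) := by
    intro t ht
    ext ⟨ρ, hρ⟩
    have hρ' : ρ = xiInf ∨ ρ = bot 0 ∨ ρ = top 0 := by simpa [hσ] using hρ
    rcases hρ' with rfl | rfl | rfl
    · exact (Function.update_self X (q t X) (q 0)).symm
    · rw [Function.update_of_ne (by simp [X]), hqz t ht, hqz 0 (by simp)]
    · rw [Function.update_of_ne (by simp [X]), hqw t ht, hqw 0 (by simp)]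
  have ha := sum_weight_single (σ := σ) (ρ₀ := X) (c := -1) (n := ![1, 0, 0]) (by simp [gen, X])
  have hnorm : ∀ t : ℂ, ‖t‖ = 1 → ‖q t X‖ = ‖q 1 X‖ := by
    intro t ht
    have htd : t ∈ disc := by simp [ht]
    have h1d : (1 : ℂ) ∈ disc := by simp
    rw [← moment_eq_iff hμ ha (p := q 0) (ρ₀ := X) (fun ρ hρ => single_weight_mul _ hρ) (by simp)
      (hq0 t htd X) (hq0 1 h1d X), ← hupd t htd, ← hupd 1 h1d, hq t htd, hq 1 h1d, hm t ht,
      hm 1 (by simp)]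
  have hdc : DiffContOnCl ℂ (fun t => q t X) (Metric.ball 0 1) := by
    refine diffContOnCl_of_charts hu (fun τ p => transition τ σ p X) fun t ht τ p hp => ⟨?_, ?_⟩
    · exact contDiffAt_pi.1 (contDiffAt_transition (hp ▸ hrange t ht)) X
    · simp only [q, hp]
      rfl
  have h1 := eq_of_norm_eq_on_sphere hdc (fun t ht => hq0 t ht X) hnorm ht
  have h2 := hupd t ht
  change q t X = q 0 X at h1
  rw [h1, Function.update_eq_self] at h2
  rw [← hq t ht, ← hq 0 (by simp), h2]

/-- Off both planes |z-1| ≠ 1 and |w-1| ≠ 1, which excludes z = 0 and w = 0 on the boundary. Once z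
and w are known to be constant, this excludes them on the whole disc. The disc then lies in the
torus, where `disc_const` applies. -/
theorem wall_subset {κ : ToricKahlerForm T} {μ : Space T → ℝ} (hμ : IsMomentMap κ ![1, 0, 0] μ)
    {b : EReal × EReal × ℝ} (hb : b ∈ wall μ) : b.1 = 0 ∨ b.2.1 = 0 := by
  by_contra! hcon
  obtain ⟨⟨-, hdisc⟩, u, hu, hbd, ⟨s, hs, t, ht, hst⟩, hmas⟩ := hb
  have hreg : ∀ t : ℂ, ‖t‖ = 1 → IsRegularPoint μ (u t) := by
    intro t ht
    by_contra h
    exact hdisc ⟨u t, h, hbd t ht⟩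
  have hbz : ∀ t : ℂ, ‖t‖ = 1 → logDist (z (u t)) = b.1 := fun t ht =>
    congrArg Prod.fst (hbd t ht)
  have hbw : ∀ t : ℂ, ‖t‖ = 1 → logDist (w (u t)) = b.2.1 := fun t ht =>
    congrArg (fun b => b.2.1) (hbd t ht)
  have hgen : ∀ t : ℂ, ‖t‖ = 1 → IsGeneric (u t) := by
    intro t ht
    obtain ⟨σ, p, hp⟩ := exists_chart (u t)
    have h1 := hreg t ht
    have h2 := hbz t ht
    have h3 := hbw t ht
    rw [← hp] at h1 h2 h3 ⊢
    have h4 := isFinitePoint_of_isRegularPoint h1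
    rw [z_chart σ p h4.zInf_ne] at h2
    rw [w_chart σ p h4.wInf_ne] at h3
    refine isGeneric_of_isRegularPoint hμ h1 (fun h => hcon.1 ?_) fun h => hcon.2 ?_
    · rw [← h2, h, logDist_zero]
    · rw [← h3, h, logDist_zero]
  have hfin : ∀ t ∈ disc, IsFinite (u t) := fun t ht =>
    isFinite_of_hasMaslovIndex_zero hμ hu hgen hmas ht
  obtain ⟨c, hc⟩ := eq_on_disc_of_isFinite hu hfin (ζc := zChart) hbz fun σ p h =>
    ⟨z_chart σ p h.zInf_ne, contDiffAt_zChart h.zInf_ne, h.z_ne⟩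
  obtain ⟨d, hd⟩ := eq_on_disc_of_isFinite hu hfin (ζc := wChart) hbw fun σ p h =>
    ⟨w_chart σ p h.wInf_ne, contDiffAt_wChart h.wInf_ne, h.w_ne⟩
  have hc0 : c ≠ 0 := by
    rintro rfl
    apply hcon.1
    rw [← hbz 1 (by simp), hc 1 (by simp), logDist_zero]
  have hd0 : d ≠ 0 := by
    rintro rfl
    apply hcon.2
    rw [← hbw 1 (by simp), hd 1 (by simp), logDist_zero]
  have hgen' : ∀ t ∈ disc, IsGeneric (u t) := by
    intro t ht
    obtain ⟨σ, p, hp⟩ := exists_chart (u t)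
    have h1 := hfin t ht
    have h2 := hc t ht
    have h3 := hd t ht
    rw [← hp] at h1 h2 h3 ⊢
    obtain ⟨h4, h5, h6⟩ := isFinite_chart.1 h1
    rw [z_chart σ p h4.zInf_ne] at h2
    rw [w_chart σ p h4.wInf_ne] at h3
    have h7 : zChart σ p ≠ 0 := OnePoint.coe_injective h2 ▸ hc0
    have h8 : wChart σ p ≠ 0 := OnePoint.coe_injective h3 ▸ hd0
    rw [isGeneric_chart, extend_ne_zero_iff]
    refine ⟨?_, h4.z_ne, h4.w_ne⟩
    rintro (⟨i | j⟩ | m)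
    · exact Finset.prod_ne_zero_iff.1 (div_ne_zero_iff.1 h7).1 i (Finset.mem_univ _)
    · exact Finset.prod_ne_zero_iff.1 (div_ne_zero_iff.1 h8).1 j (Finset.mem_univ _)
    · fin_cases m
      exacts [h4.zInf_ne, h4.wInf_ne, h5, h6]
  have hconst := fun t ht => disc_const hμ hu hgen' hc hd (m := b.2.2) (t := t)
    (fun t ht => congrArg (fun b => b.2.2) (hbd t ht)) ht
  exact hst ((hconst s hs).trans (hconst t ht).symm)

/-! ## Trivializations along discs in a chart -/

theorem fderiv_transition_bijective {σ τ : Cone T} {p : Coord σ}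
    (h : chart σ p ∈ range (chart τ)) :
    Function.Bijective (fderiv ℂ (transition σ τ) p) := by
  have h' : chart τ (transition σ τ p) ∈ range (chart σ) := by
    rw [chart_transition h]; exact mem_range_self p
  have h1 := (contDiffAt_transition h).differentiableAt (by simp)
  have h2 := (contDiffAt_transition h').differentiableAt (by simp)
  have h3 : (fun y => transition τ σ (transition σ τ y)) =ᶠ[𝓝 p] id := by
    filter_upwards [eventually_chart_transition h] with y hy
    change coordOf σ (chart τ (transition σ τ y)) = y
    rw [hy, coordOf_chart_self]
  have h4 : (fderiv ℂ (transition τ σ) (transition σ τ p)).comp (fderiv ℂ (transition σ τ) p) =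
      ContinuousLinearMap.id ℂ _ := by
    rw [← fderiv_fun_comp p h2 h1, h3.fderiv_eq, fderiv_id]
  have hinj : Function.Injective (fderiv ℂ (transition σ τ) p) := by
    refine Function.LeftInverse.injective (g := fderiv ℂ (transition τ σ) (transition σ τ p)) ?_
    intro v
    exact congrArg (fun A : Coord σ →L[ℂ] Coord σ => A v) h4
  refine ⟨hinj, ?_⟩
  exact (LinearMap.injective_iff_surjective_of_finrank_eq_finrank
    (f := (fderiv ℂ (transition σ τ) p).toLinearMap) (by
      rw [Module.finrank_fintype_fun_eq_card, Module.finrank_fintype_fun_eq_card, card_cone,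
        card_cone])).1 hinj

/-- A disc inside one chart is trivialized by a constant frame there; the expressions in the other
charts come from the derivatives of the transition maps. -/
theorem isTrivialization_of_chart {σ : Cone T} {g : ℂ → Coord σ} (hg : Continuous g)
    {R : (Fin 3 → ℂ) →L[ℂ] Coord σ} (hR : Function.Bijective R) :
    IsTrivialization (fun t => chart σ (g t))
      (fun τ t => (fderiv ℂ (transition σ τ) (g t)).comp R) := by
  refine ⟨fun τ t _ h => ?_, ?_, fun τ => ?_⟩
  · exact (fderiv_transition_bijective h).comp hR
  · intro τ τ' t _ p ψ hp hψ hev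
    have hmem : chart σ (g t) ∈ range (chart τ) := ⟨p, hp.symm⟩
    have hpt : transition σ τ (g t) = p := chart_injective τ ((chart_transition hmem).trans hp)
    have h1 := contDiffAt_transition hmem
    have h2 : transition σ τ' =ᶠ[𝓝 (g t)] fun y => ψ (transition σ τ y) := by
      have h3 : ∀ᶠ y in 𝓝 (g t), chart τ' (ψ (transition σ τ y)) = chart τ (transition σ τ y) :=
        h1.continuousAt.eventually (hpt.symm ▸ hev)
      filter_upwards [h3, eventually_chart_transition hmem] with y hy hy'
      change coordOf τ' (chart σ y) = _
      rw [← hy', ← hy, coordOf_chart_self]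
    subst hpt
    change (fderiv ℂ (transition σ τ') (g t)).comp R = _
    rw [h2.fderiv_eq, fderiv_fun_comp _ hψ (h1.differentiableAt (by simp))]
    rfl
  · intro t ht
    have h1 : ContinuousAt (fderiv ℂ (transition σ τ)) (g t) :=
      ((contDiffAt_transition ht.2).fderiv_right (m := 0) (by simp)).continuousAt
    have h2 : ContinuousAt (fun s => fderiv ℂ (transition σ τ) (g s)) t :=
      ContinuousAt.comp (f := g) h1 hg.continuousAt
    exact (h2.clm_comp continuousAt_const).continuousWithinAt

theorem fderiv_mem_fiberTangent_iff {κ : ToricKahlerForm T} {n : Fin 3 → ℤ} {μ : Space T → ℝ}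
    (hμ : IsMomentMap κ n μ) {σ τ : Cone T} {p : Coord σ} (h : chart σ p ∈ range (chart τ))
    (hp : IsFinitePoint τ (transition σ τ p)) (v : Coord σ) :
    fderiv ℂ (transition σ τ) p v ∈ fiberTangent μ τ (transition σ τ p) ↔
      v ∈ fiberTangent μ σ p := by
  have h1 := ((contDiffAt_transition h).differentiableAt (by simp)).hasFDerivAt.restrictScalars ℝ
  have h2 := (hasFDerivAt_fibrationInChart hμ hp).differentiableAt.hasFDerivAt
  have h3 : (fun y => fibrationInChart μ τ (transition σ τ y)) =ᶠ[𝓝 p] fibrationInChart μ σ := by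
    filter_upwards [eventually_chart_transition h] with y hy
    have hz : zChart τ (transition σ τ y) = zChart σ y := zChart_eq hy.symm
    have hw : wChart τ (transition σ τ y) = wChart σ y := wChart_eq hy.symm
    simp only [zChart, wChart] at hz hw
    simp only [fibrationInChart, hz, hw, hy]
  have h4 := (h2.comp p h1).congr_of_eventuallyEq h3.symm
  rw [fiberTangent, fiberTangent, mem_ofPred_eq, mem_ofPred_eq, h4.fderiv]
  rfl

/-! ## Discs of Maslov index zero in the divisors `z = 0` and `w = 0` -/

/-- A cone whose first two rays belong to one of the divisors `z = 0` and `w = 0`, and whose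
third ray belongs to the polar divisor of the other function. -/
structure EdgeCone (σ : Cone T) (α β γ : Ray k l) : Prop where
  eq : σ.1 = {α, β, γ}
  ne₁₂ : α ≠ β
  ne₁₃ : α ≠ γ
  ne₂₃ : β ≠ γ
  weight : ∃ s : ℤ, s ≠ 0 ∧ s • gen β - s • gen α = ![1, 0, 0]
  functions : (γ = wInf ∧ ∀ p : Coord σ, zChart σ p = extend σ p α * extend σ p β ∧
      wChart σ p = (extend σ p γ)⁻¹ ∧ extend σ p zInf ≠ 0) ∨
    (γ = zInf ∧ ∀ p : Coord σ, wChart σ p = extend σ p α * extend σ p β ∧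
      zChart σ p = (extend σ p γ)⁻¹ ∧ extend σ p wInf ≠ 0)

theorem EdgeCone.symm {σ : Cone T} {α β γ : Ray k l} (h : EdgeCone σ α β γ) :
    EdgeCone σ β α γ := by
  refine ⟨by rw [h.eq, Finset.insert_comm], h.ne₁₂.symm, h.ne₂₃, h.ne₁₃, ?_, ?_⟩
  · obtain ⟨s, hs, h1⟩ := h.weight
    exact ⟨-s, neg_ne_zero.2 hs, by rw [← h1]; simp; abel⟩
  · simpa only [mul_comm (extend σ _ β)] using h.functions

/-- The real parts x of the middle row are a real combination of the other two rows and drop out of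
the determinant. The factors a and a⁻¹ cancel, and three factors i remain in front of a real
determinant. Along the disc a rotates with the boundary, and this cancellation is the reason for
index zero. -/
theorem det_phase {A : Matrix (Fin 3) (Fin 3) ℂ} {a c : ℂ} (ha : a ≠ 0) {x y s r : Fin 3 → ℝ}
    {lam nu : ℝ} (hx : ∀ j, x j = lam * s j + nu * r j) (h0 : ∀ j, A 0 j = a * (Complex.I * s j))
    (h1 : ∀ j, A 1 j = a⁻¹ * (x j + y j * Complex.I)) (h2 : ∀ j, A 2 j = c * (Complex.I * r j)) :
    ∃ δ : ℝ, A.det = -Complex.I * c * δ := by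
  refine ⟨(Matrix.of ![s, y, r]).det, ?_⟩
  rw [Matrix.det_fin_three, Matrix.det_fin_three]
  simp only [h0, h1, h2, hx, Matrix.of_apply, Matrix.cons_val]
  push_cast
  field_simp
  linear_combination (c * (s 0 * y 1 * r 2 - s 0 * y 2 * r 1 - s 1 * y 0 * r 2
    + s 1 * y 2 * r 0 + s 2 * y 0 * r 1 - s 2 * y 1 * r 0)) * Complex.I_sq

/-- The square is -c²δ², and its phase arg(-c²) does not depend on the real number δ, which may also
be zero. -/
theorem sq_eq_of_phase (c : ℂ) : ∃ φ : ℝ, ∀ (d : ℂ) (δ : ℝ),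
    d = -Complex.I * c * δ → d ^ 2 = (‖d‖ : ℂ) ^ 2 * Complex.exp (φ * Complex.I) := by
  refine ⟨Complex.arg (-c ^ 2), fun d δ h => ?_⟩
  have h1 := Complex.norm_mul_exp_arg_mul_I (-c ^ 2)
  have h2 : (‖d‖ : ℂ) ^ 2 = (‖-c ^ 2‖ : ℂ) * (δ : ℂ) ^ 2 := by
    have h3 : ‖d‖ ^ 2 = ‖-c ^ 2‖ * δ ^ 2 := by
      rw [h]
      simp [mul_pow]
    exact_mod_cast congrArg (fun x : ℝ => (x : ℂ)) h3
  rw [h2, mul_right_comm, h1, h]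
  linear_combination c ^ 2 * δ ^ 2 * Complex.I_sq

theorem EdgeCone.exists_weights {σ : Cone T} {α β γ : Ray k l} (h : EdgeCone σ α β γ)
    (X Y : {ρ // ρ ∈ σ.1}) (hX : X.1 = α) (hY : Y.1 = β) :
    ∃ a : {ρ // ρ ∈ σ.1} → ℤ, ∑ ρ, a ρ • gen ρ.1 = ![1, 0, 0] ∧ a Y ≠ 0 ∧
      ∀ ρ, ρ ≠ X → ρ ≠ Y → a ρ = 0 := by
  obtain ⟨s, hs, hw⟩ := h.weight
  have hne : X ≠ Y := fun hXY => h.ne₁₂ (by rw [← hX, ← hY, hXY])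
  refine ⟨Pi.single Y s + Pi.single X (-s), ?_, ?_, ?_⟩
  · rw [Finset.sum_congr rfl (g := fun ρ => (Pi.single Y s : _ → ℤ) ρ • gen ρ.1 +
      (Pi.single X (-s) : _ → ℤ) ρ • gen ρ.1) (fun ρ _ => by simp [add_smul]),
      Finset.sum_add_distrib, sum_weight_single (n := s • gen β) (by rw [hY]),
      sum_weight_single (n := -(s • gen α)) (by rw [hX, neg_smul]), ← sub_eq_add_neg, hw]
  · simp [hne.symm, hs]
  · intro ρ h1 h2
    simp [h1, h2]

/-- The tangent vectors of a fiber along the disc. -/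
theorem EdgeCone.tangent {κ : ToricKahlerForm T} {n : Fin 3 → ℤ} {μ : Space T → ℝ}
    (hμ : IsMomentMap κ n μ) {σ : Cone T} {α β γ : Ray k l} (h : EdgeCone σ α β γ)
    (X Y Z : {ρ // ρ ∈ σ.1}) (hX : X.1 = α) (hY : Y.1 = β) (hZ : Z.1 = γ) {p : Coord σ}
    (hp : IsFinitePoint σ p) (hpX : p X = 0) {v : Coord σ} (hv : v ∈ fiberTangent μ σ p) :
    p Z ≠ 0 ∧ (p Z)⁻¹ ≠ 1 ∧ (p Y * v X).re = 0 ∧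
      ((((p Z)⁻¹ - 1) * p Z ^ 2)⁻¹ * v Z).re = 0 ∧
      fderiv ℝ (fun p => μ (chart σ p)) p v = 0 := by
  -- The first function is the product of two coordinates, one of which vanishes at the point. The
  -- second, treated below, is the inverse of the third coordinate.
  have hfirst : ∀ f : Coord σ → ℂ, (∀ p, f p = extend σ p α * extend σ p β) →
      f p = 0 ∧ fderiv ℂ f p v = p Y * v X := by
    intro f hf
    have h1 : f = fun p => p X * p Y := by
      ext p
      rw [hf, ← hX, ← hY, extend_mem, extend_mem]
    rw [h1]
    refine ⟨by simp [hpX], ?_⟩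
    have hdX : HasFDerivAt (fun p : Coord σ => p X) (ContinuousLinearMap.proj X) p :=
      (ContinuousLinearMap.proj X : Coord σ →L[ℂ] ℂ).hasFDerivAt
    have hdY : HasFDerivAt (fun p : Coord σ => p Y) (ContinuousLinearMap.proj Y) p :=
      (ContinuousLinearMap.proj Y : Coord σ →L[ℂ] ℂ).hasFDerivAt
    rw [(hdX.fun_mul hdY).fderiv]
    simp [hpX]
  have hsecond : ∀ f : Coord σ → ℂ, (∀ p, f p = (extend σ p γ)⁻¹) → p Z ≠ 0 →
      f p = (p Z)⁻¹ ∧ fderiv ℂ f p v = -(p Z ^ 2)⁻¹ * v Z := by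
    intro f hf h0
    have h1 : f = fun p => (p Z)⁻¹ := by
      ext p
      rw [hf, ← hZ, extend_mem]
    rw [h1]
    refine ⟨rfl, ?_⟩
    have hdZ : HasFDerivAt (fun p : Coord σ => p Z) (ContinuousLinearMap.proj Z) p :=
      (ContinuousLinearMap.proj Z : Coord σ →L[ℂ] ℂ).hasFDerivAt
    have := (hasDerivAt_inv h0).comp_hasFDerivAt p hdZ
    rw [show (fun p : Coord σ => (p Z)⁻¹) = Inv.inv ∘ fun p : Coord σ => p Z from rfl, this.fderiv]
    simp
  have hZ' : extend σ p γ = p Z := by rw [← hZ, extend_mem]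
  rw [mem_fiberTangent_iff hμ hp] at hv
  obtain ⟨h1, h2, h3⟩ := hv
  have hone : ∀ x : ℂ, (((0 : ℂ) - 1)⁻¹ * x).re = 0 → x.re = 0 := by
    intro x hx
    simpa [inv_neg] using hx
  have htwo : (((p Z)⁻¹ - 1)⁻¹ * (-(p Z ^ 2)⁻¹ * v Z)).re = 0 →
      ((((p Z)⁻¹ - 1) * p Z ^ 2)⁻¹ * v Z).re = 0 := by
    intro hx
    rw [show ((p Z)⁻¹ - 1)⁻¹ * (-(p Z ^ 2)⁻¹ * v Z) = -((((p Z)⁻¹ - 1) * p Z ^ 2)⁻¹ * v Z) by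
      rw [mul_inv]; ring, Complex.neg_re, neg_eq_zero] at hx
    exact hx
  rcases h.functions with ⟨rfl, hf⟩ | ⟨rfl, hf⟩
  · have h0 : p Z ≠ 0 := hZ' ▸ hp.wInf_ne
    obtain ⟨e1, e2⟩ := hfirst _ fun p => (hf p).1
    obtain ⟨e3, e4⟩ := hsecond _ (fun p => (hf p).2.1) h0
    rw [e1, e2] at h1
    rw [e3, e4] at h2
    exact ⟨h0, e3 ▸ hp.w_ne, hone _ h1, htwo h2, h3⟩
  · have h0 : p Z ≠ 0 := hZ' ▸ hp.zInf_ne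
    obtain ⟨e1, e2⟩ := hfirst _ fun p => (hf p).1
    obtain ⟨e3, e4⟩ := hsecond _ (fun p => (hf p).2.1) h0
    rw [e1, e2] at h2
    rw [e3, e4] at h1
    exact ⟨h0, e3 ▸ hp.z_ne, hone _ h2, htwo h1, h3⟩

theorem eq_I_mul_of_re_eq_zero {c x : ℂ} (hc : c ≠ 0) (h : (c * x).re = 0) :
    x = c⁻¹ * (Complex.I * ((c * x).im : ℝ)) := by
  have h1 := Complex.re_add_im (c * x)
  rw [h, Complex.ofReal_zero, zero_add, mul_comm] at h1
  rw [h1, inv_mul_cancel_left₀ hc]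

theorem EdgeCone.z_w_eq {σ : Cone T} {α β γ : Ray k l} (h : EdgeCone σ α β γ) {p q : Coord σ}
    (hα : extend σ q α = 0) (h₁ : extend σ p α = extend σ q α)
    (h₂ : extend σ p γ = extend σ q γ) :
    z (chart σ p) = z (chart σ q) ∧ w (chart σ p) = w (chart σ q) := by
  rcases h.functions with ⟨rfl, hf⟩ | ⟨rfl, hf⟩
  · refine ⟨?_, ?_⟩
    · rw [z_chart _ _ (hf p).2.2, z_chart _ _ (hf q).2.2, (hf p).1, (hf q).1, h₁, hα, zero_mul,
        zero_mul]
    · by_cases h0 : extend σ q wInf = 0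
      · rw [w_chart_of_eq _ _ h0, w_chart_of_eq _ _ (h₂.trans h0)]
      · rw [w_chart _ _ h0, w_chart _ _ (h₂ ▸ h0), (hf p).2.1, (hf q).2.1, h₂]
  · refine ⟨?_, ?_⟩
    · by_cases h0 : extend σ q zInf = 0
      · rw [z_chart_of_eq _ _ h0, z_chart_of_eq _ _ (h₂.trans h0)]
      · rw [z_chart _ _ h0, z_chart _ _ (h₂ ▸ h0), (hf p).2.1, (hf q).2.1, h₂]
    · rw [w_chart _ _ (hf p).2.2, w_chart _ _ (hf q).2.2, (hf p).1, (hf q).1, h₁, hα, zero_mul,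
        zero_mul]

theorem exists_equiv_of_three {ι : Type*} {X Y Z : ι} (hXY : X ≠ Y) (hXZ : X ≠ Z) (hYZ : Y ≠ Z)
    (hall : ∀ ρ, ρ = X ∨ ρ = Y ∨ ρ = Z) : ∃ f : Fin 3 ≃ ι, f 0 = X ∧ f 1 = Y ∧ f 2 = Z := by
  have hbij : Function.Bijective ![X, Y, Z] := by
    constructor
    · intro i j hij
      fin_cases i <;> fin_cases j <;> first
        | rfl
        | exact (hXY hij).elim
        | exact (hXZ hij).elim
        | exact (hYZ hij).elim
        | exact (hXY hij.symm).elim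
        | exact (hXZ hij.symm).elim
        | exact (hYZ hij.symm).elim
    · intro ρ
      rcases hall ρ with rfl | rfl | rfl
      exacts [⟨0, rfl⟩, ⟨1, rfl⟩, ⟨2, rfl⟩]
  exact ⟨Equiv.ofBijective _ hbij, rfl, rfl, rfl⟩

/-- The conditions from the two logarithms make the X and Z rows purely imaginary after scaling by y
and D. The condition from the moment map determines the radial part of the Y row as a fixed real
combination of them, so `det_phase` applies. -/
theorem det_of_tangent {ι : Type*} [Fintype ι] [DecidableEq ι] {X Y Z : ι} (hXY : X ≠ Y)
    (hXZ : X ≠ Z) (hYZ : Y ≠ Z) (hall : ∀ ρ, ρ = X ∨ ρ = Y ∨ ρ = Z) {R : (Fin 3 → ℂ) → ι → ℂ}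
    (hRX : ∀ v, R v X = v 0) (hRY : ∀ v, R v Y = v 1) (hRZ : ∀ v, R v Z = v 2)
    (M : (ι → ℂ) →L[ℝ] ℝ) {m : ℝ} (hm : m ≠ 0) {y D : ℂ} (hy : y ≠ 0) (hD : D ≠ 0)
    (hM : ∀ c : ℂ, M (Pi.single Y (c * y)) = c.re * m) (A : Matrix (Fin 3) (Fin 3) ℂ)
    (hA0 : ∀ j, (y * A 0 j).re = 0) (hA2 : ∀ j, (D * A 2 j).re = 0)
    (hA : ∀ j, M (R (A.col j)) = 0) : ∃ δ : ℝ, A.det = -Complex.I * D⁻¹ * δ := by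
  have h0 : ∀ j, A 0 j = y⁻¹ * (Complex.I * ((y * A 0 j).im : ℝ)) :=
    fun j => eq_I_mul_of_re_eq_zero hy (hA0 j)
  have h2 : ∀ j, A 2 j = D⁻¹ * (Complex.I * ((D * A 2 j).im : ℝ)) :=
    fun j => eq_I_mul_of_re_eq_zero hD (hA2 j)
  have h1 : ∀ j, A 1 j = y⁻¹⁻¹ * (((A 1 j / y).re : ℝ) + ((A 1 j / y).im : ℝ) * Complex.I) := by
    intro j
    rw [Complex.re_add_im, inv_inv, mul_div_cancel₀ _ hy]
  -- The moment map condition solved for the radial part; this is possible because M is non-zero on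
  -- the radial vector and kills the rotational one.
  have hsplit : ∀ j, (A 1 j / y).re = (-(M (Pi.single X (y⁻¹ * Complex.I)) / m)) *
      (y * A 0 j).im + (-(M (Pi.single Z (D⁻¹ * Complex.I)) / m)) * (D * A 2 j).im := by
    intro j
    have e1 : R (A.col j) = (y * A 0 j).im • (Pi.single X (y⁻¹ * Complex.I) : ι → ℂ) +
        (D * A 2 j).im • (Pi.single Z (D⁻¹ * Complex.I) : ι → ℂ) +
        Pi.single Y (A 1 j / y * y) := by
      ext ρ
      simp only [Pi.add_apply, Pi.smul_apply, Complex.real_smul]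
      rcases hall ρ with rfl | rfl | rfl
      · rw [hRX, Matrix.col_apply, Pi.single_eq_same, Pi.single_eq_of_ne hXY,
          Pi.single_eq_of_ne hXZ, mul_zero, add_zero, add_zero]
        exact (h0 j).trans (by ring)
      · rw [hRY, Matrix.col_apply, div_mul_cancel₀ _ hy, Pi.single_eq_same,
          Pi.single_eq_of_ne hXY.symm, Pi.single_eq_of_ne hYZ, mul_zero, mul_zero, add_zero,
          zero_add]
      · rw [hRZ, Matrix.col_apply, Pi.single_eq_same, Pi.single_eq_of_ne hYZ.symm,
          Pi.single_eq_of_ne hXZ.symm, mul_zero, zero_add, add_zero]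
        exact (h2 j).trans (by ring)
    have e2 := hA j
    rw [e1, map_add, map_add, map_smul, map_smul, hM, smul_eq_mul, smul_eq_mul] at e2
    generalize M (Pi.single X (y⁻¹ * Complex.I)) = m₁ at e2 ⊢
    generalize M (Pi.single Z (D⁻¹ * Complex.I)) = m₂ at e2 ⊢
    field_simp
    linarith
  exact det_phase (inv_ne_zero hy) hsplit h0 h1 h2

/-- The disc is t ↦ t·q_β in the line α = 0 with the coordinate γ fixed. Its boundary is a circle
orbit and so stays in the fiber. The phase is governed by a constant D depending only on the
coordinate γ, so one constant function φ serves for the whole boundary. -/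
theorem EdgeCone.mem_wall {κ : ToricKahlerForm T} {μ : Space T → ℝ}
    (hμ : IsMomentMap κ ![1, 0, 0] μ) {σ : Cone T} {α β γ : Ray k l} (h : EdgeCone σ α β γ)
    {q : Coord σ} (hα : extend σ q α = 0) (hβ : extend σ q β ≠ 0)
    (hb : fibration μ (chart σ q) ∈ regularBase μ) : fibration μ (chart σ q) ∈ wall μ := by
  obtain ⟨X, hX⟩ : ∃ X : {ρ // ρ ∈ σ.1}, X.1 = α := ⟨⟨α, by rw [h.eq]; simp⟩, rfl⟩
  obtain ⟨Y, hY⟩ : ∃ Y : {ρ // ρ ∈ σ.1}, Y.1 = β := ⟨⟨β, by rw [h.eq]; simp⟩, rfl⟩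
  obtain ⟨Z, hZ⟩ : ∃ Z : {ρ // ρ ∈ σ.1}, Z.1 = γ := ⟨⟨γ, by rw [h.eq]; simp⟩, rfl⟩
  have hXY : X ≠ Y := fun e => h.ne₁₂ (by rw [← hX, ← hY, e])
  have hXZ : X ≠ Z := fun e => h.ne₁₃ (by rw [← hX, ← hZ, e])
  have hYZ : Y ≠ Z := fun e => h.ne₂₃ (by rw [← hY, ← hZ, e])
  have hall : ∀ ρ, ρ = X ∨ ρ = Y ∨ ρ = Z := by
    rintro ⟨ρ, hρ⟩
    have h1 := hρ
    rw [h.eq] at h1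
    simpa [Subtype.ext_iff, hX, hY, hZ] using h1
  rw [← hX, extend_mem] at hα
  rw [← hY, extend_mem] at hβ
  obtain ⟨a, ha, haY, ha0⟩ := h.exists_weights X Y hX hY
  let g : ℂ → Coord σ := fun t => Function.update q Y (t * q Y)
  have hgX : ∀ t, g t X = 0 := fun t => by simp [g, hXY, hα]
  have hgY : ∀ t, g t Y = t * q Y := fun t => by simp [g]
  have hgZ : ∀ t, g t Z = q Z := fun t => by simp [g, hYZ.symm]
  have hg1 : g 1 = q := by simp [g]
  have hgdiff : ContDiff ℂ ∞ g := by
    rw [contDiff_pi]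
    intro ρ
    by_cases hρ : ρ = Y
    · subst hρ
      simp only [hgY]
      fun_prop
    · simp only [g, Function.update_of_ne hρ]
      fun_prop
  -- The circle also rotates the coordinate α, but this coordinate is zero along the disc.
  have hfix : ∀ t ρ, ρ ≠ Y → (a ρ : ℂ) * g t ρ = 0 := by
    intro t ρ hρ
    by_cases hρX : ρ = X
    · rw [hρX, hgX, mul_zero]
    · simp [ha0 ρ hρX hρ]
  have hext : ∀ t, extend σ (g t) α = extend σ q α ∧ extend σ (g t) γ = extend σ q γ := by
    intro t
    rw [← hX, ← hZ, extend_mem, extend_mem, extend_mem, extend_mem, hα]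
    exact ⟨hgX t, hgZ t⟩
  have hqα : extend σ q α = 0 := by rw [← hX, extend_mem, hα]
  have hfib : ∀ t : ℂ, ‖t‖ = 1 → fibration μ (chart σ (g t)) = fibration μ (chart σ q) := by
    intro t ht
    have ht0 : t ≠ 0 := by
      rintro rfl
      simp at ht
    have h1 : z (chart σ (g t)) = z (chart σ q) ∧ w (chart σ (g t)) = w (chart σ q) :=
      h.z_w_eq hqα (hext t).1 (hext t).2
    have h2 : μ (chart σ (g t)) = μ (chart σ q) := by
      conv_rhs => rw [← Function.update_eq_self Y q]
      exact (moment_eq_iff hμ ha (p := q) (fun ρ hρ => by simpa [hg1] using hfix 1 ρ hρ) haY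
        (mul_ne_zero ht0 hβ) hβ).2 (by simp [ht])
    rw [fibration, fibration, h1.1, h1.2, h2]
  have hreg : ∀ t : ℂ, ‖t‖ = 1 → IsRegularPoint μ (chart σ (g t)) := by
    intro t ht
    by_contra hn
    exact hb.2 ⟨_, hn, hfib t ht⟩
  obtain ⟨fe, hf0, hf1, hf2⟩ := exists_equiv_of_three hXY hXZ hYZ hall
  let R : (Fin 3 → ℂ) →L[ℂ] Coord σ :=
    ((LinearEquiv.funCongrLeft ℂ ℂ fe.symm).toLinearMap).toContinuousLinearMap
  have hR : Function.Bijective R := (LinearEquiv.funCongrLeft ℂ ℂ fe.symm).bijective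
  have hRv : ∀ (v : Fin 3 → ℂ) i, R v (fe i) = v i := by
    intro v i
    change v (fe.symm (fe i)) = v i
    rw [Equiv.symm_apply_apply]
  have hRX : ∀ v, R v X = v 0 := fun v => by rw [← hRv v 0, hf0]
  have hRY : ∀ v, R v Y = v 1 := fun v => by rw [← hRv v 1, hf1]
  have hRZ : ∀ v, R v Z = v 2 := fun v => by rw [← hRv v 2, hf2]
  set D : ℂ := (((q Z)⁻¹ - 1) * q Z ^ 2)⁻¹ with hD
  obtain ⟨φ, hφ⟩ := sq_eq_of_phase D⁻¹
  refine ⟨hb, fun t => chart σ (g t), ?_, hfib, ⟨0, by simp, 1, by simp, ?_⟩,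
    fun τ t => (fderiv ℂ (transition σ τ) (g t)).comp R, fun _ => φ,
    isTrivialization_of_chart hgdiff.continuous hR, continuous_const, by simp, ?_⟩
  · intro t _
    exact ⟨σ, g, univ, isOpen_univ, mem_univ _, (hgdiff.restrict_scalars ℝ).contDiffOn,
      (hgdiff.differentiable (by simp)).differentiableOn, fun s _ => rfl⟩
  · intro he
    have h1 := congrFun (chart_injective σ he) Y
    rw [hgY, hgY, zero_mul, one_mul] at h1
    exact hβ h1.symm
  · intro θ τ p hp A _ hA
    set t := Complex.exp (θ * Complex.I) with ht
    have htn : ‖t‖ = 1 := Complex.norm_exp_ofReal_mul_I θ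
    have ht0 : t ≠ 0 := Complex.exp_ne_zero _
    have hmem : chart σ (g t) ∈ range (chart τ) := ⟨p, hp.symm⟩
    have hpt : transition σ τ (g t) = p := chart_injective τ ((chart_transition hmem).trans hp)
    subst hpt
    have hfin : IsFinitePoint τ (transition σ τ (g t)) :=
      isFinitePoint_of_isRegularPoint (μ := μ) (by rw [← hp]; exact hreg t htn)
    have hfin' : IsFinitePoint σ (g t) := isFinitePoint_of_isRegularPoint (hreg t htn)
    have htan := fun j => h.tangent hμ X Y Z hX hY hZ hfin' (hgX t)
      ((fderiv_mem_fiberTangent_iff hμ hmem hfin _).1 (hA j))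
    simp only [hgZ, hgY] at htan
    obtain ⟨hqZ, hqZ1, -, -, -⟩ := htan 0
    have hD0 : D ≠ 0 := inv_ne_zero (mul_ne_zero (sub_ne_zero.2 hqZ1) (pow_ne_zero 2 hqZ))
    have htY : t * q Y ≠ 0 := mul_ne_zero ht0 hβ
    have hdet : ∃ δ : ℝ, A.det = -Complex.I * D⁻¹ * δ := by
      refine det_of_tangent hXY hXZ hYZ hall (R := R) hRX hRY hRZ
        (fderiv ℝ (fun p => μ (chart σ p)) (g t)) (m := a Y * Complex.normSq (t * q Y) *
          lineNorm κ σ Y (g t)) (mul_ne_zero (mul_ne_zero (by exact_mod_cast haY)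
        (Complex.normSq_eq_zero.not.2 htY)) (lineNorm_pos _ _ _ _).ne') htY hD0 (fun c => ?_)
        A (fun j => ?_) (fun j => ?_) fun j => (htan j).2.2.2.2
      · rw [fderiv_moment_single hμ ha (fun ρ hρ => hfix t ρ hρ), hgY, re_mul_mul_conj]
        ring
      · have e1 := (htan j).2.2.1
        change (t * q Y * R (A.col j) X).re = 0 at e1
        rwa [hRX] at e1
      · have e1 := (htan j).2.2.2.1
        change (D * R (A.col j) Z).re = 0 at e1
        rwa [hRZ] at e1
    obtain ⟨δ, hδ⟩ := hdet
    exact hφ _ δ hδ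

/-! ## Chains of projective lines -/

/-- Homogeneous coordinates of a point in the chart of the cone with rays `α, β, γ`. -/
def tri (α β γ : Ray k l) (x y c : ℂ) : Ray k l → ℂ := fun ρ =>
  if ρ = α then x else if ρ = β then y else if ρ = γ then c else 1

theorem tri_of_ne {α β γ ρ : Ray k l} (h1 : ρ ≠ α) (h2 : ρ ≠ β) (h3 : ρ ≠ γ) (x y c : ℂ) :
    tri α β γ x y c ρ = 1 := by
  simp [tri, h1, h2, h3]

/-- A coordinate equal to 1 is the same as an absent one, so the midpoint of a line of the chain has
the same homogeneous coordinates in the charts at both of its ends. This glues consecutive paths. -/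
theorem tri_eq_tri_of_adjacent {α β γ δ : Ray k l} (h1 : α ≠ β) (h2 : α ≠ δ) (h3 : β ≠ δ)
    (h4 : α ≠ γ) (h5 : δ ≠ γ) (c : ℂ) : tri α β γ 1 0 c = tri β δ γ 0 1 c := by
  ext ρ
  by_cases h6 : ρ = α
  · simp [tri, h6, h1, h2, h4]
  · by_cases h7 : ρ = δ
    · simp [tri, h7, h2.symm, h3.symm, h5]
    · simp [tri, h6, h7]

theorem tri_one_congr {α α' β γ : Ray k l} (h1 : α ≠ β) (h2 : α ≠ γ) (h3 : α' ≠ β) (h4 : α' ≠ γ)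
    (y c : ℂ) : tri α β γ 1 y c = tri α' β γ 1 y c := by
  ext ρ
  by_cases h5 : ρ = α
  · simp [tri, h5, h1, h2]
  · by_cases h6 : ρ = α'
    · simp [tri, h6, h3, h4]
    · simp [tri, h5, h6]

/-- The point in the chart of the cone with rays `α, β, γ` with the given coordinates. -/
def triPoint {α β γ : Ray k l} (h : IsMaxCone T {α, β, γ}) (x y c : ℂ) : Space T :=
  chart ⟨_, h⟩ fun ρ => tri α β γ x y c ρ.1

theorem extend_tri {α β γ : Ray k l} (h : IsMaxCone T {α, β, γ}) (x y c : ℂ) :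
    extend (⟨_, h⟩ : Cone T) (fun ρ => tri α β γ x y c ρ.1) = tri α β γ x y c := by
  ext ρ
  by_cases hρ : ρ ∈ ({α, β, γ} : Finset (Ray k l))
  · simp [extend, hρ]
  · rw [extend_notMem _ _ hρ]
    simp only [Finset.mem_insert, Finset.mem_singleton, not_or] at hρ
    simp [tri, hρ.1, hρ.2.1, hρ.2.2]

theorem triPoint_eq {α β γ α' β' γ' : Ray k l} (h : IsMaxCone T {α, β, γ})
    (h' : IsMaxCone T {α', β', γ'}) {x y c x' y' c' : ℂ}
    (he : tri α β γ x y c = tri α' β' γ' x' y' c') : triPoint h x y c = triPoint h' x' y' c' :=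
  chart_eq_of_extend_eq (by rw [extend_tri, extend_tri, he])

theorem continuous_triPoint {κ : ToricKahlerForm T} {n : Fin 3 → ℤ} {μ : Space T → ℝ}
    (hμ : IsMomentMap κ n μ) {α β γ : Ray k l} (h : IsMaxCone T {α, β, γ}) {f g : ℝ → ℂ}
    (hf : Continuous f) (hg : Continuous g) (c : ℂ) :
    Continuous fun r => μ (triPoint h (f r) (g r) c) := by
  refine (continuous_moment hμ ⟨_, h⟩).comp (continuous_pi fun ρ => ?_)
  unfold tri
  split_ifs <;> fun_prop

/-- Intermediate value theorem on the path that follows f from 0 to 1 and then g back from 1 to 0.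
-/
theorem exists_of_mem_uIcc {f g : ℝ → ℝ} (hf : Continuous f) (hg : Continuous g)
    (h : f 1 = g 1) {y : ℝ} (hy : y ∈ uIcc (f 0) (g 0)) :
    (∃ r, 0 ≤ r ∧ f r = y) ∨ ∃ r, 0 ≤ r ∧ g r = y := by
  have key : ∀ {f : ℝ → ℝ}, Continuous f → y ∈ uIcc (f 0) (f 1) → ∃ r, 0 ≤ r ∧ f r = y := by
    intro f hf hy
    obtain ⟨r, hr, hry⟩ := intermediate_value_uIcc (hf.continuousOn (s := uIcc 0 1)) hy
    rw [uIcc_of_le zero_le_one] at hr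
    exact ⟨r, hr.1, hry⟩
  rcases uIcc_subset_uIcc_union_uIcc (b := f 1) hy with h1 | h1
  · exact Or.inl (key hf h1)
  · rw [h, uIcc_comm] at h1
    exact Or.inr (key hg h1)

/-- The value of a function with a simple pole in terms of the inverse coordinate. -/
def invValue (c : ℂ) : OnePoint ℂ := if c = 0 then OnePoint.infty else ((c⁻¹ : ℂ) : OnePoint ℂ)

/-- The point 1 + exp v has distance exp v from 1. It is non-zero, hence an inverse; v = ⊤
corresponds to c = 0 and v = ⊥ to the value 1. -/
theorem exists_invValue (v : EReal) : ∃ c : ℂ, logDist (invValue c) = v := by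
  by_cases hv : v = ⊤
  · refine ⟨0, ?_⟩
    rw [invValue, if_pos rfl, hv]
    rfl
  · have htop : EReal.exp v ≠ ⊤ := by simpa using hv
    set e : ℝ := (EReal.exp v).toReal
    have he : 0 ≤ e := ENNReal.toReal_nonneg
    have hne : (1 + e : ℂ) ≠ 0 := by
      have : (1 + e : ℝ) ≠ 0 := by positivity
      exact_mod_cast this
    refine ⟨(1 + e : ℂ)⁻¹, ?_⟩
    rw [invValue, if_neg (inv_ne_zero hne), inv_inv, logDist_coe, add_sub_cancel_left,
      ← ofReal_norm, Complex.norm_real, Real.norm_of_nonneg he, ENNReal.ofReal_toReal htop,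
      EReal.log_exp]

/-- The chain of projective lines in which a fiber of one of the functions `z`, `w` meets the zero
divisor of the other one. -/
structure EdgeChain (T : MaximalTriangulation k l) (n : ℕ) (b : Fin (n + 1) → Ray k l)
    (γ : Ray k l) (ζ η : Space T → OnePoint ℂ) : Prop where
  pos : 0 < n
  left : IsMaxCone T {xiInf, b 0, γ}
  right : IsMaxCone T {xiZero, b (Fin.last n), γ}
  edge : ∀ i : Fin n, IsMaxCone T {b i.castSucc, b i.succ, γ}
  edgeCone : ∀ i, EdgeCone (⟨_, edge i⟩ : Cone T) (b i.castSucc) (b i.succ) γ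
  injective : Function.Injective b
  ne_left : ∀ i, b i ≠ xiInf
  ne_right : ∀ i, b i ≠ xiZero
  ne : ∀ i, b i ≠ γ
  ne_left' : γ ≠ xiInf
  ne_right' : γ ≠ xiZero
  values : ∀ Z : Homog T, (∀ ρ, ρ ≠ γ → (∀ i, ρ ≠ b i) → ρ ≠ xiZero → ρ ≠ xiInf → Z.1 ρ = 1) →
    (∃ i, Z.1 (b i) = 0) → ζ (Quotient.mk _ Z) = ((0 : ℂ) : OnePoint ℂ) ∧
      η (Quotient.mk _ Z) = invValue (Z.1 γ)

section Chain

variable {n : ℕ} {b : Fin (n + 1) → Ray k l} {γ : Ray k l} {ζ η : Space T → OnePoint ℂ}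
  {κ : ToricKahlerForm T} {μ : Space T → ℝ}

theorem EdgeChain.values_triPoint (h : EdgeChain T n b γ ζ η) {α β : Ray k l}
    (hσ : IsMaxCone T {α, β, γ}) (hα : (∃ i, α = b i) ∨ α = xiZero ∨ α = xiInf)
    (hβ : ∃ i, β = b i) {x y c : ℂ} (hxy : ∃ i, tri α β γ x y c (b i) = 0) (hα' : α ≠ γ) :
    ζ (triPoint hσ x y c) = ((0 : ℂ) : OnePoint ℂ) ∧ η (triPoint hσ x y c) = invValue c := by
  obtain ⟨j, rfl⟩ := hβ
  have e := extend_tri hσ x y c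
  have h2 : tri α (b j) γ x y c γ = c := by simp [tri, hα'.symm, (h.ne j).symm]
  rw [show invValue c = invValue (extend (⟨_, hσ⟩ : Cone T)
    (fun ρ => tri α (b j) γ x y c ρ.1) γ) by rw [e, h2]]
  refine h.values ⟨extend (⟨_, hσ⟩ : Cone T) fun ρ => tri α (b j) γ x y c ρ.1, ⟨_, hσ⟩,
    fun ρ hρ => by rw [extend_notMem _ _ hρ]; exact one_ne_zero⟩ (fun ρ h3 h4 h5 h6 => ?_) ?_
  · have h7 : ρ ≠ α := by
      rcases hα with ⟨i, rfl⟩ | rfl | rfl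
      exacts [h4 i, h5, h6]
    exact (congrFun e ρ).trans (tri_of_ne h7 (h4 j) h3 _ _ _)
  · exact hxy.imp fun i hi => (congrFun e _).trans hi

/-- The circle fixes the points of the chain with two vanishing coordinates. -/
theorem EdgeChain.not_regular_edge (hμ : IsMomentMap κ ![1, 0, 0] μ) (h : EdgeChain T n b γ ζ η)
    (i : Fin n) (c : ℂ) : ¬ IsRegularPoint μ (triPoint (h.edge i) 0 0 c) := by
  obtain ⟨a, ha, -, ha0⟩ := (h.edgeCone i).exists_weights ⟨b i.castSucc, by simp⟩
    ⟨b i.succ, by simp⟩ rfl rfl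
  refine not_isRegularPoint_of_fixed hμ ha fun ρ => ?_
  by_cases h1 : ρ.1 = b i.castSucc
  · simp [tri, h1]
  by_cases h2 : ρ.1 = b i.succ
  · simp [tri, h2]
  rw [ha0 ρ (fun e => h1 (by rw [e])) (fun e => h2 (by rw [e]))]
  simp

/-- The possible positions of a point with a given value of the moment map on the chain. -/
theorem EdgeChain.exists_triPoint (hμ : IsMomentMap κ ![1, 0, 0] μ) (h : EdgeChain T n b γ ζ η)
    (c : ℂ) (x : Space T) : ∃ r : ℝ, 0 ≤ r ∧
      ((∃ i, μ (triPoint (h.edge i) r 0 c) = μ x) ∨ (∃ i, μ (triPoint (h.edge i) 0 r c) = μ x) ∨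
        μ (triPoint h.left r 0 c) = μ x ∨ μ (triPoint h.right r 0 c) = μ x) := by
  have hc : Continuous fun r : ℝ => (r : ℂ) := Complex.continuous_ofReal
  have hc0 : Continuous fun _ : ℝ => (0 : ℂ) := continuous_const
  -- All values between those at the ξ = ∞ end and at the m-th node are attained; each induction
  -- step adds one line of the chain.
  have hstep : ∀ (m : ℕ) (hm : m < n), ∀ y ∈ uIcc (μ (triPoint h.left 0 0 c))
      (μ (triPoint (h.edge ⟨m, hm⟩) 0 0 c)), ∃ r : ℝ, 0 ≤ r ∧
      ((∃ i, μ (triPoint (h.edge i) r 0 c) = y) ∨ (∃ i, μ (triPoint (h.edge i) 0 r c) = y) ∨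
        μ (triPoint h.left r 0 c) = y ∨ μ (triPoint h.right r 0 c) = y) := by
    intro m
    induction m with
    | zero =>
      intro hm y hy
      have hglue : triPoint h.left 1 0 c = triPoint (h.edge ⟨0, hm⟩) 0 1 c :=
        triPoint_eq _ _ (tri_eq_tri_of_adjacent (h.ne_left _).symm (h.ne_left _).symm
          (fun e => by simpa using h.injective e) h.ne_left'.symm (h.ne _) c)
      rcases exists_of_mem_uIcc (continuous_triPoint hμ h.left hc hc0 c)
        (continuous_triPoint hμ (h.edge ⟨0, hm⟩) hc0 hc c) (by simp [hglue])
        (y := y) (by simpa using hy) with ⟨r, hr, hry⟩ | ⟨r, hr, hry⟩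
      · exact ⟨r, hr, Or.inr (Or.inr (Or.inl hry))⟩
      · exact ⟨r, hr, Or.inr (Or.inl ⟨_, hry⟩)⟩
    | succ m ih =>
      intro hm y hy
      have hm' : m < n := Nat.lt_of_succ_lt hm
      rcases uIcc_subset_uIcc_union_uIcc (b := μ (triPoint (h.edge ⟨m, hm'⟩) 0 0 c)) hy with
        hy | hy
      · exact ih hm' y hy
      · have hne : ∀ {i j : Fin (n + 1)}, i.1 ≠ j.1 → b i ≠ b j := fun hij e =>
          hij (congrArg Fin.val (h.injective e))
        have hglue : triPoint (h.edge ⟨m, hm'⟩) 1 0 c = triPoint (h.edge ⟨m + 1, hm⟩) 0 1 c :=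
          triPoint_eq _ _ (tri_eq_tri_of_adjacent (hne (by simp)) (hne (by simp; omega))
            (hne (by simp)) (h.ne _) (h.ne _) c)
        rcases exists_of_mem_uIcc (continuous_triPoint hμ (h.edge ⟨m, hm'⟩) hc hc0 c)
          (continuous_triPoint hμ (h.edge ⟨m + 1, hm⟩) hc0 hc c) (by simp [hglue])
          (y := y) (by simpa using hy) with ⟨r, hr, hry⟩ | ⟨r, hr, hry⟩
        · exact ⟨r, hr, Or.inl ⟨_, hry⟩⟩
        · exact ⟨r, hr, Or.inr (Or.inl ⟨_, hry⟩)⟩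
  -- The ends of the chain lie on ξ = ∞ and ξ = 0, where the moment map has its global maximum and
  -- minimum.
  have hle : μ x ≤ μ (triPoint h.left 0 0 c) :=
    moment_le hμ (σ := ⟨_, h.left⟩) (ρ₀ := ⟨xiInf, by simp⟩) (by simp [gen]) (by simp [tri]) x
  have hge : μ (triPoint h.right 0 0 c) ≤ μ x :=
    le_moment hμ (σ := ⟨_, h.right⟩) (ρ₀ := ⟨xiZero, by simp⟩) (by simp [gen]) (by simp [tri]) x
  have hlast : n - 1 < n := Nat.sub_lt h.pos one_pos
  rcases uIcc_subset_uIcc_union_uIcc (b := μ (triPoint (h.edge ⟨n - 1, hlast⟩) 0 0 c))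
    (mem_uIcc.2 (Or.inr ⟨hge, hle⟩)) with hy | hy
  · exact hstep _ hlast _ hy
  · have e1 : Fin.succ ⟨n - 1, hlast⟩ = Fin.last n := by
      ext
      simp only [Fin.succ_mk, Fin.val_last]
      omega
    have h1 : b (Fin.castSucc ⟨n - 1, hlast⟩) ≠ b (Fin.last n) := fun e => by
      have := congrArg Fin.val (h.injective e)
      simp only [Fin.val_castSucc, Fin.val_last] at this
      omega
    have hglue : triPoint (h.edge ⟨n - 1, hlast⟩) 1 0 c = triPoint h.right 1 0 c := by
      refine triPoint_eq _ _ ?_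
      rw [e1]
      exact tri_one_congr h1 (h.ne _) (h.ne_right _).symm h.ne_right'.symm _ _
    rcases exists_of_mem_uIcc (continuous_triPoint hμ (h.edge ⟨n - 1, hlast⟩) hc hc0 c)
      (continuous_triPoint hμ h.right hc hc0 c) (by simp [hglue])
      (y := μ x) (by simpa using hy) with ⟨r, hr, hry⟩ | ⟨r, hr, hry⟩
    · exact ⟨r, hr, Or.inl ⟨_, hry⟩⟩
    · exact ⟨r, hr, Or.inr (Or.inr (Or.inr hry))⟩

theorem EdgeChain.mem_wall_chart (hμ : IsMomentMap κ ![1, 0, 0] μ) (h : EdgeChain T n b γ ζ η)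
    {x : Space T} (hb : fibration μ x ∈ regularBase μ) (i : Fin n)
    (hx : x ∈ range (chart ⟨_, h.edge i⟩)) {σ : Cone T} {p : Coord σ} (hp : chart σ p = x)
    (h1 : (extend σ p (b i.castSucc) = 0 ∧ extend σ p (b i.succ) ≠ 0) ∨
      (extend σ p (b i.castSucc) ≠ 0 ∧ extend σ p (b i.succ) = 0)) : fibration μ x ∈ wall μ := by
  obtain ⟨q, rfl⟩ := hx
  simp only [← extend_eq_zero_iff hp, ne_eq] at h1
  rcases h1 with ⟨h2, h3⟩ | ⟨h2, h3⟩
  · exact (h.edgeCone i).mem_wall hμ h2 h3 hb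
  · exact (h.edgeCone i).symm.mem_wall hμ h3 h2 hb

/-- Over the regular base the point found on the chain is neither a node nor an end, since those are
fixed by the circle. It therefore lies on exactly one line, in the chart of a node of that line,
with exactly one of the two edge coordinates equal to zero. -/
theorem EdgeChain.exists_mem_wall (hμ : IsMomentMap κ ![1, 0, 0] μ) (h : EdgeChain T n b γ ζ η)
    (c : ℂ) (y : Space T) : ∃ x, μ x = μ y ∧ ζ x = ((0 : ℂ) : OnePoint ℂ) ∧ η x = invValue c ∧
      (fibration μ x ∈ regularBase μ → fibration μ x ∈ wall μ) := by
  have hreg : ∀ {x}, fibration μ x ∈ regularBase μ → IsRegularPoint μ x := by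
    intro x hx
    by_contra hn
    exact hx.2 ⟨x, hn, rfl⟩
  have hne : ∀ i : Fin n, b i.castSucc ≠ b i.succ := fun i e => by
    simpa [Fin.ext_iff] using h.injective e
  obtain ⟨r, hr, ⟨i, hi⟩ | ⟨i, hi⟩ | hi | hi⟩ := h.exists_triPoint hμ c y
  · obtain ⟨hζ, hη⟩ := h.values_triPoint (h.edge i) (x := r) (y := 0) (c := c) (Or.inl ⟨_, rfl⟩)
      ⟨_, rfl⟩ ⟨i.succ, by simp [tri, (hne i).symm]⟩ (h.ne _)
    refine ⟨_, hi, hζ, hη, fun hb => ?_⟩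
    refine h.mem_wall_chart hμ hb i (mem_range_self _) rfl (Or.inr ?_)
    rw [extend_tri]
    refine ⟨?_, by simp [tri, (hne i).symm]⟩
    intro h0
    have hr0 : (r : ℂ) = 0 := by simpa [tri] using h0
    rw [hr0] at hb
    exact h.not_regular_edge hμ i c (hreg hb)
  · obtain ⟨hζ, hη⟩ := h.values_triPoint (h.edge i) (x := 0) (y := r) (c := c) (Or.inl ⟨_, rfl⟩)
      ⟨_, rfl⟩ ⟨i.castSucc, by simp [tri]⟩ (h.ne _)
    refine ⟨_, hi, hζ, hη, fun hb => ?_⟩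
    refine h.mem_wall_chart hμ hb i (mem_range_self _) rfl (Or.inl ?_)
    rw [extend_tri]
    refine ⟨by simp [tri], ?_⟩
    intro h0
    have hr0 : (r : ℂ) = 0 := by simpa [tri, (hne i).symm] using h0
    rw [hr0] at hb
    exact h.not_regular_edge hμ i c (hreg hb)
  · obtain ⟨hζ, hη⟩ := h.values_triPoint h.left (x := r) (y := 0) (c := c) (Or.inr (Or.inr rfl))
      ⟨_, rfl⟩ ⟨0, by simp [tri, h.ne_left]⟩ h.ne_left'.symm
    refine ⟨_, hi, hζ, hη, fun hb => ?_⟩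
    have hr0 : (r : ℂ) ≠ 0 := by
      intro hr0
      rw [hr0] at hb
      exact not_isRegularPoint_of_fixed hμ (sum_weight_single (σ := ⟨_, h.left⟩)
        (ρ₀ := ⟨xiInf, by simp⟩) (c := -1) (by simp [gen]))
        (single_weight_mul_update (by simp [tri])) (hreg hb)
    have h1 : b (Fin.succ ⟨0, h.pos⟩) ≠ b 0 := fun e => by simpa using h.injective e
    -- A point of the first line with r ≠ 0 is off ξ = ∞ and therefore also lies in the chart of the
    -- first node. The last line is treated in the same way.
    refine h.mem_wall_chart hμ hb ⟨0, h.pos⟩ ?_ rfl (Or.inl ?_)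
    · rw [triPoint, chart_mem_range_chart, extend_tri]
      intro ρ hρ
      have e1 : b (Fin.castSucc ⟨0, h.pos⟩) = b 0 := rfl
      simp only [e1, Finset.mem_insert, Finset.mem_singleton, not_or] at hρ
      simp only [tri, hρ.1, hρ.2.2, if_false]
      split_ifs
      exacts [hr0, one_ne_zero]
    · rw [extend_tri]
      refine ⟨?_, ?_⟩
      · change tri xiInf (b 0) γ r 0 c (b 0) = 0
        simp [tri, h.ne_left]
      · rw [tri_of_ne (h.ne_left _) h1 (h.ne _)]
        exact one_ne_zero
  · obtain ⟨hζ, hη⟩ := h.values_triPoint h.right (x := r) (y := 0) (c := c) (Or.inr (Or.inl rfl))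
      ⟨_, rfl⟩ ⟨Fin.last n, by simp [tri, h.ne_right]⟩ h.ne_right'.symm
    refine ⟨_, hi, hζ, hη, fun hb => ?_⟩
    have hr0 : (r : ℂ) ≠ 0 := by
      intro hr0
      rw [hr0] at hb
      exact not_isRegularPoint_of_fixed hμ (sum_weight_single (σ := ⟨_, h.right⟩)
        (ρ₀ := ⟨xiZero, by simp⟩) (c := 1) (by simp [gen]))
        (single_weight_mul_update (by simp [tri])) (hreg hb)
    have hlast : n - 1 < n := Nat.sub_lt h.pos one_pos
    have e1 : b (Fin.succ ⟨n - 1, hlast⟩) = b (Fin.last n) := by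
      congr 1
      ext
      simp only [Fin.succ_mk, Fin.val_last]
      omega
    have h1 : b (Fin.castSucc ⟨n - 1, hlast⟩) ≠ b (Fin.last n) := e1 ▸ hne _
    refine h.mem_wall_chart hμ hb ⟨n - 1, hlast⟩ ?_ rfl (Or.inr ?_)
    · rw [triPoint, chart_mem_range_chart, extend_tri]
      intro ρ hρ
      simp only [e1, Finset.mem_insert, Finset.mem_singleton, not_or] at hρ
      simp only [tri, hρ.2.1, hρ.2.2, if_false]
      split_ifs
      exacts [hr0, one_ne_zero]
    · rw [extend_tri, e1]
      refine ⟨?_, ?_⟩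
      · rw [tri_of_ne (h.ne_right _) h1 (h.ne _)]
        exact one_ne_zero
      · simp [tri, h.ne_right]

end Chain

/-! ## The chains over `z = 0` and `w = 0` -/

/-- Consecutive bottom generators differ by (1,0,0), so the circle has weights -1 and 1 on the two
edge coordinates. Near the chain z is the product of the bottom coordinates and w is the inverse of
the coordinate of w = ∞. -/
theorem edgeChain_bot (hk : 0 < k) : EdgeChain T k bot wInf z w where
  pos := hk
  left := .botLeft
  right := .botRight
  edge := .botEdge
  edgeCone i := by
    refine ⟨rfl, by simp [Fin.ext_iff], by simp, by simp, ⟨1, one_ne_zero, ?_⟩,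
      Or.inl ⟨rfl, fun p => ⟨?_, ?_, ?_⟩⟩⟩
    · ext j
      fin_cases j <;> simp [gen, Vertex.coord]
    · rw [zChart, zVal, Fintype.prod_eq_mul i.castSucc i.succ (by simp [Fin.ext_iff]),
        extend_notMem _ _ (by simp : (zInf : Ray k l) ∉ _), div_one]
      intro j hj
      exact extend_notMem _ _ (by simpa using hj)
    · rw [wChart, wVal, Finset.prod_eq_one, one_div]
      intro j _
      exact extend_notMem _ _ (by simp)
    · rw [extend_notMem _ _ (by simp)]
      exact one_ne_zero
  injective i j h := by simpa using h
  ne_left i := by simp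
  ne_right i := by simp
  ne i := by simp
  ne_left' := by simp
  ne_right' := by simp
  values Z h := by
    rintro ⟨i, hi⟩
    have h1 : Z.1 zInf = 1 := h _ (by simp) (by simp) (by simp) (by simp)
    have h2 : zVal Z.1 = 0 := by
      rw [zVal, Finset.prod_eq_zero (Finset.mem_univ i) hi, zero_div]
    have h3 : wVal Z.1 = (Z.1 wInf)⁻¹ := by
      rw [wVal, Finset.prod_eq_one fun j _ => h _ (by simp) (by simp) (by simp) (by simp), one_div]
    constructor
    · change (if Z.1 zInf = 0 then _ else _) = _
      rw [if_neg (by simp [h1]), h2]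
    · change (if Z.1 wInf = 0 then _ else _) = _
      rw [h3]
      rfl

theorem edgeChain_top (hl : 0 < l) : EdgeChain T l top zInf w z where
  pos := hl
  left := .topLeft
  right := .topRight
  edge := .topEdge
  edgeCone i := by
    refine ⟨rfl, by simp [Fin.ext_iff], by simp, by simp, ⟨1, one_ne_zero, ?_⟩,
      Or.inr ⟨rfl, fun p => ⟨?_, ?_, ?_⟩⟩⟩
    · ext j
      fin_cases j <;> simp [gen, Vertex.coord]
    · rw [wChart, wVal, Fintype.prod_eq_mul i.castSucc i.succ (by simp [Fin.ext_iff]),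
        extend_notMem _ _ (by simp : (wInf : Ray k l) ∉ _), div_one]
      intro j hj
      exact extend_notMem _ _ (by simpa using hj)
    · rw [zChart, zVal, Finset.prod_eq_one, one_div]
      intro j _
      exact extend_notMem _ _ (by simp)
    · rw [extend_notMem _ _ (by simp)]
      exact one_ne_zero
  injective i j h := by simpa using h
  ne_left i := by simp
  ne_right i := by simp
  ne i := by simp
  ne_left' := by simp
  ne_right' := by simp
  values Z h := by
    rintro ⟨i, hi⟩
    have h1 : Z.1 wInf = 1 := h _ (by simp) (by simp) (by simp) (by simp)
    have h2 : wVal Z.1 = 0 := by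
      rw [wVal, Finset.prod_eq_zero (Finset.mem_univ i) hi, zero_div]
    have h3 : zVal Z.1 = (Z.1 zInf)⁻¹ := by
      rw [zVal, Finset.prod_eq_one fun j _ => h _ (by simp) (by simp) (by simp) (by simp), one_div]
    constructor
    · change (if Z.1 wInf = 0 then _ else _) = _
      rw [if_neg (by simp [h1]), h2]
    · change (if Z.1 zInf = 0 then _ else _) = _
      rw [h3]
      rfl

end DoubledGross
end

/-! ### The wall is the union of the two planes. -/

theorem mainTheorem10 (k l : ℕ) (hl : 1 ≤ l) (hkl : l ≤ k)
    (T : DoubledGross.MaximalTriangulation k l) (κ : DoubledGross.ToricKahlerForm T)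
    (μ : DoubledGross.Space T → ℝ) (hμ : DoubledGross.IsMomentMap κ ![1, 0, 0] μ) :
    DoubledGross.wall μ = {b | b ∈ DoubledGross.regularBase μ ∧ (b.1 = 0 ∨ b.2.1 = 0)} := by
  open DoubledGross in
  refine Set.Subset.antisymm (fun b hb => ⟨hb.1, wall_subset hμ hb⟩) ?_
  rintro b ⟨hb, h⟩
  obtain ⟨y, hy⟩ := hb.1
  rcases h with h | h
  -- On the chain z = 0 gives b₁ = log|0-1| = 0. The inverse coordinate c of w is chosen to produce
  -- b₂, and the position on the chain produces b₃.
  · obtain ⟨c, hc⟩ := exists_invValue b.2.1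
    obtain ⟨x, hx, hz, hw, hxw⟩ := (edgeChain_bot (T := T) (hl.trans hkl)).exists_mem_wall hμ c y
    have hbx : fibration μ x = b := by
      rw [fibration, hz, hw, logDist_zero, hc, hx, hy, ← h]
    exact hbx ▸ hxw (hbx ▸ hb)
  · obtain ⟨c, hc⟩ := exists_invValue b.1
    obtain ⟨x, hx, hw, hz, hxw⟩ := (edgeChain_top (T := T) hl).exists_mem_wall hμ c y
    have hbx : fibration μ x = b := by
      rw [fibration, hz, hw, logDist_zero, hc, hx, hy, ← h]
    exact hbx ▸ hxw (hbx ▸ hb)
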